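/- For a Borel probability measure $\mu$ on $\mathbb{C}$ write $U^\mu(z)=\int\log\frac1{|z-w|}\,\mu(dw)$, $D(\mu,\mu)=\iint\log\frac1{|z-w|}\,\mu(dz)\,\mu(dw)$, $S_\mu=\operatorname{supp}\mu$; $m$ is Lebesgue measure and $\Delta=\partial_x^2+\partial_y^2$. Let $V:\mathbb{C}\to\mathbb{R}\cup\{+\infty\}$ be lower semicontinuous with $\liminf_{|z|\to\infty}\big(V(z)-(2+\varepsilon)\log|z|\big)=+\infty$ for some $\varepsilon>0$, let $\Sigma_V=\overline{\{V<\infty\}}$, and suppose that $\{V<\infty\}$ has positive logarithmic capacity, i.e. some probability measure $\mu$ carried by a compact subset of $\{V<\infty\}$ has $D(\mu,\mu)<\infty$. For a probability measure $\mu$ put $I_V(\mu)=D(\mu,\mu)+\int V\,d\mu$ (with $I_V(\mu)=+\infty$ if $\int V\,d\mu=+\infty$). An equilibrium measure of $V$ is a minimizer of $I_V$ over the probability measures supported on $\Sigma_V$. Let $\mu_V$ be an equilibrium measure of $V$, $S_V=\operatorname{supp}\mu_V$, and $F_V=I_V(\mu_V)-\frac12\int V\,d\mu_V$. Suppose that $V$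 is locally $C^{1,1}$ near $S_V$ in the following sense: there are an open $U\supset S_V$ and a function $g:U\to\mathbb{R}$, differentiable with locally Lipschitz derivative, such that $V=g$ on $U\cap\Sigma_V$ (so $V$ may be $+\infty$ off $\Sigma_V$); on $S_V$ we write $\Delta V=\Delta g$, which is defined almost everywhere. Proposition. Let $f\in C^2(\mathbb{C})$ be real-valued and bounded, with $\operatorname{supp}\Delta f\subset S_V$ and $\Delta f\le\Delta V$ almost everywhere on $S_V$. Then $\Delta f$ is integrable, $V-f$ has a unique equilibrium measure $\mu_{V-f}$, and $$\mu_{V-f}=\mu_V-\frac1{4\pi}\Delta f\,dm .$$ Moreover $S_{V-f}\subseteq S_V$; the numbers $I_V(\mu_V)$, $F_V$ and $F_{V-f}$ (defined from $V-f$ and $\mu_{V-f}$ in the same way) are finite; the effective potential is unchanged, $$U^{\mu_{V-f}}+\tfrac12(V-f)-F_{V-f}=U^{\mu_V}+\tfrac12V-F_V\quad\text{everywhere on }\mathbb{C};$$ and $$I_{V-f}(\mu_{V-f})=I_V(\mu_V)-\int f\,d\mu_V-\frac1{8\pi}\int f\,(-\Delta f)\,dm .$$ -/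

import Mathlib

open MeasureTheory Filter Topology Set
open scoped ENNReal

noncomputable section

namespace LogPotential

/-- The integral of an extended real valued function, as the difference of the integrals of its
positive and negative parts. It has its usual meaning as soon as one of the two is finite. -/
def eintegral {α : Type*} [MeasurableSpace α] (μ : Measure α) (φ : α → EReal) : EReal :=
  ((∫⁻ x, (φ x).toENNReal ∂μ : ℝ≥0∞) : EReal) - ((∫⁻ x, (-φ x).toENNReal ∂μ : ℝ≥0∞) : EReal)

open Classical in
/-- The kernel `log (1 / |z - w|)`, with value `+∞` on the diagonal. -/
def logKernel (z w : ℂ) : EReal :=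
  if z = w then ⊤ else ((Real.log (1 / ‖z - w‖) : ℝ) : EReal)

/-- The logarithmic potential `U^μ(z) = ∫ log (1 / |z - w|) μ(dw)`. -/
def logPotential (μ : Measure ℂ) (z : ℂ) : EReal :=
  eintegral μ (fun w => logKernel z w)

/-- The logarithmic energy `D(μ, μ) = ∬ log (1 / |z - w|) μ(dz) μ(dw)`. -/
def logEnergy (μ : Measure ℂ) : EReal :=
  eintegral (μ.prod μ) (fun p => logKernel p.1 p.2)

/-- `A` has positive logarithmic capacity: some probability measure carried by a compact subset
of `A` has finite logarithmic energy. -/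
def HasPositiveCapacity (A : Set ℂ) : Prop :=
  ∃ μ : Measure ℂ, IsProbabilityMeasure μ ∧
    (∃ K : Set ℂ, IsCompact K ∧ K ⊆ A ∧ μ Kᶜ = 0) ∧ logEnergy μ < ⊤

/-- `Σ_V`, the closure of `{V < ∞}`. -/
def potentialDomain (V : ℂ → EReal) : Set ℂ :=
  closure {z | V z < ⊤}

open Classical in
/-- The weighted energy `I_V(μ) = D(μ, μ) + ∫ V dμ`, understood to be `+∞` if `∫ V dμ = +∞`.
(For `V` growing faster than `2 log |z|`, if `∫ V dμ < ∞` then `log (1 + |z|)` is `μ`-integrable,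
so that `D(μ, μ)` is well defined in `(-∞, +∞]`.) -/
def energy (V : ℂ → EReal) (μ : Measure ℂ) : EReal :=
  if eintegral μ V = ⊤ then ⊤ else logEnergy μ + eintegral μ V

/-- `μ` is an equilibrium measure of `V`: it minimizes `I_V` over the Borel probability measures
supported on `Σ_V`. -/
structure IsEquilibriumMeasure (V : ℂ → EReal) (μ : Measure ℂ) : Prop where
  isProbabilityMeasure : IsProbabilityMeasure μ
  compl_domain : μ (potentialDomain V)ᶜ = 0
  energy_le : ∀ ν : Measure ℂ, IsProbabilityMeasure ν → ν (potentialDomain V)ᶜ = 0 →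
    energy V μ ≤ energy V ν

/-- The constant `F_V = I_V(μ) - (1/2) ∫ V dμ`, to be used with the equilibrium measure `μ`. -/
def equilibriumConstant (V : ℂ → EReal) (μ : Measure ℂ) : EReal :=
  energy V μ - ((1 / 2 : ℝ) : EReal) * eintegral μ V

/-- The effective potential `U^μ + V/2 - F_V`, to be used with the equilibrium measure `μ`. -/
def effectivePotential (V : ℂ → EReal) (μ : Measure ℂ) (z : ℂ) : EReal :=
  logPotential μ z + ((1 / 2 : ℝ) : EReal) * V z - equilibriumConstant V μ

/-- `V : ℂ → ℝ ∪ {+∞}` is an admissible potential: it is lower semicontinuous, it satisfies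
`liminf_{|z| → ∞} (V z - (2 + ε) log |z|) = +∞` for some `ε > 0`, and the set where it is finite
has positive capacity. -/
structure IsAdmissible (V : ℂ → EReal) : Prop where
  ne_bot : ∀ z, V z ≠ ⊥
  lowerSemicontinuous : LowerSemicontinuous V
  growth : ∃ ε : ℝ, 0 < ε ∧
    liminf (fun z : ℂ => V z - (((2 + ε) * Real.log ‖z‖ : ℝ) : EReal)) (cocompact ℂ) = ⊤
  capacity : HasPositiveCapacity {z | V z < ⊤}

/-- The perturbed potential `V - f`, for a real valued function `f`. -/
def perturb (V : ℂ → EReal) (f : ℂ → ℝ) (z : ℂ) : EReal :=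
  V z - ((f z : ℝ) : EReal)

/-- `g` is locally of class `C^{1,1}` on the open set `U`. -/
def IsLocallyC11On (g : ℂ → ℝ) (U : Set ℂ) : Prop :=
  DifferentiableOn ℝ g U ∧ LocallyLipschitzOn U (fderiv ℝ g)

end LogPotential

end

open LogPotential

/-! ### Radial integration and disc averages of the logarithmic kernel -/

namespace LogPotential

/-! A Liouville argument shows that a bounded `C²` function `f` with compactly supported Laplacian
satisfies `∫ Δf = 0` and `f(z) = c + (2π)⁻¹ ∫ log|z - w| Δf(w) dm(w)`. Hence `ν = μ - Δf/4π` has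
total mass one and `U^ν = U^μ + (f - c)/2`. In `U^ν + (V - f)/2` the function `f` cancels, so the
effective potential changes only by a constant, which the equilibrium constant absorbs. Once `ν` is
known to be positive, the Frostman conditions for `V` therefore pass to `V - f`. They single out the
minimizer because the logarithmic energy is strictly positive definite on differences of probability
measures of finite energy (`isEquilibriumMeasure_of_frostman`). That positivity comes from
Frullani's integral, which writes `-log|x|²` as a superposition of Gaussians, and from the Fourier
transform of Gaussians (`mutualEnergy_add_sub_nonneg`).

The main difficulty is the positivity of `ν`: as `Δf ≤ Δg` on the support `S` of `μ`, it suffices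
that `μ` has density at least `Δg/4π` almost everywhere on `S` (`ae_laplacian_le_rnDeriv`). Put `E =
U^μ + g/2 - F`. The variational inequality and Fatou's lemma give `E ≤ 0` everywhere on `S`, and
normalized area measures as competitors give `E ≥ 0` almost everywhere on `S`; so `E = 0` almost
everywhere there. Formally `ΔE = 0` on `S` would yield the density, but no regularity of `U^μ` is
available, so disc averages are used instead.

Off `S` the potential is harmonic and `g` is `C^{1,1}`, so `E⁺` has the sub-mean value property up
to a quadratic error. At a density point of `S`, where `E⁺` vanishes on most of each small disc,
iteration over dyadic discs gives `E⁺ = O(r²)`; feeding this back makes the integral of `E⁺` over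
suitable small discs `o(r⁴)`. On the other hand, the integral of `E - E(z₀)` over a disc is a Taylor
term in `Δg(z₀)` minus a defect controlled by `μ(B_t)/t²`. A density of `μ` below `Δg/4π` would make
this at least a positive multiple of `r⁴`, a contradiction. -/

open Real in
/-- The integral of a radial function on the plane. -/
theorem integral_radial (φ : ℝ → ℝ) :
    ∫ x : ℂ, φ ‖x‖ = 2 * π * ∫ r in Ioi (0 : ℝ), r * φ r := by
  rw [← Complex.integral_comp_polarCoord_symm, show polarCoord.target = Ioi (0 : ℝ) ×ˢ Ioo (-π) π
    from rfl]
  have h : ∫ p in Ioi (0 : ℝ) ×ˢ Ioo (-π) π, p.1 • φ ‖Complex.polarCoord.symm p‖ =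
      ∫ p in Ioi (0 : ℝ) ×ˢ Ioo (-π) π, (p.1 * φ p.1) * (1 : ℝ) := by
    refine setIntegral_congr_fun (measurableSet_Ioi.prod measurableSet_Ioo) fun p hp => ?_
    simp only [Complex.norm_polarCoord_symm, abs_of_pos (show 0 < p.1 from hp.1), smul_eq_mul,
      mul_one]
  rw [h, Measure.volume_eq_prod, setIntegral_prod_mul (fun r => r * φ r) (fun _ => (1 : ℝ))]
  have : ∫ _ in Ioo (-π) π, (1 : ℝ) = 2 * π := by
    simp [Real.pi_pos.le]
    linarith [Real.pi_pos]
  rw [this]; ring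

open Real in
/-- Integration in the plane by averaging over circles. -/
theorem integral_eq_integral_circleAverage {F : ℂ → ℝ} (hm : Measurable F) (hF : Integrable F) :
    ∫ x, F x = ∫ x : ℂ, circleAverage F 0 ‖x‖ := by
  rw [integral_radial (fun r => circleAverage F 0 r), ← Complex.integral_comp_polarCoord_symm]
  have hcm : Measurable fun p : ℝ × ℝ => Complex.polarCoord.symm p := by
    simp only [Complex.polarCoord_symm_apply]; fun_prop
  have hint : IntegrableOn (fun p : ℝ × ℝ => p.1 • F (Complex.polarCoord.symm p))
      (Ioi (0 : ℝ) ×ˢ Ioo (-π) π) := by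
    refine ⟨(measurable_fst.smul (hm.comp hcm)).aestronglyMeasurable, ?_⟩
    have := hF.hasFiniteIntegral
    rw [hasFiniteIntegral_def, ← Complex.lintegral_comp_polarCoord_symm] at this
    rw [hasFiniteIntegral_def]
    refine lt_of_le_of_lt (le_of_eq ?_) this
    refine setLIntegral_congr_fun (measurableSet_Ioi.prod measurableSet_Ioo) fun p hp => ?_
    have h0 : 0 < p.1 := hp.1
    simp only [smul_eq_mul]
    rw [enorm_mul, Real.enorm_eq_ofReal h0.le]
  rw [show polarCoord.target = Ioi (0 : ℝ) ×ˢ Ioo (-π) π from rfl, Measure.volume_eq_prod,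
    setIntegral_prod _ hint, ← integral_const_mul]
  refine setIntegral_congr_fun measurableSet_Ioi fun r hr => ?_
  -- Polar coordinates use angles in `(-π, π)`, circle averages use `[0, 2π]`; periodicity
  -- identifies the two.
  have hper : Function.Periodic (fun θ => F (circleMap 0 r θ)) (2 * π) := fun θ => by
    simp [periodic_circleMap 0 r θ]
  have h1 := hper.intervalIntegral_add_eq (-π) 0
  rw [show -π + 2 * π = π by ring, zero_add] at h1
  rw [circleAverage_def, ← h1, intervalIntegral.integral_of_le (by linarith [Real.pi_pos]),
    integral_Ioc_eq_integral_Ioo, integral_smul]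
  have h2 : ∀ θ : ℝ, F (Complex.polarCoord.symm (r, θ)) = F (circleMap 0 r θ) := fun θ => by
    simp [circleMap, Complex.exp_mul_I]
  simp only [h2, smul_eq_mul]
  field_simp

open Real in
/-- Circle averages of `log ‖x - ζ‖` around the origin. -/
theorem circleAverage_log_norm_sub (ζ : ℂ) (hζ : ζ ≠ 0) (R : ℝ) (hR : 0 < R) :
    circleAverage (fun x => Real.log ‖x - ζ‖) 0 R = Real.log ‖ζ‖ + log⁺ (R / ‖ζ‖) := by
  rw [circleAverage_log_norm_sub_const_eq_log_radius_add_posLog hR.ne']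
  have hz : 0 < ‖ζ‖ := norm_pos_iff.2 hζ
  -- The available formula is `log R + log⁺(|ζ|/R)`; the identity `log⁺ x - log⁺ x⁻¹ = log x`
  -- exchanges the roles of `R` and `|ζ|`.
  have := posLog_sub_posLog_inv (x := R / ‖ζ‖)
  rw [Real.log_div hR.ne' hz.ne', inv_div] at this
  have h2 : R⁻¹ * ‖(0 : ℂ) - ζ‖ = ‖ζ‖ / R := by rw [zero_sub, norm_neg]; field_simp
  rw [h2]; linarith

/-- The Jacobian `r` of polar coordinates absorbs the logarithmic singularity, since `log x ≤ x`. -/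
theorem mul_posLog_div_le {R r : ℝ} (hR : 0 < R) (hr : 0 < r) : r * Real.posLog (R / r) ≤ R := by
  have h1 : Real.posLog (R / r) ≤ R / r := by
    rw [Real.posLog_apply]
    exact max_le (by positivity) ((Real.log_le_sub_one_of_pos (by positivity)).trans (by linarith))
  calc r * Real.posLog (R / r) ≤ r * (R / r) := by gcongr
    _ = R := by field_simp

theorem posLog_div_eq_zero {R r : ℝ} (hR : 0 < R) (hr : R ≤ r) : Real.posLog (R / r) = 0 := by
  rw [Real.posLog_eq_zero_iff, abs_of_pos (div_pos hR (hR.trans_le hr))]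
  exact div_le_one_of_le₀ hr (hR.le.trans hr)

theorem measurable_posLog : Measurable Real.posLog := Real.continuous_posLog.measurable

/-- The truncated logarithmic kernel is integrable on the plane. -/
theorem integrable_posLog_div_norm {R : ℝ} (hR : 0 < R) :
    Integrable fun x : ℂ => Real.posLog (R / ‖x‖) := by
  rw [integrable_fun_norm_addHaar volume (f := fun r => Real.posLog (R / r))]
  simp only [Complex.finrank_real_complex, Nat.add_one_sub_one, pow_one, smul_eq_mul]
  have h1 : IntegrableOn (fun r : ℝ => r * Real.posLog (R / r)) (Ioc 0 R) := by
    refine Measure.integrableOn_of_bounded (M := R) (by simp)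
      (measurable_id.mul (measurable_posLog.comp
        (measurable_const.div measurable_id))).aestronglyMeasurable ?_
    refine (ae_restrict_iff' measurableSet_Ioc).2 (ae_of_all _ fun r hr => ?_)
    rw [Real.norm_of_nonneg (mul_nonneg hr.1.le Real.posLog_nonneg)]
    exact mul_posLog_div_le hR hr.1
  rw [← Ioc_union_Ioi_eq_Ioi hR.le]
  refine h1.union ((integrableOn_congr_fun (g := fun _ => (0 : ℝ)) (fun r hr => ?_)
    measurableSet_Ioi).2 integrableOn_zero)
  simp [posLog_div_eq_zero hR (le_of_lt hr)]

theorem log_norm_eq (x : ℂ) :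
    Real.log ‖x‖ = Real.posLog ‖x‖ - Real.posLog (1 / ‖x‖) := by
  rw [one_div, Real.posLog_sub_posLog_inv]

theorem posLog_norm_sub_le (z w : ℂ) :
    Real.posLog ‖z - w‖ ≤ Real.log (1 + ‖z‖) + Real.log (1 + ‖w‖) := by
  rw [← Real.log_mul (by positivity) (by positivity), Real.posLog_eq_log_max_one (norm_nonneg _)]
  refine Real.log_le_log (by positivity) (max_le ?_ ?_)
  · nlinarith [norm_nonneg z, norm_nonneg w]
  · nlinarith [norm_nonneg z, norm_nonneg w, norm_sub_le z w]

theorem integrableOn_log_norm_sub (ζ c : ℂ) (r : ℝ) :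
    IntegrableOn (fun x : ℂ => Real.log ‖x - ζ‖) (Metric.ball c r) := by
  simp_rw [log_norm_eq]
  refine Integrable.sub ?_ ?_
  · refine Measure.integrableOn_of_bounded
      (M := Real.log (1 + (‖c‖ + |r|)) + Real.log (1 + ‖ζ‖)) measure_ball_lt_top.ne
      (measurable_posLog.comp (by fun_prop)).aestronglyMeasurable ?_
    refine (ae_restrict_iff' measurableSet_ball).2 (ae_of_all _ fun x hx => ?_)
    rw [Real.norm_of_nonneg Real.posLog_nonneg]
    refine (posLog_norm_sub_le x ζ).trans ?_
    gcongr
    have : dist x c < r := hx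
    rw [dist_eq_norm] at this
    calc ‖x‖ = ‖c + (x - c)‖ := by ring_nf
      _ ≤ ‖c‖ + ‖x - c‖ := norm_add_le _ _
      _ ≤ _ := by gcongr; exact this.le.trans (le_abs_self r)
  · exact ((integrable_posLog_div_norm one_pos).comp_sub_right ζ).integrableOn

theorem ae_ne (ζ : ℂ) : ∀ᵐ x : ℂ, x ≠ ζ := by simp [ae_iff]

/-- Averaging over a disc replaces the logarithm by its radial average. -/
theorem setIntegral_ball_log_norm_sub {ζ : ℂ} (hζ : ζ ≠ 0) (r : ℝ) :
    ∫ x in Metric.ball (0 : ℂ) r, Real.log ‖x - ζ‖ =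
      ∫ x in Metric.ball (0 : ℂ) r, (Real.log ‖ζ‖ + Real.posLog (‖x‖ / ‖ζ‖)) := by
  rw [← integral_indicator measurableSet_ball, ← integral_indicator measurableSet_ball,
    integral_eq_integral_circleAverage
      ((show Measurable fun x : ℂ => Real.log ‖x - ζ‖ by fun_prop).indicator measurableSet_ball)
      ((integrableOn_log_norm_sub ζ 0 r).integrable_indicator measurableSet_ball)]
  refine integral_congr_ae ?_
  filter_upwards [ae_ne 0] with x hx
  have hx0 : 0 < ‖x‖ := norm_pos_iff.2 hx
  by_cases h : x ∈ Metric.ball (0 : ℂ) r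
  · rw [indicator_of_mem h, ← circleAverage_log_norm_sub ζ hζ _ hx0]
    refine Real.circleAverage_congr_sphere fun y hy => indicator_of_mem ?_ _
    simp only [abs_norm, mem_sphere_iff_norm, sub_zero, mem_ball_zero_iff] at hy h ⊢
    rwa [hy]
  · rw [indicator_of_notMem h, ← Real.circleAverage_const (0 : ℝ) (0 : ℂ) ‖x‖]
    refine Real.circleAverage_congr_sphere fun y hy => indicator_of_notMem ?_ _
    simp only [abs_norm, mem_sphere_iff_norm, sub_zero, mem_ball_zero_iff] at hy h ⊢
    rwa [hy]

end LogPotential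

/-! ### Mean value formula for `C²` functions -/

namespace LogPotential

theorem hasDerivAt_intervalIntegral_of_continuous {H H' : ℝ → ℝ → ℝ} (a b : ℝ)
    (hH : ∀ r, Continuous (H r)) (hH' : Continuous fun p : ℝ × ℝ => H' p.1 p.2)
    (hd : ∀ r θ, HasDerivAt (fun r => H r θ) (H' r θ) r) (r : ℝ) :
    HasDerivAt (fun r => ∫ θ in a..b, H r θ) (∫ θ in a..b, H' r θ) r := by
  obtain ⟨C, hC⟩ := (((isCompact_closedBall r 1).prod (isCompact_uIcc (a := a) (b := b)))).exists_bound_of_continuousOn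
    hH'.continuousOn
  refine (intervalIntegral.hasDerivAt_integral_of_dominated_loc_of_deriv_le (bound := fun _ => C)
    (Metric.closedBall_mem_nhds r one_pos) (Eventually.of_forall fun x => (hH x).aestronglyMeasurable)
    ((hH r).intervalIntegrable _ _) ?_ ?_ (by simp) ?_).2
  · exact (hH'.comp (by fun_prop : Continuous fun θ : ℝ => (r, θ))).aestronglyMeasurable
  · exact ae_of_all _ fun t ht x hx => hC (x, t) ⟨hx, uIoc_subset_uIcc ht⟩
  · exact ae_of_all _ fun t _ x _ => hd x t

theorem laplacian_eq_fderiv_fderiv (f : ℂ → ℝ) (z : ℂ) :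
    Laplacian.laplacian f z = fderiv ℝ (fderiv ℝ f) z 1 1 +
      fderiv ℝ (fderiv ℝ f) z Complex.I Complex.I := by
  rw [InnerProductSpace.laplacian_eq_iteratedFDeriv_complexPlane]
  simp [iteratedFDeriv_two_apply]

/-- The pair `e, ie` is `‖e‖` times an orthonormal frame, and a trace does not depend on the frame.
-/
theorem bilinear_add_bilinear_I_mul (B : ℂ →L[ℝ] ℂ →L[ℝ] ℝ) (e : ℂ) :
    B e e + B (Complex.I * e) (Complex.I * e) =
      ‖e‖ ^ 2 * (B 1 1 + B Complex.I Complex.I) := by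
  have h1 : e = e.re • (1 : ℂ) + e.im • Complex.I := by
    simp [Complex.re_add_im]
  have h2 : Complex.I * e = (-e.im) • (1 : ℂ) + e.re • Complex.I := by
    apply Complex.ext <;> simp
  have h3 : ‖e‖ ^ 2 = e.re ^ 2 + e.im ^ 2 := by
    rw [Complex.sq_norm, Complex.normSq_apply]; ring
  rw [h2, h3]
  conv_lhs => rw [h1]
  simp only [map_add, map_smul, add_apply, smul_apply, smul_eq_mul, Complex.add_re,
    Complex.add_im]
  simp
  ring

theorem continuous_laplacian {f : ℂ → ℝ} (hf : ContDiff ℝ 2 f) :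
    Continuous (Laplacian.laplacian f) := by
  have h2 : Continuous (fderiv ℝ (fderiv ℝ f)) :=
    (hf.fderiv_right (m := 1) (by norm_num)).continuous_fderiv (by norm_num)
  rw [show Laplacian.laplacian f = fun z => _ from funext (laplacian_eq_fderiv_fderiv f)]
  fun_prop

theorem hasDerivAt_circleMap_radius (z : ℂ) (θ r : ℝ) :
    HasDerivAt (fun r => circleMap z r θ) (Complex.exp (θ * Complex.I)) r := by
  simp only [circleMap]
  have := ((Complex.ofRealCLM.hasDerivAt (x := r)).mul_const (Complex.exp (θ * Complex.I))).const_add z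
  simpa using this

open Real in
/-- Circle averages of a `C²` function: the defect in the mean value property. -/
theorem circleAverage_sub_eq_intervalIntegral {f : ℂ → ℝ} (hf : ContDiff ℝ 2 f) (z : ℂ) {R : ℝ}
    (hR : 0 < R) :
    circleAverage f z R - f z =
      ∫ ρ in (0 : ℝ)..R, ρ * Real.log (R / ρ) * circleAverage (Laplacian.laplacian f) z ρ := by
  have hd0 : Differentiable ℝ f := hf.differentiable (by norm_num)
  have hf1 : ContDiff ℝ 1 (fderiv ℝ f) := hf.fderiv_right (by norm_num)
  have hd1 : Differentiable ℝ (fderiv ℝ f) := hf1.differentiable (by norm_num)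
  have hc1 : Continuous (fderiv ℝ f) := hf1.continuous
  have hc2 : Continuous (fderiv ℝ (fderiv ℝ f)) := hf1.continuous_fderiv (by norm_num)
  set e : ℝ → ℂ := fun θ => Complex.exp (θ * Complex.I) with he
  have hec : Continuous e := by fun_prop
  have hcm : Continuous fun p : ℝ × ℝ => circleMap z p.1 p.2 := by fun_prop
  set G : ℝ → ℝ := fun r => ∫ θ in (0 : ℝ)..2 * π, f (circleMap z r θ) with hG
  set G1 : ℝ → ℝ := fun r => ∫ θ in (0 : ℝ)..2 * π, fderiv ℝ f (circleMap z r θ) (e θ) with hG1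
  set G2 : ℝ → ℝ := fun r => ∫ θ in (0 : ℝ)..2 * π,
    fderiv ℝ (fderiv ℝ f) (circleMap z r θ) (e θ) (e θ) with hG2
  set A : ℝ → ℝ := fun r => ∫ θ in (0 : ℝ)..2 * π, Laplacian.laplacian f (circleMap z r θ) with hA
  have hsec : ∀ r, Continuous fun θ : ℝ => circleMap z r θ := fun r => by fun_prop
  have dG : ∀ r, HasDerivAt G (G1 r) r := by
    intro r
    refine hasDerivAt_intervalIntegral_of_continuous 0 (2 * π)
      (H := fun r θ => f (circleMap z r θ))
      (H' := fun r θ => fderiv ℝ f (circleMap z r θ) (e θ))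
      (fun r => hf.continuous.comp (hsec r)) ?_ ?_ r
    · exact (hc1.comp hcm).clm_apply (hec.comp continuous_snd)
    · intro r θ
      exact (hd0 _).hasFDerivAt.comp_hasDerivAt r (hasDerivAt_circleMap_radius z θ r)
  have dG1 : ∀ r, HasDerivAt G1 (G2 r) r := by
    intro r
    refine hasDerivAt_intervalIntegral_of_continuous 0 (2 * π)
      (H := fun r θ => fderiv ℝ f (circleMap z r θ) (e θ))
      (H' := fun r θ => fderiv ℝ (fderiv ℝ f) (circleMap z r θ) (e θ) (e θ))
      (fun r => (hc1.comp (hsec r)).clm_apply hec) ?_ ?_ r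
    · exact ((hc2.comp hcm).clm_apply (hec.comp continuous_snd)).clm_apply (hec.comp continuous_snd)
    · intro r θ
      exact ((hd1 _).hasFDerivAt.comp_hasDerivAt r (hasDerivAt_circleMap_radius z θ r)).clm_apply
        (hasDerivAt_const r (e θ)) |>.congr_deriv (by simp [he])
  -- The Laplacian in polar coordinates, averaged over angles. The `θ`-derivative of `Df(ie^{iθ})`
  -- is `r D²f(ie^{iθ}, ie^{iθ}) - Df(e^{iθ})` and integrates to zero by periodicity, so `G1` is the
  -- tangential part of `r A`; `r G2` is the radial part.
  have key : ∀ r, G1 r + r * G2 r = r * A r := by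
    intro r
    have hder : ∀ θ : ℝ, HasDerivAt (fun θ => fderiv ℝ f (circleMap z r θ) (Complex.I * e θ))
        (r * fderiv ℝ (fderiv ℝ f) (circleMap z r θ) (Complex.I * e θ) (Complex.I * e θ)
          - fderiv ℝ f (circleMap z r θ) (e θ)) θ := by
      intro θ
      have h1 := hasDerivAt_circleMap z r θ
      have h2 : HasDerivAt (fun θ : ℝ => Complex.I * e θ) (-e θ) θ := by
        have : HasDerivAt (fun θ : ℝ => (θ : ℂ) * Complex.I) Complex.I θ := by
          simpa using (Complex.ofRealCLM.hasDerivAt (x := θ)).mul_const Complex.I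
        refine (this.cexp.const_mul Complex.I).congr_deriv ?_
        simp only [he]
        linear_combination Complex.exp (θ * Complex.I) * Complex.I_mul_I
      refine (((hd1 _).hasFDerivAt.comp_hasDerivAt θ h1).clm_apply h2).congr_deriv ?_
      have h3 : circleMap 0 r θ * Complex.I = r • (Complex.I * e θ) := by
        simp [circleMap, he]; ring
      simp only [h3, map_smul, map_neg]
      simp
      ring
    have hcont1 : Continuous fun θ => r * fderiv ℝ (fderiv ℝ f) (circleMap z r θ)
        (Complex.I * e θ) (Complex.I * e θ) := by
      have hIe : Continuous fun θ => Complex.I * e θ := by fun_prop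
      exact continuous_const.mul (((hc2.comp (hsec r)).clm_apply hIe).clm_apply hIe)
    have hcont2 : Continuous fun θ => fderiv ℝ f (circleMap z r θ) (e θ) :=
      (hc1.comp (hsec r)).clm_apply hec
    have hcont3 : Continuous fun θ => r * fderiv ℝ (fderiv ℝ f) (circleMap z r θ) (e θ) (e θ) :=
      continuous_const.mul (((hc2.comp (hsec r)).clm_apply hec).clm_apply hec)
    have h0 := intervalIntegral.integral_eq_sub_of_hasDerivAt (a := 0) (b := 2 * π)
      (fun θ _ => hder θ) ((hcont1.sub hcont2).intervalIntegrable _ _)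
    have hper : fderiv ℝ f (circleMap z r (2 * π)) (Complex.I * e (2 * π)) -
        fderiv ℝ f (circleMap z r 0) (Complex.I * e 0) = 0 := by
      simp [circleMap, he]
    rw [hper, intervalIntegral.integral_sub (hcont1.intervalIntegrable _ _)
      (hcont2.intervalIntegrable _ _)] at h0
    have h1 : G1 r = ∫ θ in (0 : ℝ)..2 * π, r * fderiv ℝ (fderiv ℝ f) (circleMap z r θ)
        (Complex.I * e θ) (Complex.I * e θ) := by
      rw [hG1]; linarith
    rw [h1, hG2, hA]
    simp only
    rw [← intervalIntegral.integral_const_mul, ← intervalIntegral.integral_const_mul,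
      ← intervalIntegral.integral_add (hcont1.intervalIntegrable _ _)
      (hcont3.intervalIntegrable _ _)]
    refine intervalIntegral.integral_congr fun θ _ => ?_
    have := bilinear_add_bilinear_I_mul (fderiv ℝ (fderiv ℝ f) (circleMap z r θ)) (e θ)
    rw [show ‖e θ‖ = 1 from Complex.norm_exp_ofReal_mul_I θ, ← laplacian_eq_fderiv_fderiv] at this
    linear_combination r * this
  have hGc : Continuous G := continuous_iff_continuousAt.2 fun r => (dG r).continuousAt
  have hG1c : Continuous G1 := continuous_iff_continuousAt.2 fun r => (dG1 r).continuousAt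
  have hAc : Continuous A := by
    refine intervalIntegral.continuous_parametric_intervalIntegral_of_continuous'
      (f := fun r θ => Laplacian.laplacian f (circleMap z r θ)) ?_ _ _
    exact (continuous_laplacian hf).comp hcm
  have hlog : (fun ρ : ℝ => ρ * Real.log (R / ρ)) = fun ρ => ρ * Real.log R - ρ * Real.log ρ := by
    funext ρ
    rcases eq_or_ne ρ 0 with rfl | h
    · simp
    · rw [Real.log_div hR.ne' h]; ring
  have hlogc : Continuous fun ρ : ℝ => ρ * Real.log (R / ρ) := by
    rw [hlog]; exact (by fun_prop : Continuous fun ρ : ℝ => ρ * Real.log R).sub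
      Real.continuous_mul_log
  -- By `key` the primitive `ρ log(R/ρ) G1 + G` has derivative `ρ log(R/ρ) A`. Its first term
  -- vanishes at both ends: at `R` because `log 1 = 0`, at `0` because of the factor `ρ`.
  have hftc := intervalIntegral.integral_eq_sub_of_hasDerivAt_of_le hR.le
    (f := fun ρ => ρ * Real.log (R / ρ) * G1 ρ + G ρ)
    (f' := fun ρ => ρ * Real.log (R / ρ) * A ρ)
    ((hlogc.mul hG1c).add hGc).continuousOn ?_ ((hlogc.mul hAc).intervalIntegrable _ _)
  · have hG0 : G 0 = 2 * π * f z := by simp [hG]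
    simp only [div_self hR.ne', Real.log_one, mul_zero, zero_mul, zero_add, hG0] at hftc
    rw [circleAverage_def]
    simp only [circleAverage_def, smul_eq_mul]
    rw [show (fun ρ => ρ * Real.log (R / ρ) * ((2 * π)⁻¹ *
      ∫ θ in (0 : ℝ)..2 * π, Laplacian.laplacian f (circleMap z ρ θ))) =
      fun ρ => (2 * π)⁻¹ * (ρ * Real.log (R / ρ) * A ρ) by funext ρ; rw [hA]; ring,
      intervalIntegral.integral_const_mul, hftc]
    have := Real.pi_pos
    simp only [hG]
    field_simp
  · intro ρ hρ
    have h0 : 0 < ρ := hρ.1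
    have hl : HasDerivAt (fun ρ : ℝ => ρ * Real.log (R / ρ)) (Real.log (R / ρ) - 1) ρ := by
      rw [hlog]
      refine (((hasDerivAt_id ρ).mul_const _).sub (Real.hasDerivAt_mul_log h0.ne')).congr_deriv ?_
      rw [Real.log_div hR.ne' h0.ne']; ring
    refine ((hl.mul (dG1 ρ)).add (dG ρ)).congr_deriv ?_
    linear_combination Real.log (R / ρ) * key ρ

open Real in
/-- The mean value formula for `C²` functions, as an integral over the plane. -/
theorem circleAverage_sub_eq_integral {f : ℂ → ℝ} (hf : ContDiff ℝ 2 f) (z : ℂ) {R : ℝ}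
    (hR : 0 < R) :
    circleAverage f z R - f z =
      (2 * π)⁻¹ * ∫ w : ℂ, log⁺ (R / ‖w‖) * Laplacian.laplacian f (z + w) := by
  have hΔ := continuous_laplacian hf
  have hm : Measurable fun w : ℂ => log⁺ (R / ‖w‖) * Laplacian.laplacian f (z + w) :=
    (measurable_posLog.comp (by fun_prop)).mul (hΔ.measurable.comp (by fun_prop))
  obtain ⟨C, hC⟩ := (isCompact_closedBall z R).exists_bound_of_continuousOn hΔ.continuousOn
  have hint : Integrable fun w : ℂ => log⁺ (R / ‖w‖) * Laplacian.laplacian f (z + w) := by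
    refine ((integrable_posLog_div_norm hR).const_mul C).mono' hm.aestronglyMeasurable
      (ae_of_all _ fun w => ?_)
    rw [norm_mul, Real.norm_of_nonneg posLog_nonneg, mul_comm]
    rcases le_or_gt R ‖w‖ with h | h
    · simp [posLog_div_eq_zero hR h]
    · exact mul_le_mul_of_nonneg_right (hC _ (by simpa using h.le)) posLog_nonneg
  rw [integral_eq_integral_circleAverage hm hint]
  have h1 : ∀ x : ℂ, circleAverage (fun w : ℂ => log⁺ (R / ‖w‖) * Laplacian.laplacian f (z + w)) 0
      ‖x‖ = log⁺ (R / ‖x‖) * circleAverage (Laplacian.laplacian f) z ‖x‖ := by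
    intro x
    rw [← circleAverage_map_add_const (f := Laplacian.laplacian f) (c := z), ← smul_eq_mul,
      ← circleAverage_smul]
    refine circleAverage_congr_sphere fun y hy => ?_
    have hy' : ‖y‖ = ‖x‖ := by simpa using hy
    simp [hy', add_comm z]
  simp only [h1]
  rw [integral_radial (fun r => log⁺ (R / r) * circleAverage (Laplacian.laplacian f) z r),
    circleAverage_sub_eq_intervalIntegral hf z hR, intervalIntegral.integral_of_le hR.le,
    ← mul_assoc, inv_mul_cancel₀ (by positivity), one_mul, ← integral_indicator measurableSet_Ioc,
    ← integral_indicator measurableSet_Ioi]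
  congr 1
  funext r
  by_cases hr : r ∈ Ioc 0 R
  · rw [indicator_of_mem hr, indicator_of_mem (show r ∈ Ioi 0 from hr.1), posLog_eq_log]
    · ring
    · rw [abs_of_pos (div_pos hR hr.1), le_div_iff₀ hr.1, one_mul]; exact hr.2
  · rw [indicator_of_notMem hr]
    by_cases hr0 : r ∈ Ioi 0
    · have : R ≤ r := by
        by_contra h
        exact hr ⟨hr0, (not_le.1 h).le⟩
      rw [indicator_of_mem hr0, posLog_div_eq_zero hR this]; simp
    · rw [indicator_of_notMem hr0]

end LogPotential

/-! ### Liouville argument: `f` as a logarithmic potential of its Laplacian -/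

namespace LogPotential

open Real in
/-- Integration over a disc by averaging over concentric circles. -/
theorem setIntegral_ball_eq_circleAverage {F : ℂ → ℝ} (hm : Measurable F) {z : ℂ} {r : ℝ}
    (hF : IntegrableOn F (Metric.ball z r)) :
    ∫ x in Metric.ball z r, F x = ∫ x in Metric.ball (0 : ℂ) r, circleAverage F z ‖x‖ := by
  have hi := hF.integrable_indicator measurableSet_ball
  rw [← integral_indicator measurableSet_ball, ← integral_indicator measurableSet_ball,
    ← integral_add_right_eq_self _ z,
    integral_eq_integral_circleAverage (F := fun x => (Metric.ball z r).indicator F (x + z))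
      ((hm.indicator measurableSet_ball).comp (measurable_add_const z)) (hi.comp_add_right z)]
  refine integral_congr_ae (ae_of_all _ fun x => ?_)
  simp only
  by_cases h : x ∈ Metric.ball (0 : ℂ) r
  · rw [indicator_of_mem h, ← circleAverage_map_add_const (f := F)]
    refine circleAverage_congr_sphere fun y hy => indicator_of_mem ?_ _
    simp only [abs_norm, mem_sphere_iff_norm, sub_zero, Metric.mem_ball,
      dist_add_self_left, dist_zero_right] at hy h ⊢
    rwa [hy]
  · rw [indicator_of_notMem h, ← circleAverage_const (0 : ℝ) (0 : ℂ) ‖x‖]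
    refine circleAverage_congr_sphere fun y hy => indicator_of_notMem ?_ _
    simp only [abs_norm, mem_sphere_iff_norm, sub_zero, Metric.mem_ball,
      dist_add_self_left, dist_zero_right] at hy h ⊢
    rwa [hy]

theorem abs_circleAverage_le {f : ℂ → ℝ} {C : ℝ} (hf : Continuous f) (hC : ∀ z, |f z| ≤ C) (z : ℂ)
    (R : ℝ) : |Real.circleAverage f z R| ≤ C := by
  refine (Real.abs_circleAverage_le_circleAverage_abs).trans ?_
  refine Real.circleAverage_mono_on_of_le_circle ?_ fun x _ => hC x
  exact hf.abs.continuousOn.circleIntegrable' 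

theorem volume_real_ball (z : ℂ) {r : ℝ} (hr : 0 ≤ r) :
    volume.real (Metric.ball z r) = Real.pi * r ^ 2 := by
  rw [Measure.real, Complex.volume_ball]
  simp [hr, mul_comm]

/-- Discs of equal large radius have almost the same integrals of a bounded function. -/
theorem abs_setIntegral_ball_sub_le {f : ℂ → ℝ} {C : ℝ} (hf : Continuous f) (hC : ∀ z, |f z| ≤ C)
    (z : ℂ) {r : ℝ} (hr : ‖z‖ ≤ r) :
    |(∫ x in Metric.ball z r, f x) - ∫ x in Metric.ball (0 : ℂ) (r - ‖z‖), f x| ≤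
      C * (2 * Real.pi * r * ‖z‖) := by
  have hsub : Metric.ball (0 : ℂ) (r - ‖z‖) ⊆ Metric.ball z r := by
    refine Metric.ball_subset_ball' ?_
    simp
  have hfi : IntegrableOn f (Metric.ball z r) :=
    Measure.integrableOn_of_bounded measure_ball_lt_top.ne hf.aestronglyMeasurable
      (ae_of_all _ hC)
  have hd := setIntegral_sdiff measurableSet_ball hfi hsub
  rw [← hd]
  have hC0 : 0 ≤ C := (abs_nonneg _).trans (hC 0)
  refine (norm_setIntegral_le_of_norm_le_const (f := f) (C := C)
    ((measure_mono sdiff_subset).trans_lt measure_ball_lt_top) fun x _ => hC x).trans ?_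
  rw [measureReal_sdiff hsub measurableSet_ball,
    volume_real_ball _ ((norm_nonneg z).trans hr), volume_real_ball _ (by linarith)]
  refine mul_le_mul_of_nonneg_left ?_ hC0
  nlinarith [mul_nonneg Real.pi_pos.le (sq_nonneg ‖z‖)]

/-- In concentric circles, only radii below `R₀` contribute to the difference, so the error does not
grow with `r`. -/
theorem abs_setIntegral_ball_sub_const_le {f : ℂ → ℝ} {C : ℝ} (hf : Continuous f)
    (hC : ∀ z, |f z| ≤ C) {z : ℂ} {H R₀ r : ℝ} (hR₀ : 0 ≤ R₀) (hH : |H| ≤ C)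
    (hav : ∀ R, R₀ ≤ R → Real.circleAverage f z R = H) (hr : R₀ ≤ r) :
    |(∫ x in Metric.ball z r, f x) - Real.pi * r ^ 2 * H| ≤ 2 * C * (Real.pi * R₀ ^ 2) := by
  have hfi : IntegrableOn f (Metric.ball z r) :=
    Measure.integrableOn_of_bounded measure_ball_lt_top.ne hf.aestronglyMeasurable
      (ae_of_all _ hC)
  have hc : Continuous fun x : ℂ => Real.circleAverage f z ‖x‖ := (Real.Continuous.circleAverage hf).comp continuous_norm
  have hci : IntegrableOn (fun x : ℂ => Real.circleAverage f z ‖x‖) (Metric.ball 0 r) :=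
    Measure.integrableOn_of_bounded measure_ball_lt_top.ne hc.aestronglyMeasurable
      (ae_of_all _ fun x => abs_circleAverage_le hf hC z ‖x‖)
  have h1 : Real.pi * r ^ 2 * H = ∫ _ in Metric.ball (0 : ℂ) r, H := by
    rw [setIntegral_const, volume_real_ball _ (hR₀.trans hr), smul_eq_mul]
  rw [setIntegral_ball_eq_circleAverage hf.measurable hfi, h1,
    ← integral_sub hci (integrableOn_const measure_ball_lt_top.ne),
    setIntegral_eq_of_subset_of_forall_sdiff_eq_zero (s := Metric.ball 0 R₀) measurableSet_ball
      (Metric.ball_subset_ball hr), ← volume_real_ball (0 : ℂ) hR₀]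
  · rw [← Real.norm_eq_abs]
    refine norm_setIntegral_le_of_norm_le_const measure_ball_lt_top fun x _ => ?_
    refine (norm_sub_le _ _).trans ?_
    have := abs_circleAverage_le hf hC z ‖x‖
    simp only [Real.norm_eq_abs]
    linarith
  · intro x hx
    have : R₀ ≤ ‖x‖ := by simpa using hx.2
    simp [hav _ this]

/-- A bounded continuous function whose circle averages stabilise has a constant limit. -/
theorem eq_of_circleAverage_eventually_const {f H : ℂ → ℝ} {C : ℝ} (hf : Continuous f)
    (hC : ∀ z, |f z| ≤ C) (hav : ∀ z, ∃ R₀, 0 ≤ R₀ ∧ ∀ R, R₀ ≤ R → Real.circleAverage f z R = H z)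
    (z : ℂ) : H z = H 0 := by
  have hHb : ∀ z, |H z| ≤ C := fun z => by
    obtain ⟨R₀, _, h⟩ := hav z
    rw [← h R₀ le_rfl]; exact abs_circleAverage_le hf hC z R₀
  obtain ⟨R₁, h10, h1⟩ := hav z
  obtain ⟨R₂, h20, h2⟩ := hav 0
  set a := 2 * C * (Real.pi * R₁ ^ 2) + 2 * C * (Real.pi * R₂ ^ 2) + C * Real.pi * ‖z‖ ^ 2 with ha
  set b := 4 * C * Real.pi * ‖z‖ with hb
  have hC0 : 0 ≤ C := (abs_nonneg _).trans (hC 0)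
  -- As in the disc proof of Liouville's theorem: the discs about `z` and `0` differ by an annular
  -- region of area `O(r)`, while their integrals are `πr² H z` and `π(r - ‖z‖)² H 0` up to bounded
  -- errors. Division by `r²` leaves `a/r² + b/r`.
  have key : ∀ᶠ r : ℝ in atTop, Real.pi * |H z - H 0| ≤ a / r ^ 2 + b / r := by
    filter_upwards [eventually_ge_atTop (R₁ + R₂ + ‖z‖ + 1)] with r hr
    have hz := norm_nonneg z
    have e1 := abs_setIntegral_ball_sub_const_le hf hC h10 (hHb z) h1 (r := r) (by linarith)
    have e2 := abs_setIntegral_ball_sub_const_le hf hC h20 (hHb 0) h2 (r := r - ‖z‖) (by linarith)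
    have e3 := abs_setIntegral_ball_sub_le hf hC z (r := r) (by linarith)
    have hr0 : 0 < r := by linarith
    have e4 : Real.pi * r ^ 2 * |H z - H 0| ≤ a + b * r := by
      have hH := hHb 0
      rw [show Real.pi * r ^ 2 * |H z - H 0| = |Real.pi * r ^ 2 * (H z - H 0)| by
        rw [abs_mul, abs_of_nonneg (a := Real.pi * r ^ 2) (by positivity)]]
      have e5 : |Real.pi * (2 * r * ‖z‖ - ‖z‖ ^ 2) * H 0| ≤
          Real.pi * (2 * r * ‖z‖ + ‖z‖ ^ 2) * C := by
        rw [abs_mul]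
        refine mul_le_mul ?_ hH (abs_nonneg _) (by positivity)
        rw [abs_mul, abs_of_pos Real.pi_pos]
        refine mul_le_mul_of_nonneg_left ?_ Real.pi_pos.le
        rw [abs_le]
        constructor <;> nlinarith [mul_nonneg hr0.le hz, sq_nonneg ‖z‖]
      rw [abs_le] at *
      constructor <;> nlinarith
    rw [div_add_div _ _ (by positivity) hr0.ne', le_div_iff₀ (by positivity)]
    nlinarith
  have hlim : Tendsto (fun r : ℝ => a / r ^ 2 + b / r) atTop (𝓝 (0 + 0)) :=
    (tendsto_const_nhds.div_atTop (tendsto_pow_atTop two_ne_zero)).add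
      (tendsto_const_nhds.div_atTop tendsto_id)
  have h0 := ge_of_tendsto hlim key
  rw [add_zero] at h0
  have : |H z - H 0| ≤ 0 := by
    by_contra h
    push Not at h
    nlinarith [mul_pos Real.pi_pos h]
  linarith [abs_nonpos_iff.1 this]

theorem integrable_log_norm_sub_mul {h : ℂ → ℝ} (hc : Continuous h) (hs : HasCompactSupport h)
    (z : ℂ) : Integrable fun w : ℂ => Real.log ‖z - w‖ * h w := by
  obtain ⟨ρ, hρ⟩ := hs.isCompact.isBounded.subset_closedBall 0
  obtain ⟨B, hB⟩ := hs.exists_bound_of_continuous hc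
  have h1 : IntegrableOn (fun w : ℂ => Real.log ‖w - z‖) (Metric.ball 0 (ρ + 1)) :=
    integrableOn_log_norm_sub z 0 (ρ + 1)
  have h2 := (h1.integrable_indicator measurableSet_ball).mul_bdd (c := B)
    hc.aestronglyMeasurable (ae_of_all _ hB)
  refine h2.congr (ae_of_all _ fun w => ?_)
  by_cases hw : w ∈ Metric.ball (0 : ℂ) (ρ + 1)
  · simp [indicator_of_mem hw, norm_sub_rev]
  · have : h w = 0 := by
      by_contra hne
      have h3 := mem_closedBall_zero_iff.1 (hρ (subset_tsupport h hne))
      rw [mem_ball_zero_iff] at hw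
      linarith
    simp [this]

open Real in
/-- A bounded `C²` function with compactly supported Laplacian is, up to a constant, the
logarithmic potential of its Laplacian, which has total mass zero. -/
theorem exists_eq_const_add_log_potential {f : ℂ → ℝ} {C : ℝ} (hf : ContDiff ℝ 2 f)
    (hC : ∀ z, |f z| ≤ C) (hs : HasCompactSupport (Laplacian.laplacian f)) :
    ∫ w, Laplacian.laplacian f w = 0 ∧
      ∃ c, ∀ z, f z = c + (2 * π)⁻¹ * ∫ w, Real.log ‖z - w‖ * Laplacian.laplacian f w := by
  set h := Laplacian.laplacian f with hh
  have hc : Continuous h := continuous_laplacian hf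
  have hint : Integrable h := hc.integrable_of_hasCompactSupport hs
  obtain ⟨ρ, hρ⟩ := hs.isCompact.isBounded.subset_closedBall 0
  have hsupp : ∀ w, ρ < ‖w‖ → h w = 0 := fun w hw => by
    by_contra hne
    have := hρ (subset_tsupport h hne)
    simp at this; linarith
  have hlogint := integrable_log_norm_sub_mul hc hs
  set L : ℂ → ℝ := fun z => ∫ w, Real.log ‖z - w‖ * h w with hL
  -- Once the circle about `z` encloses the support of the Laplacian, `log⁺(R/‖w‖)` may be replaced
  -- by `log R - log‖w‖` there.
  have hR : ∀ z R, 0 < R → ρ + ‖z‖ ≤ R →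
      circleAverage f z R = f z + (2 * π)⁻¹ * (Real.log R * ∫ w, h w) - (2 * π)⁻¹ * L z := by
    intro z R hR0 hzR
    have e := circleAverage_sub_eq_integral hf z hR0
    have e2 : ∫ w : ℂ, log⁺ (R / ‖w‖) * h (z + w) =
        ∫ w : ℂ, (Real.log R * h w - Real.log ‖z - w‖ * h w) := by
      rw [← integral_add_left_eq_self (fun w => Real.log R * h w - Real.log ‖z - w‖ * h w) z]
      refine integral_congr_ae ?_
      filter_upwards [ae_ne 0] with w hw
      have hw0 : 0 < ‖w‖ := norm_pos_iff.2 hw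
      rw [show z - (z + w) = -w by ring, norm_neg]
      by_cases hne : h (z + w) = 0
      · simp [hne]
      · have h1 : ‖z + w‖ ≤ ρ := by
          by_contra hcon
          exact hne (hsupp _ (not_le.1 hcon))
        have h2 : ‖w‖ ≤ R := by
          calc ‖w‖ = ‖(z + w) - z‖ := by ring_nf
            _ ≤ ‖z + w‖ + ‖z‖ := norm_sub_le _ _
            _ ≤ R := by linarith
        rw [posLog_eq_log, Real.log_div hR0.ne' hw0.ne']
        · ring
        · rw [abs_of_pos (div_pos hR0 hw0), le_div_iff₀ hw0, one_mul]; exact h2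
    rw [e2, integral_sub (hint.const_mul _) (hlogint z), integral_const_mul] at e
    rw [hL]
    linear_combination e
  -- All other terms in `hR` stay bounded as `R → ∞`, so the coefficient of `log R` must vanish.
  have hT : ∫ w, h w = 0 := by
    by_contra hne
    have hb : ∀ᶠ R : ℝ in atTop, |(2 * π)⁻¹ * (Real.log R * ∫ w, h w)| ≤
        2 * C + |(2 * π)⁻¹ * L 0| := by
      filter_upwards [eventually_ge_atTop (ρ + ‖(0 : ℂ)‖), eventually_gt_atTop 0] with R h1 h2
      have e := hR 0 R h2 h1
      have e1 := abs_circleAverage_le hf.continuous hC 0 R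
      have e2 := hC 0
      rw [show (2 * π)⁻¹ * (Real.log R * ∫ w, h w) =
        circleAverage f 0 R - f 0 + (2 * π)⁻¹ * L 0 by rw [e]; ring]
      refine (abs_add_le _ _).trans ?_
      have := abs_sub (circleAverage f 0 R) (f 0)
      linarith
    have ht : Tendsto (fun R : ℝ => |(2 * π)⁻¹ * (Real.log R * ∫ w, h w)|) atTop atTop := by
      simp_rw [abs_mul]
      refine Tendsto.const_mul_atTop (by positivity) ?_
      exact (tendsto_abs_atTop_atTop.comp Real.tendsto_log_atTop).atTop_mul_const
        (abs_pos.2 hne)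
    obtain ⟨R, h1, h2⟩ := (hb.and (ht.eventually_gt_atTop (2 * C + |(2 * π)⁻¹ * L 0|))).exists
    linarith
  refine ⟨hT, f 0 - (2 * π)⁻¹ * L 0, fun z => ?_⟩
  -- With mass zero the circle averages stabilize at `f - (2π)⁻¹ L`, which is therefore constant.
  have := eq_of_circleAverage_eventually_const (H := fun z => f z - (2 * π)⁻¹ * L z)
    hf.continuous hC (fun z => ⟨max 1 (ρ + ‖z‖), by positivity, fun R hR1 => by
      rw [hR z R (lt_of_lt_of_le one_pos (le_trans (le_max_left _ _) hR1))
        ((le_max_right _ _).trans hR1), hT]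
      ring⟩) z
  linarith

end LogPotential

/-! ### Gaussian energies and their positivity -/

namespace LogPotential

/-- The mutual Gaussian energy of two measures. -/
noncomputable def gaussianEnergy (t : ℝ) (α β : Measure ℂ) : ℝ :=
  ∫ p, Real.exp (-(t * ‖p.1 - p.2‖ ^ 2)) ∂(α.prod β)

theorem integrable_cexp_neg_mul_sq_norm {b : ℝ} (hb : 0 < b) :
    Integrable fun ξ : ℂ => Complex.exp (-b * ‖ξ‖ ^ 2) := by
  have := GaussianFourier.integrable_cexp_neg_mul_sq_norm_add (V := ℂ) (b := b) (by simpa using hb) 0 0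
  simpa using this

-- The Fourier transform of `exp(-‖v‖²/4t)` is `4πt exp(-t‖x‖²)`. Inserting this integral for the
-- kernel and exchanging integrals splits the double integral over `α` and `β` into characteristic
-- functions.
open ComplexConjugate in
open scoped RealInnerProductSpace in
theorem gaussianEnergy_eq (α β : Measure ℂ) [IsProbabilityMeasure α] [IsProbabilityMeasure β]
    {t : ℝ} (ht : 0 < t) :
    ((gaussianEnergy t α β : ℝ) : ℂ) * (4 * Real.pi * t) =
      ∫ ξ : ℂ, Complex.exp (-((4 * t)⁻¹ : ℝ) * ‖ξ‖ ^ 2) *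
        (charFun α ξ * conj (charFun β ξ)) := by
  set b : ℝ := (4 * t)⁻¹ with hb
  have hb0 : 0 < b := by positivity
  have h1 : ∀ x : ℂ, ∫ v : ℂ, Complex.exp (-b * ‖v‖ ^ 2 + Complex.I * ⟪x, v⟫) =
      (Real.exp (-(t * ‖x‖ ^ 2)) : ℂ) * (4 * Real.pi * t) := by
    intro x
    rw [GaussianFourier.integral_cexp_neg_mul_sq_norm_add (by simpa using hb0)]
    have hbt : (b : ℂ) = (4 * (t : ℂ))⁻¹ := by rw [hb]; push_cast; ring
    have ht' : (t : ℂ) ≠ 0 := by exact_mod_cast ht.ne'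
    simp only [Complex.finrank_real_complex, Complex.I_sq, hbt]
    norm_num
    field_simp
  rw [gaussianEnergy, ← integral_complex_ofReal, ← integral_mul_const]
  simp_rw [← h1]
  rw [integral_integral_swap]
  · refine integral_congr_ae (ae_of_all _ fun ξ => ?_)
    simp only
    have h2 : ∀ p : ℂ × ℂ, Complex.exp (-b * ‖ξ‖ ^ 2 + Complex.I * ⟪p.1 - p.2, ξ⟫) =
        Complex.exp (-b * ‖ξ‖ ^ 2) * (Complex.exp (⟪p.1, ξ⟫ * Complex.I) *
          Complex.exp (⟪p.2, -ξ⟫ * Complex.I)) := by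
      intro p
      rw [← Complex.exp_add, ← Complex.exp_add, inner_sub_left, inner_neg_right]
      congr 1
      push_cast
      ring
    simp_rw [h2]
    rw [integral_const_mul, integral_prod_mul (fun z => Complex.exp (⟪z, ξ⟫ * Complex.I))
      (fun w => Complex.exp (⟪w, -ξ⟫ * Complex.I)), ← charFun_apply, ← charFun_apply, charFun_neg]
  · have h3 : Integrable (fun q : (ℂ × ℂ) × ℂ => (1 : ℂ) * Complex.exp (-b * ‖q.2‖ ^ 2))
        ((α.prod β).prod volume) :=
      (integrable_const (1 : ℂ)).mul_prod (integrable_cexp_neg_mul_sq_norm hb0)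
    refine h3.mono (by fun_prop) (ae_of_all _ fun q => ?_)
    simp only [Function.uncurry]
    rw [Complex.exp_add, norm_mul, one_mul, mul_comm Complex.I, Complex.norm_exp_ofReal_mul_I,
      mul_one]

/-- The Gaussian energy of the difference of two measures. -/
noncomputable def gaussianDefect (t : ℝ) (α β : Measure ℂ) : ℝ :=
  gaussianEnergy t α α + gaussianEnergy t β β - 2 * gaussianEnergy t α β

/-- Polarization `|a|² + |b|² - 2 Re(a b̄) = |a - b|²` under the Fourier integral. -/
theorem gaussianDefect_mul (α β : Measure ℂ) [IsProbabilityMeasure α] [IsProbabilityMeasure β]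
    {t : ℝ} (ht : 0 < t) :
    gaussianDefect t α β * (4 * Real.pi * t) =
      ∫ ξ : ℂ, Real.exp (-((4 * t)⁻¹ * ‖ξ‖ ^ 2)) * ‖charFun α ξ - charFun β ξ‖ ^ 2 := by
  have hb0 : 0 < (4 * t)⁻¹ := by positivity
  have hi : ∀ (γ δ : Measure ℂ) [IsProbabilityMeasure γ] [IsProbabilityMeasure δ],
      Integrable fun ξ : ℂ => Complex.exp (-((4 * t)⁻¹ : ℝ) * ‖ξ‖ ^ 2) *
        (charFun γ ξ * (starRingEnd ℂ) (charFun δ ξ)) := by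
    intro γ δ _ _
    refine (integrable_cexp_neg_mul_sq_norm hb0).mul_bdd (c := 1) ?_ (ae_of_all _ fun ξ => ?_)
    · have : Measurable fun ξ : ℂ => charFun γ ξ * (starRingEnd ℂ) (charFun δ ξ) := by
        have := measurable_charFun (μ := γ)
        have := measurable_charFun (μ := δ)
        have := Complex.continuous_conj.measurable
        fun_prop
      exact this.aestronglyMeasurable
    · rw [norm_mul, RCLike.norm_conj]
      exact mul_le_one₀ (norm_charFun_le_one ξ) (norm_nonneg _) (norm_charFun_le_one ξ)
  have hre : ∀ (γ δ : Measure ℂ) [IsProbabilityMeasure γ] [IsProbabilityMeasure δ],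
      gaussianEnergy t γ δ * (4 * Real.pi * t) = ∫ ξ : ℂ,
        (Complex.exp (-((4 * t)⁻¹ : ℝ) * ‖ξ‖ ^ 2) *
        (charFun γ ξ * (starRingEnd ℂ) (charFun δ ξ))).re := by
    intro γ δ _ _
    have := congrArg Complex.re (gaussianEnergy_eq γ δ ht)
    rw [← RCLike.re_eq_complex_re, ← integral_re (hi γ δ)] at this
    refine Eq.trans ?_ this
    simp [← Complex.ofReal_ofNat, ← Complex.ofReal_mul]
  have hir : ∀ (γ δ : Measure ℂ) [IsProbabilityMeasure γ] [IsProbabilityMeasure δ],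
      Integrable fun ξ : ℂ => (Complex.exp (-((4 * t)⁻¹ : ℝ) * ‖ξ‖ ^ 2) *
        (charFun γ ξ * (starRingEnd ℂ) (charFun δ ξ))).re := fun γ δ _ _ => (hi γ δ).re
  have hsub := integral_sub ((hir α α).add (hir β β)) ((hir α β).const_mul 2)
  simp only [Pi.add_apply] at hsub
  rw [gaussianDefect, sub_mul, add_mul, mul_assoc 2, hre α α, hre β β, hre α β,
    ← integral_const_mul, ← integral_add (hir α α) (hir β β), ← hsub]
  refine integral_congr_ae (ae_of_all _ fun ξ => ?_)
  have he : Complex.exp (-((4 * t)⁻¹ : ℝ) * ‖ξ‖ ^ 2) =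
      ((Real.exp (-((4 * t)⁻¹ * ‖ξ‖ ^ 2)) : ℝ) : ℂ) := by push_cast; ring_nf
  simp only [he, Complex.re_ofReal_mul]
  rw [Complex.sq_norm (charFun α ξ - charFun β ξ), Complex.normSq_apply]
  simp only [Complex.mul_re, Complex.conj_re, Complex.conj_im, Complex.sub_re, Complex.sub_im]
  ring

theorem gaussianDefect_nonneg (α β : Measure ℂ) [IsProbabilityMeasure α] [IsProbabilityMeasure β]
    {t : ℝ} (ht : 0 < t) : 0 ≤ gaussianDefect t α β := by
  have h := gaussianDefect_mul α β ht
  have h0 : 0 ≤ gaussianDefect t α β * (4 * Real.pi * t) := by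
    rw [h]; exact integral_nonneg fun ξ => by positivity
  exact nonneg_of_mul_nonneg_left h0 (by positivity)

/-- The integrand of `gaussianDefect_mul` is continuous and nonnegative; if its integral is zero,
the characteristic functions agree everywhere, not only almost everywhere. -/
theorem eq_of_gaussianDefect_eq_zero (α β : Measure ℂ) [IsProbabilityMeasure α]
    [IsProbabilityMeasure β] {t : ℝ} (ht : 0 < t) (h : gaussianDefect t α β = 0) : α = β := by
  have hm := gaussianDefect_mul α β ht
  have hca := continuous_charFun (μ := α)
  have hcb := continuous_charFun (μ := β)
  rw [h, zero_mul] at hm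
  have hcont : Continuous fun ξ : ℂ =>
      Real.exp (-((4 * t)⁻¹ * ‖ξ‖ ^ 2)) * ‖charFun α ξ - charFun β ξ‖ ^ 2 := by fun_prop
  have hint : Integrable fun ξ : ℂ =>
      Real.exp (-((4 * t)⁻¹ * ‖ξ‖ ^ 2)) * ‖charFun α ξ - charFun β ξ‖ ^ 2 := by
    refine ((integrable_cexp_neg_mul_sq_norm (b := (4 * t)⁻¹) (by positivity)).norm.mul_const
      4).mono' hcont.aestronglyMeasurable (ae_of_all _ fun ξ => ?_)
    rw [Real.norm_of_nonneg (by positivity), Complex.norm_exp]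
    have h1 : ‖charFun α ξ - charFun β ξ‖ ≤ 2 := by
      refine (norm_sub_le _ _).trans ?_
      linarith [norm_charFun_le_one (μ := α) ξ, norm_charFun_le_one (μ := β) ξ]
    have h2 : ‖charFun α ξ - charFun β ξ‖ ^ 2 ≤ 4 := by
      nlinarith [norm_nonneg (charFun α ξ - charFun β ξ)]
    have h3 : (-(((4 * t)⁻¹ : ℝ) : ℂ) * (‖ξ‖ : ℂ) ^ 2).re = -((4 * t)⁻¹ * ‖ξ‖ ^ 2) := by
      rw [← Complex.ofReal_pow, ← Complex.ofReal_neg, ← Complex.ofReal_mul, Complex.ofReal_re]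
      ring
    rw [h3]
    gcongr
  have hz := (integral_eq_zero_iff_of_nonneg (fun ξ => by positivity) hint).1 hm.symm
  have hz' := hcont.ae_eq_iff_eq volume continuous_const |>.1 hz
  refine Measure.ext_of_charFun (funext fun ξ => ?_)
  have := congrFun hz' ξ
  have h4 : Real.exp (-((4 * t)⁻¹ * ‖ξ‖ ^ 2)) * ‖charFun α ξ - charFun β ξ‖ ^ 2 = 0 := this
  rw [mul_eq_zero, or_iff_right (Real.exp_ne_zero _)] at h4
  exact sub_eq_zero.1 (norm_eq_zero.1 (pow_eq_zero_iff two_ne_zero |>.1 h4))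

end LogPotential

/-! ### From Gaussians to the logarithm by Frullani's integral -/

namespace LogPotential

/-- Near `0` the difference of exponentials is `O(t)` and cancels `t⁻¹`; on `(1, ∞)` both
exponentials decay. -/
theorem integrableOn_frullani {a : ℝ} (ha : 0 < a) :
    IntegrableOn (fun t : ℝ => t⁻¹ * (Real.exp (-(a * t)) - Real.exp (-(1 * t)))) (Ioi 0) := by
  have hm : Measurable fun t : ℝ => t⁻¹ * (Real.exp (-(a * t)) - Real.exp (-(1 * t))) := by
    fun_prop
  rw [← Ioc_union_Ioi_eq_Ioi zero_le_one]
  refine IntegrableOn.union ?_ ?_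
  · refine Measure.integrableOn_of_bounded (M := a + 1) (by simp) hm.aestronglyMeasurable
      ((ae_restrict_iff' measurableSet_Ioc).2 (ae_of_all _ fun t ht => ?_))
    have ht0 : 0 < t := ht.1
    rw [norm_mul, norm_inv, Real.norm_of_nonneg ht0.le, inv_mul_le_iff₀ ht0, Real.norm_eq_abs,
      abs_le]
    have h1 := Real.add_one_le_exp (-(a * t))
    have h2 := Real.add_one_le_exp (-(1 * t))
    have h3 : Real.exp (-(a * t)) ≤ 1 := Real.exp_le_one_iff.2 (by nlinarith)
    have h4 : Real.exp (-(1 * t)) ≤ 1 := Real.exp_le_one_iff.2 (by nlinarith)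
    constructor <;> nlinarith
  · have h1 : IntegrableOn (fun t : ℝ => Real.exp (-a * t) + Real.exp (-1 * t)) (Ioi 1) :=
      (integrableOn_exp_mul_Ioi (by linarith) 1).add (integrableOn_exp_mul_Ioi (by norm_num) 1)
    refine h1.mono' hm.aestronglyMeasurable
      ((ae_restrict_iff' measurableSet_Ioi).2 (ae_of_all _ fun t ht => ?_))
    have ht1 : 1 < t := ht
    rw [norm_mul, norm_inv, Real.norm_of_nonneg (by linarith : (0 : ℝ) ≤ t)]
    have h2 : t⁻¹ ≤ 1 := inv_le_one_of_one_le₀ ht1.le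
    have h3 : ‖Real.exp (-(a * t)) - Real.exp (-(1 * t))‖ ≤
        Real.exp (-a * t) + Real.exp (-1 * t) := by
      refine (norm_sub_le _ _).trans ?_
      rw [Real.norm_of_nonneg (Real.exp_pos _).le, Real.norm_of_nonneg (Real.exp_pos _).le]
      simp [neg_mul]
    calc _ ≤ 1 * _ := mul_le_mul h2 h3 (norm_nonneg _) zero_le_one
      _ = _ := one_mul _

theorem integral_frullani {a : ℝ} (ha : 0 < a) :
    ∫ t in Ioi (0 : ℝ), t⁻¹ * (Real.exp (-(a * t)) - Real.exp (-(1 * t))) = -Real.log a := by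
  have hc : Continuous fun t : ℝ => Real.exp (-t) := by fun_prop
  have := Frullani.integral_Ioi_eq (f := fun t : ℝ => Real.exp (-t)) (L := 1) (R := 0) (a := a)
    (b := 1) (hc.locallyIntegrable.locallyIntegrableOn _) ha one_pos
    (by simpa using (hc.tendsto 0).mono_left nhdsWithin_le_nhds)
    (Real.tendsto_exp_neg_atTop_nhds_zero) (integrableOn_frullani ha)
  simpa using this

/-- The integrand has a constant sign, decided by whether `a ≤ 1`. This gives the absolute bound
needed for Fubini. -/
theorem integral_abs_frullani {a : ℝ} (ha : 0 < a) :
    ∫ t in Ioi (0 : ℝ), |t⁻¹ * (Real.exp (-(a * t)) - Real.exp (-(1 * t)))| = |Real.log a| := by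
  rcases le_total a 1 with h | h
  · rw [abs_of_nonpos (Real.log_nonpos ha.le h), ← integral_frullani ha]
    refine setIntegral_congr_fun measurableSet_Ioi fun t ht => abs_of_nonneg ?_
    have ht0 : 0 < t := ht
    refine mul_nonneg (by positivity) (sub_nonneg.2 (Real.exp_le_exp.2 ?_))
    nlinarith
  · rw [abs_of_nonneg (Real.log_nonneg h), ← neg_neg (Real.log a), ← integral_frullani ha,
      ← integral_neg]
    refine setIntegral_congr_fun measurableSet_Ioi fun t ht => abs_of_nonpos ?_
    have ht0 : 0 < t := ht
    refine mul_nonpos_of_nonneg_of_nonpos (by positivity) (sub_nonpos.2 (Real.exp_le_exp.2 ?_))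
    nlinarith

/-- The mutual logarithmic energy of two measures, as a real number. -/
noncomputable def mutualEnergy (α β : Measure ℂ) : ℝ :=
  ∫ p, -Real.log ‖p.1 - p.2‖ ∂(α.prod β)

/-- Frullani with `a = ‖x‖²` reads `-2 log‖x‖ = ∫ t⁻¹ (exp(-t‖x‖²) - exp(-t)) dt`; integrate over
the product measure. The factor `2` comes from the square. -/
theorem mutualEnergy_eq_integral (α β : Measure ℂ) [IsProbabilityMeasure α]
    [IsProbabilityMeasure β] (hi : Integrable (fun p : ℂ × ℂ => Real.log ‖p.1 - p.2‖) (α.prod β))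
    (hd : ∀ᵐ p ∂(α.prod β), p.1 ≠ p.2) :
    IntegrableOn (fun t => t⁻¹ * (gaussianEnergy t α β - Real.exp (-t))) (Ioi 0) ∧
    2 * mutualEnergy α β = ∫ t in Ioi (0 : ℝ), t⁻¹ * (gaussianEnergy t α β - Real.exp (-t)) := by
  set k : (ℂ × ℂ) → ℝ → ℝ := fun p t =>
    t⁻¹ * (Real.exp (-(‖p.1 - p.2‖ ^ 2 * t)) - Real.exp (-(1 * t))) with hk
  have hkm : Measurable (Function.uncurry k) := by
    simp only [hk, Function.uncurry_def]; fun_prop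
  have hlog : ∀ p : ℂ × ℂ, p.1 ≠ p.2 → 0 < ‖p.1 - p.2‖ ^ 2 := fun p hp =>
    pow_pos (norm_pos_iff.2 (sub_ne_zero.2 hp)) 2
  have hint : Integrable (Function.uncurry k) ((α.prod β).prod (volume.restrict (Ioi 0))) := by
    rw [integrable_prod_iff hkm.aestronglyMeasurable]
    refine ⟨hd.mono fun p hp => integrableOn_frullani (hlog p hp), ?_⟩
    refine (hi.abs.const_mul 2).congr (hd.mono fun p hp => ?_)
    simp only [Function.uncurry, Real.norm_eq_abs, hk]
    rw [integral_abs_frullani (hlog p hp), Real.log_pow, abs_mul]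
    simp
  have hsect : ∀ t ∈ Ioi (0 : ℝ), ∫ p, k p t ∂(α.prod β) = t⁻¹ * (gaussianEnergy t α β - Real.exp (-t)) := by
    intro t ht
    have ht0 : 0 < t := ht
    simp only [hk]
    rw [integral_const_mul, integral_sub, gaussianEnergy]
    · simp [mul_comm]
    · refine (integrable_const (1 : ℝ)).mono' (by fun_prop) (ae_of_all _ fun p => ?_)
      rw [Real.norm_of_nonneg (Real.exp_pos _).le]
      exact Real.exp_le_one_iff.2 (by nlinarith [sq_nonneg ‖p.1 - p.2‖])
    · exact integrable_const _
  refine ⟨?_, ?_⟩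
  · exact (integrableOn_congr_fun hsect measurableSet_Ioi).1 hint.integral_prod_right
  · rw [← setIntegral_congr_fun measurableSet_Ioi hsect, ← integral_integral_swap hint,
      mutualEnergy, ← integral_const_mul]
    refine integral_congr_ae (hd.mono fun p hp => ?_)
    simp only [hk]
    rw [integral_frullani (hlog p hp), Real.log_pow]
    push_cast; ring

/-- The logarithmic energy is positive definite on differences of probability measures. -/
theorem mutualEnergy_add_sub_nonneg (α β : Measure ℂ) [IsProbabilityMeasure α]
    [IsProbabilityMeasure β]
    (hαα : Integrable (fun p : ℂ × ℂ => Real.log ‖p.1 - p.2‖) (α.prod α))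
    (hββ : Integrable (fun p : ℂ × ℂ => Real.log ‖p.1 - p.2‖) (β.prod β))
    (hαβ : Integrable (fun p : ℂ × ℂ => Real.log ‖p.1 - p.2‖) (α.prod β))
    (dαα : ∀ᵐ p ∂(α.prod α), p.1 ≠ p.2) (dββ : ∀ᵐ p ∂(β.prod β), p.1 ≠ p.2)
    (dαβ : ∀ᵐ p ∂(α.prod β), p.1 ≠ p.2) :
    0 ≤ mutualEnergy α α + mutualEnergy β β - 2 * mutualEnergy α β ∧
      (mutualEnergy α α + mutualEnergy β β - 2 * mutualEnergy α β = 0 → α = β) := by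
  obtain ⟨i1, e1⟩ := mutualEnergy_eq_integral α α hαα dαα
  obtain ⟨i2, e2⟩ := mutualEnergy_eq_integral β β hββ dββ
  obtain ⟨i3, e3⟩ := mutualEnergy_eq_integral α β hαβ dαβ
  -- The corrections `exp(-t)` cancel because both measures have mass one.
  have hsum : ∀ t : ℝ, t⁻¹ * (gaussianEnergy t α α - Real.exp (-t)) +
      t⁻¹ * (gaussianEnergy t β β - Real.exp (-t)) -
      2 * (t⁻¹ * (gaussianEnergy t α β - Real.exp (-t))) = t⁻¹ * gaussianDefect t α β := fun t => by
    rw [gaussianDefect]; ring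
  have hI : IntegrableOn (fun t => t⁻¹ * gaussianDefect t α β) (Ioi 0) := by
    have := (i1.add i2).sub (i3.const_mul 2)
    refine this.congr (ae_of_all _ fun t => ?_)
    simpa using hsum t
  have hE : 2 * (mutualEnergy α α + mutualEnergy β β - 2 * mutualEnergy α β) =
      ∫ t in Ioi (0 : ℝ), t⁻¹ * gaussianDefect t α β := by
    simp_rw [← hsum]
    have h1 := integral_sub (i1.add i2) (i3.const_mul 2)
    simp only [Pi.add_apply] at h1
    rw [h1, integral_add i1 i2, integral_const_mul, ← e1, ← e2, ← e3]
    ring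
  have hpos : ∀ t ∈ Ioi (0 : ℝ), 0 ≤ t⁻¹ * gaussianDefect t α β := fun t ht =>
    mul_nonneg (inv_nonneg.2 (le_of_lt ht)) (gaussianDefect_nonneg α β ht)
  refine ⟨?_, fun h0 => ?_⟩
  · have := setIntegral_nonneg (μ := volume) measurableSet_Ioi hpos
    linarith
  · rw [h0, mul_zero] at hE
    have hz := (setIntegral_eq_zero_iff_of_nonneg_ae
      ((ae_restrict_iff' measurableSet_Ioi).2 (ae_of_all _ hpos)) hI).1 hE.symm
    have hz2 : ∀ᵐ t ∂(volume.restrict (Ioi (0 : ℝ))), t ∈ Ioi (0 : ℝ) ∧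
        t⁻¹ * gaussianDefect t α β = 0 := (ae_restrict_mem measurableSet_Ioi).and hz
    have : (ae (volume.restrict (Ioi (0 : ℝ)))).NeBot := by
      rw [ae_neBot, Ne, Measure.restrict_eq_zero]; simp
    obtain ⟨t, ht, h⟩ := hz2.exists
    have ht0 : (0 : ℝ) < t := ht
    refine eq_of_gaussianDefect_eq_zero α β ht0 ?_
    exact (mul_eq_zero.1 h).resolve_left (inv_ne_zero ht0.ne')

end LogPotential

/-! ### Potentials of compactly supported measures -/

namespace LogPotential

/-- The logarithmic potential as a real valued function. -/
noncomputable def pot (μ : Measure ℂ) (z : ℂ) : ℝ := ∫ w, -Real.log ‖z - w‖ ∂μ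

theorem measurable_posLog_one_div : Measurable fun p : ℂ × ℂ => Real.posLog (1 / ‖p.1 - p.2‖) :=
  measurable_posLog.comp (by fun_prop)

theorem integrable_posLog_norm_sub_prod {α β : Measure ℂ} [IsFiniteMeasure α] [IsFiniteMeasure β]
    (hα : Integrable (fun z => Real.log (1 + ‖z‖)) α)
    (hβ : Integrable (fun z => Real.log (1 + ‖z‖)) β) :
    Integrable (fun p : ℂ × ℂ => Real.posLog ‖p.1 - p.2‖) (α.prod β) := by
  refine ((hα.comp_fst β).add (hβ.comp_snd α)).mono'
    (measurable_posLog.comp (by fun_prop)).aestronglyMeasurable (ae_of_all _ fun p => ?_)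
  rw [Real.norm_of_nonneg Real.posLog_nonneg]
  exact posLog_norm_sub_le p.1 p.2

/-- The logarithmic kernel is integrable for a product of measures, one of which has a bounded
potential. -/
theorem integrable_log_norm_sub_prod {α β : Measure ℂ} [IsFiniteMeasure α] [IsFiniteMeasure β]
    (hα : Integrable (fun z => Real.log (1 + ‖z‖)) α)
    (hβ : Integrable (fun z => Real.log (1 + ‖z‖)) β) {M : ℝ≥0∞} (hM : M ≠ ∞)
    (h : ∀ w, ∫⁻ z, ENNReal.ofReal (Real.posLog (1 / ‖z - w‖)) ∂α ≤ M) :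
    Integrable (fun p : ℂ × ℂ => Real.log ‖p.1 - p.2‖) (α.prod β) := by
  simp_rw [log_norm_eq]
  refine (integrable_posLog_norm_sub_prod hα hβ).sub ⟨measurable_posLog_one_div.aestronglyMeasurable, ?_⟩
  rw [hasFiniteIntegral_iff_ofReal (ae_of_all _ fun p => Real.posLog_nonneg),
    lintegral_prod_symm' _ measurable_posLog_one_div.ennreal_ofReal]
  calc ∫⁻ w, ∫⁻ z, ENNReal.ofReal (Real.posLog (1 / ‖z - w‖)) ∂α ∂β ≤ ∫⁻ _, M ∂β :=
        lintegral_mono h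
    _ = M * β univ := by simp
    _ < ∞ := ENNReal.mul_lt_top hM.lt_top (measure_lt_top β _)

/-- Translation invariance makes the bound uniform in `w`. -/
theorem lintegral_posLog_le_volume (s : Set ℂ) (w : ℂ) :
    ∫⁻ z in s, ENNReal.ofReal (Real.posLog (1 / ‖z - w‖)) ≤
      ∫⁻ z : ℂ, ENNReal.ofReal (Real.posLog (1 / ‖z‖)) := by
  refine (setLIntegral_le_lintegral _ _).trans (le_of_eq ?_)
  exact lintegral_sub_right_eq_self (fun z : ℂ => ENNReal.ofReal (Real.posLog (1 / ‖z‖))) w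

theorem lintegral_posLog_volume_ne_top :
    ∫⁻ z : ℂ, ENNReal.ofReal (Real.posLog (1 / ‖z‖)) ≠ ∞ :=
  ((hasFiniteIntegral_iff_ofReal (ae_of_all _ fun _ => Real.posLog_nonneg)).1
    (integrable_posLog_div_norm one_pos).hasFiniteIntegral).ne

theorem integrable_log_one_add_norm_of_bounded {α : Measure ℂ} [IsFiniteMeasure α] {R : ℝ}
    (h : ∀ᵐ z ∂α, ‖z‖ ≤ R) : Integrable (fun z => Real.log (1 + ‖z‖)) α := by
  refine Integrable.of_bound (C := Real.log (1 + R))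
    (show Measurable fun z : ℂ => Real.log (1 + ‖z‖) by fun_prop).aestronglyMeasurable (h.mono fun z hz => ?_)
  rw [Real.norm_of_nonneg (Real.log_nonneg (by linarith [norm_nonneg z]))]
  exact Real.log_le_log (by positivity) (by linarith)

/-- The standing assumptions on a compactly supported measure with finite potential. -/
structure HasFinitePotential (μ : Measure ℂ) (S : Set ℂ) : Prop where
  isCompact : IsCompact S
  compl_eq_zero : μ Sᶜ = 0
  integrable : ∀ z, Integrable (fun w => Real.log ‖z - w‖) μ
  noAtoms : ∀ z, μ {z} = 0

variable {μ : Measure ℂ} {S : Set ℂ}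

theorem HasFinitePotential.ae_mem (h : HasFinitePotential μ S) : ∀ᵐ w ∂μ, w ∈ S :=
  mem_ae_iff.2 h.compl_eq_zero

theorem HasFinitePotential.ae_ne (h : HasFinitePotential μ S) (z : ℂ) : ∀ᵐ w ∂μ, w ≠ z := by
  simpa [ae_iff] using h.noAtoms z

theorem HasFinitePotential.logInt [IsFiniteMeasure μ] (h : HasFinitePotential μ S) :
    Integrable (fun z => Real.log (1 + ‖z‖)) μ := by
  obtain ⟨R, hR⟩ := h.isCompact.isBounded.exists_norm_le
  exact integrable_log_one_add_norm_of_bounded (h.ae_mem.mono fun z hz => hR z hz)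

/-- A potential is continuous off the support of the measure. -/
theorem HasFinitePotential.continuousAt [IsFiniteMeasure μ] (h : HasFinitePotential μ S) {z : ℂ}
    (hz : z ∉ S) : ContinuousAt (pot μ) z := by
  have hopen : Sᶜ ∈ 𝓝 z := h.isCompact.isClosed.isOpen_compl.mem_nhds hz
  obtain ⟨δ, hδ, hball⟩ := Metric.nhds_basis_closedBall.mem_iff.1 hopen
  have hcont : ContinuousOn (fun p : ℂ × ℂ => -Real.log ‖p.1 - p.2‖)
      (Metric.closedBall z δ ×ˢ S) := by
    refine ContinuousOn.neg (ContinuousOn.log (by fun_prop) ?_)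
    rintro ⟨x, w⟩ ⟨hx, hw⟩
    rw [Ne, norm_eq_zero, sub_eq_zero]
    intro hxw
    exact hball hx (by rw [show x = w from hxw]; exact hw)
  obtain ⟨C, hC⟩ := ((isCompact_closedBall z δ).prod h.isCompact).exists_bound_of_continuousOn hcont
  refine continuousAt_of_dominated (bound := fun _ => C) ?_ ?_ (integrable_const C) ?_
  · exact Eventually.of_forall fun x => (h.integrable x).neg.aestronglyMeasurable
  · filter_upwards [Metric.closedBall_mem_nhds z hδ] with x hx
    exact h.ae_mem.mono fun w hw => hC (x, w) ⟨hx, hw⟩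
  · refine h.ae_mem.mono fun w hw => ?_
    have : ‖z - w‖ ≠ 0 := by
      rw [Ne, norm_eq_zero, sub_eq_zero]
      rintro rfl
      exact hz hw
    exact ContinuousAt.neg (ContinuousAt.log (by fun_prop) this)

theorem pot_sub_pot (h : HasFinitePotential μ S) (z z' : ℂ) :
    pot μ z - pot μ z' = ∫ w, (Real.log ‖z' - w‖ - Real.log ‖z - w‖) ∂μ := by
  rw [pot, pot, integral_neg, integral_neg, integral_sub (h.integrable z') (h.integrable z)]
  ring

/-- The nearest point comparison: the potential at `z` is controlled by that at a nearest point. -/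
theorem HasFinitePotential.exists_nearest (h : HasFinitePotential μ S) (hne : S.Nonempty) (z : ℂ) :
    ∃ z' ∈ S, (∀ w ∈ S, ‖z - z'‖ ≤ ‖z - w‖) ∧ ∀ w ∈ S, ‖z' - w‖ ≤ 2 * ‖z - w‖ := by
  obtain ⟨z', hz', hd⟩ := h.isCompact.exists_infDist_eq_dist hne z
  have h1 : ∀ w ∈ S, ‖z - z'‖ ≤ ‖z - w‖ := fun w hw => by
    rw [← dist_eq_norm, ← dist_eq_norm, ← hd]
    exact Metric.infDist_le_dist_of_mem hw
  refine ⟨z', hz', h1, fun w hw => ?_⟩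
  calc ‖z' - w‖ = ‖(z - w) - (z - z')‖ := by ring_nf
    _ ≤ ‖z - w‖ + ‖z - z'‖ := norm_sub_le _ _
    _ ≤ 2 * ‖z - w‖ := by linarith [h1 w hw]

theorem HasFinitePotential.nonempty [NeZero μ] (h : HasFinitePotential μ S) : S.Nonempty := by
  by_contra hne
  rw [not_nonempty_iff_eq_empty] at hne
  have := h.compl_eq_zero
  rw [hne, compl_empty] at this
  exact NeZero.ne μ (Measure.measure_univ_eq_zero.1 this)

/-- A weak maximum principle: replacing `z` by a nearest point of `S` at most doubles the distances
to `S`, which costs `log 2` per unit of mass. -/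
theorem HasFinitePotential.pot_le_of_le [IsFiniteMeasure μ] (h : HasFinitePotential μ S)
    (hne : S.Nonempty) {M : ℝ} (hM : ∀ z ∈ S, pot μ z ≤ M) (z : ℂ) :
    pot μ z ≤ M + Real.log 2 * μ.real univ := by
  obtain ⟨z', hz', -, h2⟩ := h.exists_nearest hne z
  have h3 : pot μ z - pot μ z' ≤ ∫ _, Real.log 2 ∂μ := by
    rw [pot_sub_pot h]
    refine integral_mono_ae ((h.integrable z').sub (h.integrable z)) (integrable_const _) ?_
    filter_upwards [h.ae_mem, h.ae_ne z'] with w hw hwne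
    have hpos : 0 < ‖z' - w‖ := norm_pos_iff.2 (sub_ne_zero.2 hwne.symm)
    have hpos2 : 0 < ‖z - w‖ := by have := h2 w hw; linarith
    have := Real.log_le_log hpos (h2 w hw)
    rw [Real.log_mul two_ne_zero hpos2.ne'] at this
    linarith
  rw [integral_const, smul_eq_mul] at h3
  linarith [hM z' hz']

/-- Upper semicontinuity of the potential at the support, relative to a continuous majorant on
the support. -/
theorem HasFinitePotential.eventually_pot_lt [IsFiniteMeasure μ] (h : HasFinitePotential μ S)
    {φ : ℂ → ℝ} (hφ : ∀ z ∈ S, pot μ z ≤ φ z) {ζ : ℂ} (hζ : ζ ∈ S) (hc : ContinuousAt φ ζ) {η : ℝ}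
    (hη : 0 < η) : ∀ᶠ z in 𝓝 ζ, pot μ z < φ ζ + η := by
  set m := μ.real univ with hm
  -- Since `ζ` is not an atom, it has a neighbourhood `O` of small mass. The crude loss `log 2 ≤ 1`
  -- of the nearest point comparison is paid only there; off `O` the ratio of distances is close to
  -- `1`.
  obtain ⟨O, hOζ, hO, hOμ⟩ := Set.exists_isOpen_lt_of_lt ({ζ} : Set ℂ)
    (ENNReal.ofReal (η / 4)) (μ := μ) (by rw [h.noAtoms]; simp; linarith)
  obtain ⟨δ, hδ, hball⟩ := Metric.isOpen_iff.1 hO ζ (hOζ rfl)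
  have hOr : μ.real O ≤ η / 4 := ENNReal.toReal_le_of_le_ofReal (by linarith) hOμ.le
  have hlog2 : Real.log 2 ≤ 1 := by linarith [Real.log_two_lt_d9]
  have hev : ∀ᶠ x in 𝓝 ζ, φ x < φ ζ + η / 4 := hc.eventually (gt_mem_nhds (by linarith))
  obtain ⟨κ, hκ, hφκ⟩ := Metric.eventually_nhds_iff_ball.1 hev
  have hm0 : 0 ≤ m := measureReal_nonneg
  -- The bounds `δ/2` and `κ/2` keep `z` away from `Oᶜ` and its nearest point where `φ < φ ζ + η/4`;
  -- the last bound keeps the loss off `O` below `η/4`.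
  set τ := min (min (δ / 2) (κ / 2)) (η * δ / (8 * (m + 1))) with hτ
  have hτ0 : 0 < τ := by positivity
  filter_upwards [Metric.ball_mem_nhds ζ hτ0] with z hz
  rw [Metric.mem_ball, dist_eq_norm] at hz
  have hzδ : ‖z - ζ‖ < δ / 2 := hz.trans_le ((min_le_left _ _).trans (min_le_left _ _))
  have hzκ : ‖z - ζ‖ < κ / 2 := hz.trans_le ((min_le_left _ _).trans (min_le_right _ _))
  have hzm : ‖z - ζ‖ < η * δ / (8 * (m + 1)) := hz.trans_le (min_le_right _ _)
  obtain ⟨z', hz', h1, h2⟩ := h.exists_nearest ⟨ζ, hζ⟩ z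
  have hz'ζ : ‖z' - ζ‖ < κ := by have := h2 ζ hζ; linarith
  have hφz' : pot μ z' < φ ζ + η / 4 :=
    (hφ z' hz').trans_lt (hφκ z' (by rwa [Metric.mem_ball, dist_eq_norm]))
  have h3 : pot μ z - pot μ z' ≤
      ∫ w, (O.indicator (fun _ => (1 : ℝ)) w + 2 * ‖z - ζ‖ / δ) ∂μ := by
    rw [pot_sub_pot h]
    refine integral_mono_ae ((h.integrable z').sub (h.integrable z))
      (((integrable_const _).indicator hO.measurableSet).add (integrable_const _)) ?_
    filter_upwards [h.ae_mem, h.ae_ne z'] with w hw hwne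
    have hpos : 0 < ‖z' - w‖ := norm_pos_iff.2 (sub_ne_zero.2 hwne.symm)
    have hpos2 : 0 < ‖z - w‖ := by have := h2 w hw; linarith
    by_cases hwO : w ∈ O
    · have := Real.log_le_log hpos (h2 w hw)
      rw [Real.log_mul two_ne_zero hpos2.ne'] at this
      rw [indicator_of_mem hwO]
      have : 0 ≤ 2 * ‖z - ζ‖ / δ := by positivity
      linarith
    · rw [indicator_of_notMem hwO, zero_add]
      have hwδ : δ ≤ ‖w - ζ‖ := by
        by_contra hlt
        exact hwO (hball (by rw [Metric.mem_ball, dist_eq_norm]; linarith))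
      have hzw : δ / 2 ≤ ‖z - w‖ := by
        have : ‖w - ζ‖ ≤ ‖z - ζ‖ + ‖z - w‖ := by
          calc ‖w - ζ‖ = ‖(z - ζ) - (z - w)‖ := by ring_nf
            _ ≤ _ := norm_sub_le _ _
        linarith
      have hz'w : ‖z' - w‖ ≤ ‖z - w‖ + ‖z - ζ‖ := by
        calc ‖z' - w‖ = ‖(z - w) - (z - z')‖ := by ring_nf
          _ ≤ ‖z - w‖ + ‖z - z'‖ := norm_sub_le _ _
          _ ≤ _ := by linarith [h1 ζ hζ]
      rw [← Real.log_div hpos.ne' hpos2.ne']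
      refine (Real.log_le_sub_one_of_pos (by positivity)).trans ?_
      have h4 : ‖z' - w‖ / ‖z - w‖ ≤ 1 + ‖z - ζ‖ / ‖z - w‖ := by
        rw [div_le_iff₀ hpos2]; field_simp; linarith
      have h5 : ‖z - ζ‖ / ‖z - w‖ ≤ ‖z - ζ‖ / (δ / 2) := by gcongr
      have h6 : ‖z - ζ‖ / (δ / 2) = 2 * ‖z - ζ‖ / δ := by field_simp
      linarith
  rw [integral_add ((integrable_const _).indicator hO.measurableSet) (integrable_const _),
    integral_indicator hO.measurableSet, setIntegral_const, integral_const] at h3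
  simp only [smul_eq_mul, mul_one] at h3
  have h7 : m * (2 * ‖z - ζ‖ / δ) ≤ η / 4 := by
    rw [lt_div_iff₀ (by positivity)] at hzm
    rw [mul_div_assoc', div_le_iff₀ hδ]
    nlinarith [norm_nonneg (z - ζ)]
  linarith

end LogPotential

/-! ### Disc averages of potentials and the mean value defect -/

namespace LogPotential

variable {μ : Measure ℂ} {S : Set ℂ}

/-- The defect of the potential in the mean value property. -/
noncomputable def potDefect (μ : Measure ℂ) (z : ℂ) (ρ : ℝ) : ℝ :=
  ∫ w, Real.posLog (ρ / ‖z - w‖) ∂μ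

/-- Justifies Fubini for disc averages: area measure on a disc has a bounded singular potential. -/
theorem HasFinitePotential.integrable_prod [IsFiniteMeasure μ] (h : HasFinitePotential μ S)
    (z : ℂ) (r : ℝ) :
    Integrable (fun p : ℂ × ℂ => Real.log ‖z + p.1 - p.2‖)
      ((volume.restrict (Metric.ball (0 : ℂ) r)).prod μ) := by
  have : IsFiniteMeasure (volume.restrict (Metric.ball (0 : ℂ) r)) :=
    ⟨by rw [Measure.restrict_apply_univ]; exact measure_ball_lt_top⟩
  have : IsFiniteMeasure (volume.restrict (Metric.ball z r)) :=
    ⟨by rw [Measure.restrict_apply_univ]; exact measure_ball_lt_top⟩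
  have h1 : Integrable (fun p : ℂ × ℂ => Real.log ‖p.1 - p.2‖)
      ((volume.restrict (Metric.ball z r)).prod μ) := by
    refine integrable_log_norm_sub_prod (integrable_log_one_add_norm_of_bounded (R := ‖z‖ + |r|) ?_)
      h.logInt lintegral_posLog_volume_ne_top (lintegral_posLog_le_volume _)
    refine (ae_restrict_iff' measurableSet_ball).2 (ae_of_all _ fun x hx => ?_)
    rw [Metric.mem_ball, dist_eq_norm] at hx
    calc ‖x‖ = ‖z + (x - z)‖ := by ring_nf
      _ ≤ ‖z‖ + ‖x - z‖ := norm_add_le _ _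
      _ ≤ _ := by gcongr; exact hx.le.trans (le_abs_self r)
  have hmp : MeasurePreserving (fun x : ℂ => z + x) (volume.restrict (Metric.ball (0 : ℂ) r))
      (volume.restrict (Metric.ball z r)) := by
    have := (measurePreserving_add_left (volume : Measure ℂ) z).restrict_preimage
      (measurableSet_ball (x := z) (ε := r))
    convert this using 2
    ext x; simp
  exact ((hmp.prod (MeasurePreserving.id μ)).integrable_comp_of_integrable h1)

/-- The mean value formula for potentials. -/
theorem HasFinitePotential.setIntegral_pot [IsFiniteMeasure μ] (h : HasFinitePotential μ S)
    (z : ℂ) (r : ℝ) :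
    IntegrableOn (fun x => pot μ (z + x)) (Metric.ball 0 r) ∧
    IntegrableOn (fun x : ℂ => potDefect μ z ‖x‖) (Metric.ball 0 r) ∧
    ∫ x in Metric.ball (0 : ℂ) r, pot μ (z + x) =
      ∫ x in Metric.ball (0 : ℂ) r, (pot μ z - potDefect μ z ‖x‖) := by
  have hfin : IsFiniteMeasure (volume.restrict (Metric.ball (0 : ℂ) r)) :=
    ⟨by rw [Measure.restrict_apply_univ]; exact measure_ball_lt_top⟩
  have h1 := h.integrable_prod z r
  have h2 : Integrable (fun p : ℂ × ℂ => Real.posLog (‖p.1‖ / ‖z - p.2‖))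
      ((volume.restrict (Metric.ball (0 : ℂ) r)).prod μ) := by
    have h3 : Integrable (fun p : ℂ × ℂ => Real.posLog r + |Real.log ‖z - p.2‖|)
        ((volume.restrict (Metric.ball (0 : ℂ) r)).prod μ) :=
      (integrable_const _).add ((h.integrable z).abs.comp_snd _)
    refine h3.mono' (measurable_posLog.comp (by fun_prop)).aestronglyMeasurable ?_
    have : ∀ᵐ p ∂((volume.restrict (Metric.ball (0 : ℂ) r)).prod μ), p.1 ∈ Metric.ball (0 : ℂ) r :=
      Measure.quasiMeasurePreserving_fst.ae (ae_restrict_mem measurableSet_ball)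
    filter_upwards [this] with p hp
    rw [Real.norm_of_nonneg Real.posLog_nonneg, div_eq_mul_inv]
    refine Real.posLog_mul.trans (add_le_add ?_ ?_)
    · exact Real.posLog_le_posLog (norm_nonneg _) (by simpa using (mem_ball_zero_iff.1 hp).le)
    · rw [Real.posLog_apply, Real.log_inv]
      exact max_le (abs_nonneg _) (neg_le_abs _)
  refine ⟨h1.integral_prod_left.neg.congr (ae_of_all _ fun x => ?_), h2.integral_prod_left, ?_⟩
  · simp only [pot, Pi.neg_apply, integral_neg]
  have e1 : ∫ x in Metric.ball (0 : ℂ) r, pot μ (z + x) =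
      -∫ w, (∫ x in Metric.ball (0 : ℂ) r, Real.log ‖z + x - w‖) ∂μ := by
    rw [← integral_integral_swap (f := fun x w => Real.log ‖z + x - w‖) h1, ← integral_neg]
    simp only [pot, integral_neg]
  -- For `w ≠ z` the average of the kernel over a disc is its radial average; the point `w = z` is
  -- not charged.
  have e2 : ∫ w, (∫ x in Metric.ball (0 : ℂ) r, Real.log ‖z + x - w‖) ∂μ =
      ∫ w, (∫ x in Metric.ball (0 : ℂ) r, (Real.log ‖z - w‖ + Real.posLog (‖x‖ / ‖z - w‖))) ∂μ := by
    refine integral_congr_ae ((h.ae_ne z).mono fun w hw => ?_)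
    have := setIntegral_ball_log_norm_sub (sub_ne_zero.2 hw) r
    rw [norm_sub_rev w z] at this
    refine Eq.trans ?_ this
    simp only
    congr 1
    funext x
    congr 2
    ring
  have h4 : Integrable (fun p : ℂ × ℂ => Real.log ‖z - p.2‖ + Real.posLog (‖p.1‖ / ‖z - p.2‖))
      ((volume.restrict (Metric.ball (0 : ℂ) r)).prod μ) :=
    ((h.integrable z).comp_snd _).add h2
  rw [e1, e2, ← integral_integral_swap
    (f := fun x w => Real.log ‖z - w‖ + Real.posLog (‖x‖ / ‖z - w‖)) h4, ← integral_neg]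
  refine integral_congr_ae ?_
  filter_upwards [h2.prod_right_ae] with x hx
  rw [integral_add (h.integrable z) hx, pot, potDefect, integral_neg]
  ring

/-- The potential is harmonic on discs that miss `S`: `log⁺(ρ/‖z - w‖)` vanishes as soon as `‖z - w‖
≥ ρ`. -/
theorem HasFinitePotential.potDefect_eq_zero (h : HasFinitePotential μ S) {z : ℂ} {ρ r : ℝ}
    (hρ : 0 ≤ ρ) (hρr : ρ ≤ r) (hd : ∀ w ∈ S, r ≤ ‖z - w‖) : potDefect μ z ρ = 0 := by
  rw [potDefect]
  refine integral_eq_zero_of_ae (h.ae_mem.mono fun w hw => ?_)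
  have h1 := hd w hw
  rcases hρ.eq_or_lt with rfl | h0
  · simp
  · exact posLog_div_eq_zero h0 (hρr.trans h1)

/-- A quadratic bound for the measure of small discs gives a quadratic bound for the defect. -/
theorem potDefect_le [IsFiniteMeasure μ] {z : ℂ} {ρ a : ℝ} (hρ : 0 < ρ)
    (ha : 0 ≤ a) (hμ : ∀ t, 0 < t → t ≤ ρ → μ.real (Metric.closedBall z t) ≤ a * t ^ 2) :
    potDefect μ z ρ ≤ a * ρ ^ 2 / 2 := by
  have hm : Measurable fun w : ℂ => Real.posLog (ρ / ‖z - w‖) := measurable_posLog.comp (by fun_prop)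
  rw [potDefect, integral_eq_lintegral_of_nonneg_ae (ae_of_all _ fun _ => Real.posLog_nonneg)
    hm.aestronglyMeasurable, lintegral_eq_lintegral_meas_lt μ
      (ae_of_all _ fun _ => Real.posLog_nonneg) hm.aemeasurable]
  refine ENNReal.toReal_le_of_le_ofReal (by positivity) ?_
  have hexp : IntegrableOn (fun s : ℝ => a * ρ ^ 2 * Real.exp (-2 * s)) (Ioi 0) :=
    (integrableOn_exp_mul_Ioi (by norm_num) 0).const_mul _
  have hval : ∫ s in Ioi (0 : ℝ), a * ρ ^ 2 * Real.exp (-2 * s) = a * ρ ^ 2 / 2 := by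
    rw [integral_const_mul, integral_exp_mul_Ioi (by norm_num)]
    norm_num
    ring
  rw [← hval, ofReal_integral_eq_lintegral_ofReal hexp (ae_of_all _ fun s => by positivity)]
  refine setLIntegral_mono' measurableSet_Ioi fun s hs => ?_
  have hs0 : 0 < s := hs
  -- Layer cake: the superlevel set lies in a disc of radius `ρ e^{-s}`, whose mass is at most `a ρ²
  -- e^{-2s}`; integration in `s` yields the factor `1/2`.
  have hsub : {w : ℂ | s < Real.posLog (ρ / ‖z - w‖)} ⊆ Metric.closedBall z (ρ * Real.exp (-s)) := by
    intro w hw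
    have hw' : s < Real.posLog (ρ / ‖z - w‖) := hw
    rw [Metric.mem_closedBall, dist_comm, dist_eq_norm]
    rcases (norm_nonneg (z - w)).eq_or_lt with h0 | h0
    · rw [← h0]; positivity
    rw [Real.posLog_apply, lt_max_iff, or_iff_right (by linarith), Real.lt_log_iff_exp_lt
      (by positivity), lt_div_iff₀ h0] at hw'
    rw [Real.exp_neg, ← div_eq_mul_inv, le_div_iff₀ (Real.exp_pos _), mul_comm]
    exact hw'.le
  refine (measure_mono hsub).trans ?_
  rw [← ofReal_measureReal]
  refine ENNReal.ofReal_le_ofReal ((hμ _ (by positivity) ?_).trans (le_of_eq ?_))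
  · exact mul_le_of_le_one_right hρ.le (Real.exp_le_one_iff.2 (by linarith))
  · rw [mul_pow, ← Real.exp_nat_mul]
    push_cast
    rw [show 2 * -s = -2 * s by ring, mul_assoc]

theorem setIntegral_ball_norm_sq {r : ℝ} (hr : 0 ≤ r) :
    ∫ x in Metric.ball (0 : ℂ) r, ‖x‖ ^ 2 = Real.pi * r ^ 4 / 2 := by
  rw [← integral_indicator measurableSet_ball]
  have h1 : ∀ x : ℂ, (Metric.ball (0 : ℂ) r).indicator (fun x => ‖x‖ ^ 2) x =
      (Iio r).indicator (fun t => t ^ 2) ‖x‖ := fun x => by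
    by_cases h : ‖x‖ < r
    · rw [indicator_of_mem (by simpa using h), indicator_of_mem (by simpa using h)]
    · rw [indicator_of_notMem (by simpa using h), indicator_of_notMem (by simpa using h)]
  simp_rw [h1]
  rw [integral_radial (fun t => (Iio r).indicator (fun t => t ^ 2) t)]
  have h2 : ∫ t in Ioi (0 : ℝ), t * (Iio r).indicator (fun t => t ^ 2) t =
      ∫ t in Ioo (0 : ℝ) r, t ^ 3 := by
    rw [← integral_indicator measurableSet_Ioi, ← integral_indicator measurableSet_Ioo]
    congr 1
    funext t
    simp only [indicator, mem_Ioi, mem_Iio, mem_Ioo]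
    split_ifs <;> first | (exfalso; tauto) | ring
  rw [h2, ← integral_Ioc_eq_integral_Ioo, ← intervalIntegral.integral_of_le hr, integral_pow]
  norm_num
  ring

theorem setIntegral_ball_linear (A : ℂ →L[ℝ] ℝ) (r : ℝ) :
    ∫ x in Metric.ball (0 : ℂ) r, A x = 0 := by
  have h1 : ∫ x in Metric.ball (0 : ℂ) r, A x = ∫ x in Metric.ball (0 : ℂ) r, A (-x) := by
    rw [← integral_indicator measurableSet_ball, ← integral_indicator measurableSet_ball,
      ← integral_neg_eq_self]
    congr 1
    funext x
    simp [indicator]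
  simp only [map_neg, integral_neg] at h1
  linarith

theorem setIntegral_ball_rotation (e : Circle) (F : ℂ → ℝ) (r : ℝ) :
    ∫ x in Metric.ball (0 : ℂ) r, F (e * x) = ∫ x in Metric.ball (0 : ℂ) r, F x := by
  have := (rotation e).measurePreserving.setIntegral_preimage_emb
    (rotation e).toHomeomorph.measurableEmbedding F (Metric.ball (0 : ℂ) r)
  rw [← this]
  have hpre : (rotation e) ⁻¹' Metric.ball (0 : ℂ) r = Metric.ball (0 : ℂ) r := by
    ext x
    rw [mem_preimage, mem_ball_zero_iff, mem_ball_zero_iff, LinearIsometryEquiv.norm_map]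
  rw [hpre]
  rfl

theorem Continuous.integrableOn_ball_real {u : ℂ → ℝ} (hu : Continuous u) (z : ℂ) (r : ℝ) :
    IntegrableOn u (Metric.ball z r) :=
  (hu.continuousOn.integrableOn_compact (isCompact_closedBall z r)).mono_set
    Metric.ball_subset_closedBall

/-- Averaging with the rotation by `i` leaves only the trace of `B`. -/
theorem setIntegral_ball_bilinear (B : ℂ →L[ℝ] ℂ →L[ℝ] ℝ) (r : ℝ) :
    ∫ x in Metric.ball (0 : ℂ) r, B x x =
      (B 1 1 + B Complex.I Complex.I) / 2 * ∫ x in Metric.ball (0 : ℂ) r, ‖x‖ ^ 2 := by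
  have hcont : Continuous fun x : ℂ => B x x := by fun_prop
  have hcont2 : Continuous fun x : ℂ => B (Complex.I * x) (Complex.I * x) := by fun_prop
  have hrot : ∫ x in Metric.ball (0 : ℂ) r, B (Complex.I * x) (Complex.I * x) =
      ∫ x in Metric.ball (0 : ℂ) r, B x x :=
    setIntegral_ball_rotation ⟨Complex.I, by simp [Submonoid.unitSphere]⟩ (fun x => B x x) r
  have hsum : ∫ x in Metric.ball (0 : ℂ) r, (B x x + B (Complex.I * x) (Complex.I * x)) =
      ∫ x in Metric.ball (0 : ℂ) r, ‖x‖ ^ 2 * (B 1 1 + B Complex.I Complex.I) := by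
    congr 1
    funext x
    exact bilinear_add_bilinear_I_mul B x
  rw [integral_add (Continuous.integrableOn_ball_real hcont _ _)
    (Continuous.integrableOn_ball_real hcont2 _ _), hrot, integral_mul_const] at hsum
  linarith

end LogPotential

/-! ### Sub-mean value property: from small discs to large ones -/

namespace LogPotential

-- The circle average becomes an average over rotations of `x`, which can be interchanged with disc
-- averages in `x`.
open Real in
theorem circleAverage_norm_eq (u : ℂ → ℝ) (z x : ℂ) :
    circleAverage u z ‖x‖ = (2 * π)⁻¹ * ∫ θ in (0 : ℝ)..2 * π, u (z + Circle.exp θ * x) := by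
  rw [circleAverage_eq_integral_add x.arg, smul_eq_mul]
  congr 2
  funext θ
  congr 1
  rw [circleMap, Circle.coe_exp]
  conv_rhs => rw [← Complex.norm_mul_exp_arg_mul_I x]
  push_cast
  rw [add_mul, Complex.exp_add]
  ring

theorem setIntegral_ball_norm_sq_sub (a : ℂ) (s : ℝ) :
    ∫ y in Metric.ball (0 : ℂ) s, (‖a + y‖ ^ 2 - ‖a‖ ^ 2) = ∫ y in Metric.ball (0 : ℂ) s, ‖y‖ ^ 2 := by
  have h : ∀ y : ℂ, ‖a + y‖ ^ 2 - ‖a‖ ^ 2 = 2 * innerSL ℝ a y + ‖y‖ ^ 2 := fun y => by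
    rw [norm_add_sq_real]; simp; ring
  simp_rw [h]
  rw [integral_add (Continuous.integrableOn_ball_real (by fun_prop) _ _)
    (Continuous.integrableOn_ball_real (by fun_prop) _ _), integral_const_mul,
    setIntegral_ball_linear]
  ring

/-- The sub-mean value property on small discs, up to a quadratic error. -/
def IsLocallySubmean (u : ℂ → ℝ) (z₁ : ℂ) (R L : ℝ) : Prop :=
  ∃ δ > 0, ∀ z ∈ Metric.ball z₁ R, ∀ s, 0 < s → s < δ → s < R - ‖z - z₁‖ →
    -L * ∫ y in Metric.ball (0 : ℂ) s, ‖y‖ ^ 2 ≤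
      ∫ y in Metric.ball (0 : ℂ) s, (u (z + y) - u z)

open Real in
/-- From small discs to a large circle, by averaging over rotations. -/
theorem IsLocallySubmean.le_circleAverage {u : ℂ → ℝ} {z₁ : ℂ} {R L : ℝ} (hu : Continuous u)
    (hR : 0 < R) (h : IsLocallySubmean u z₁ R L) :
    u z₁ ≤ circleAverage u z₁ R + (L + 1) * R ^ 2 := by
  obtain ⟨δ, hδ, h⟩ := h
  -- Adding `(L + 1)‖x‖²` beats the admitted error `L` and leaves a strict sub-mean value
  -- inequality.
  set v : ℂ → ℝ := fun x => u (z₁ + x) + (L + 1) * ‖x‖ ^ 2 with hv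
  have hvc : Continuous v := by fun_prop
  set V : ℂ → ℝ := fun x => ∫ θ in (0 : ℝ)..2 * π, v (Circle.exp θ * x) with hV
  have hVu : ∀ x, V x = 2 * π * (circleAverage u z₁ ‖x‖ + (L + 1) * ‖x‖ ^ 2) := by
    intro x
    rw [circleAverage_norm_eq, hV]
    simp only [hv]
    rw [intervalIntegral.integral_add (Continuous.intervalIntegrable (by fun_prop) _ _)
      (Continuous.intervalIntegrable (by fun_prop) _ _)]
    have hn : ∀ θ : ℝ, ‖(Circle.exp θ : ℂ) * x‖ = ‖x‖ := fun θ => by simp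
    simp only [hn, intervalIntegral.integral_const, smul_eq_mul, sub_zero]
    rw [mul_add, mul_inv_cancel_left₀ (by positivity)]
  have hVc : Continuous V := by
    refine intervalIntegral.continuous_parametric_intervalIntegral_of_continuous'
      (f := fun x θ => v (Circle.exp θ * x)) ?_ _ _
    exact hvc.comp (by fun_prop)
  -- Maximum principle: an interior maximum of the rotation average `V` contradicts strictness. So
  -- the maximum lies on the circle, where `V` is constant, and comparison with `V 0` gives the
  -- claim.
  obtain ⟨x, hx, hmax⟩ := (isCompact_closedBall (0 : ℂ) R).exists_isMaxOn
    ⟨0, by simp [hR.le]⟩ hVc.continuousOn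
  have hxR : ‖x‖ = R := by
    by_contra hne
    have hlt : ‖x‖ < R := lt_of_le_of_ne (by simpa using hx) hne
    set s := min (δ / 2) ((R - ‖x‖) / 2) with hs
    have hs0 : 0 < s := lt_min (by linarith) (by linarith)
    have hsδ : s < δ := (min_le_left _ _).trans_lt (by linarith)
    have hsR : s < R - ‖x‖ := (min_le_right _ _).trans_lt (by linarith)
    set m := ∫ y in Metric.ball (0 : ℂ) s, ‖y‖ ^ 2 with hm
    have hm0 : 0 < m := by rw [hm, setIntegral_ball_norm_sq hs0.le]; positivity
    -- The error of `u` is at least `-L m` and the quadratic term contributes `(L + 1) m`, so the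
    -- gain `m` is uniform in the rotation.
    have hin : ∀ θ : ℝ, m ≤ ∫ y in Metric.ball (0 : ℂ) s,
        (v (Circle.exp θ * (x + y)) - v (Circle.exp θ * x)) := by
      intro θ
      set a : ℂ := Circle.exp θ * x with ha
      have hna : ‖a‖ = ‖x‖ := by simp [ha]
      have e1 : ∫ y in Metric.ball (0 : ℂ) s, (v (Circle.exp θ * (x + y)) - v a) =
          ∫ y in Metric.ball (0 : ℂ) s, (v (a + y) - v a) := by
        rw [← setIntegral_ball_rotation (Circle.exp θ) (fun y => v (a + y) - v a)]
        simp only [ha, mul_add]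
      have h1 := h (z₁ + a) (by simp [hna, hlt]) s hs0 hsδ (by simpa [hna] using hsR)
      have e2 : ∫ y in Metric.ball (0 : ℂ) s, (v (a + y) - v a) =
          (∫ y in Metric.ball (0 : ℂ) s, (u (z₁ + a + y) - u (z₁ + a))) +
            (L + 1) * ∫ y in Metric.ball (0 : ℂ) s, (‖a + y‖ ^ 2 - ‖a‖ ^ 2) := by
        rw [← integral_const_mul, ← integral_add (Continuous.integrableOn_ball_real (by fun_prop) _ _)
          (Continuous.integrableOn_ball_real (by fun_prop) _ _)]
        congr 1
        funext y
        simp only [hv, add_assoc]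
        ring
      rw [e1, e2, setIntegral_ball_norm_sq_sub]
      linarith
    have hswap : ∫ y in Metric.ball (0 : ℂ) s, (V (x + y) - V x) =
        ∫ θ in (0 : ℝ)..2 * π, ∫ y in Metric.ball (0 : ℂ) s,
          (v (Circle.exp θ * (x + y)) - v (Circle.exp θ * x)) := by
      have hVV : ∀ y, V (x + y) - V x = ∫ θ in Ioc 0 (2 * π),
          (v (Circle.exp θ * (x + y)) - v (Circle.exp θ * x)) := fun y => by
        rw [← intervalIntegral.integral_of_le (by positivity), hV]
        simp only
        rw [intervalIntegral.integral_sub (Continuous.intervalIntegrable (by fun_prop) _ _)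
          (Continuous.intervalIntegrable (by fun_prop) _ _)]
      simp_rw [hVV]
      rw [intervalIntegral.integral_of_le (by positivity)]
      refine integral_integral_swap (f := fun y θ =>
        v (Circle.exp θ * (x + y)) - v (Circle.exp θ * x)) ?_
      rw [Measure.prod_restrict]
      have hc : Continuous (Function.uncurry fun (y : ℂ) (θ : ℝ) =>
          v (Circle.exp θ * (x + y)) - v (Circle.exp θ * x)) := by
        simp only [Function.uncurry_def]
        fun_prop
      exact (hc.continuousOn.integrableOn_compact ((isCompact_closedBall (0 : ℂ) s).prod
        (isCompact_Icc (a := (0 : ℝ)) (b := 2 * π)))).mono_set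
        (prod_mono Metric.ball_subset_closedBall Ioc_subset_Icc_self)
    have hpos : 0 < ∫ y in Metric.ball (0 : ℂ) s, (V (x + y) - V x) := by
      rw [hswap]
      have hc : Continuous fun θ : ℝ => ∫ y in Metric.ball (0 : ℂ) s,
          (v (Circle.exp θ * (x + y)) - v (Circle.exp θ * x)) := by
        -- The closed disc differs by a null circle and is compact, so continuity of the parametric
        -- integral is available.
        have : ∀ θ : ℝ, ∫ y in Metric.ball (0 : ℂ) s,
          (v (Circle.exp θ * (x + y)) - v (Circle.exp θ * x)) =
          ∫ y in Metric.closedBall (0 : ℂ) s,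
          (v (Circle.exp θ * (x + y)) - v (Circle.exp θ * x)) := fun θ => by
          refine setIntegral_congr_set ?_
          exact (Measure.addHaar_sphere volume (0 : ℂ) s) |> fun h0 => by
            refine (ae_eq_set.2 ⟨?_, ?_⟩)
            · simp [Set.sdiff_eq_empty.2 Metric.ball_subset_closedBall]
            · rw [Metric.closedBall_sdiff_ball]; exact h0
        simp_rw [this]
        refine continuous_parametric_integral_of_continuous (by fun_prop)
          (isCompact_closedBall (0 : ℂ) s)
      calc 0 < (2 * π - 0) * m := by rw [sub_zero]; positivity
        _ = ∫ _ in (0 : ℝ)..2 * π, m := by simp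
        _ ≤ _ := intervalIntegral.integral_mono_on (by positivity) (by simp)
          (hc.intervalIntegrable _ _) fun θ _ => hin θ
    refine absurd hpos (not_lt.2 (setIntegral_nonpos measurableSet_ball fun y hy => ?_))
    have hmem : x + y ∈ Metric.closedBall (0 : ℂ) R := by
      have : ‖y‖ < s := by simpa using hy
      rw [mem_closedBall_zero_iff]
      exact (norm_add_le _ _).trans (by linarith)
    have := hmax hmem
    simp only [mem_ofPred_eq] at this
    linarith
  have h0 : V 0 ≤ V x := hmax (by simp [hR.le])
  rw [hVu, hVu, hxR] at h0
  simp only [norm_zero, circleAverage_zero, ne_eq, OfNat.ofNat_ne_zero, not_false_eq_true,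
    zero_pow, mul_zero, add_zero] at h0
  exact le_of_mul_le_mul_left h0 (by positivity)

/-- From small discs to a large disc. -/
theorem IsLocallySubmean.le_setIntegral {u : ℂ → ℝ} {z₁ : ℂ} {R L : ℝ} (hu : Continuous u)
    (hR : 0 < R) (hL : 0 ≤ L) (h : IsLocallySubmean u z₁ R L) :
    u z₁ * (Real.pi * R ^ 2) ≤
      (∫ z in Metric.ball z₁ R, u z) + (L + 1) * R ^ 2 * (Real.pi * R ^ 2) := by
  have hc : Continuous fun x : ℂ => Real.circleAverage u z₁ ‖x‖ :=
    (Real.Continuous.circleAverage hu).comp continuous_norm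
  rw [setIntegral_ball_eq_circleAverage hu.measurable (Continuous.integrableOn_ball_real hu _ _),
    ← volume_real_ball (0 : ℂ) hR.le, mul_comm, ← smul_eq_mul, ← setIntegral_const,
    mul_comm _ (volume.real _), ← smul_eq_mul (volume.real _), ← setIntegral_const,
    ← integral_add (Continuous.integrableOn_ball_real hc _ _)
      (Continuous.integrableOn_ball_real continuous_const _ _)]
  refine setIntegral_mono_on (Continuous.integrableOn_ball_real continuous_const _ _)
    (Continuous.integrableOn_ball_real (hc.add continuous_const) _ _) measurableSet_ball fun x hx => ?_
  have hxR : ‖x‖ < R := by simpa using hx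
  rcases (norm_nonneg x).eq_or_lt with h0 | h0
  · rw [← h0, Real.circleAverage_zero]
    have : 0 ≤ (L + 1) * R ^ 2 := by positivity
    linarith
  · have hsub : IsLocallySubmean u z₁ ‖x‖ L := by
      obtain ⟨δ, hδ, h⟩ := h
      exact ⟨δ, hδ, fun z hz s hs hsδ hsR =>
        h z (Metric.ball_subset_ball hxR.le hz) s hs hsδ (by linarith)⟩
    refine (hsub.le_circleAverage hu h0).trans ?_
    gcongr

end LogPotential

/-! ### Positive part of the effective potential -/

namespace LogPotential

variable {μ : Measure ℂ} {S : Set ℂ} {g : ℂ → ℝ} {z₀ : ℂ} {ρ Λ : ℝ}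

/-- On the disc `closedBall z₀ ρ`, `g` is differentiable with `Λ`-Lipschitz derivative. -/
structure IsC11Ball (g : ℂ → ℝ) (z₀ : ℂ) (ρ Λ : ℝ) : Prop where
  pos : 0 < ρ
  nonneg : 0 ≤ Λ
  diff : ∀ x ∈ Metric.closedBall z₀ ρ, DifferentiableAt ℝ g x
  lip : ∀ x ∈ Metric.closedBall z₀ ρ, ∀ y ∈ Metric.closedBall z₀ ρ,
    ‖fderiv ℝ g x - fderiv ℝ g y‖ ≤ Λ * ‖x - y‖

theorem IsLocallyC11On.exists_isC11Ball {U : Set ℂ} (hg : IsLocallyC11On g U) (hU : IsOpen U)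
    (hz : z₀ ∈ U) : ∃ ρ Λ, Metric.closedBall z₀ ρ ⊆ U ∧ IsC11Ball g z₀ ρ Λ := by
  obtain ⟨K, t, ht, hK⟩ := hg.2 hz
  rw [hU.nhdsWithin_eq hz] at ht
  obtain ⟨ρ, hρ, hball⟩ := Metric.nhds_basis_closedBall.mem_iff.1
    (inter_mem ht (hU.mem_nhds hz))
  refine ⟨ρ, K, fun x hx => (hball hx).2, hρ, K.2, fun x hx => ?_, fun x hx y hy => ?_⟩
  · exact (hg.1 x (hball hx).2).differentiableAt (hU.mem_nhds (hball hx).2)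
  · have := hK.dist_le_mul x (hball hx).1 y (hball hy).1
    rwa [dist_eq_norm, dist_eq_norm] at this

theorem IsC11Ball.abs_sub_le (hg : IsC11Ball g z₀ ρ Λ) {x y : ℂ} (hx : x ∈ Metric.closedBall z₀ ρ)
    (hy : x + y ∈ Metric.closedBall z₀ ρ) :
    |g (x + y) - g x - fderiv ℝ g x y| ≤ Λ * ‖y‖ ^ 2 := by
  have hseg : segment ℝ x (x + y) ⊆ Metric.closedBall z₀ ρ :=
    (convex_closedBall z₀ ρ).segment_subset hx hy
  have := (convex_segment x (x + y)).norm_image_sub_le_of_norm_hasFDerivWithin_le'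
    (f := g) (f' := fderiv ℝ g) (φ := fderiv ℝ g x) (C := Λ * ‖y‖)
    (fun p hp => (hg.diff p (hseg hp)).hasFDerivAt.hasFDerivWithinAt)
    (fun p hp => ?_) (left_mem_segment ℝ x (x + y)) (right_mem_segment ℝ x (x + y))
  · rw [add_sub_cancel_left] at this
    rw [← Real.norm_eq_abs]
    linarith
  · refine (hg.lip p (hseg hp) x hx).trans (mul_le_mul_of_nonneg_left ?_ hg.nonneg)
    obtain ⟨t, ht, rfl⟩ := (segment_eq_image' ℝ x (x + y)) ▸ hp
    rw [add_sub_cancel_left, add_sub_cancel_left, norm_smul, Real.norm_of_nonneg ht.1]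
    exact mul_le_of_le_one_left (norm_nonneg _) ht.2

theorem IsC11Ball.continuousOn (hg : IsC11Ball g z₀ ρ Λ) :
    ContinuousOn g (Metric.closedBall z₀ ρ) :=
  fun x hx => (hg.diff x hx).continuousAt.continuousWithinAt

theorem IsC11Ball.integrableOn (hg : IsC11Ball g z₀ ρ Λ) {z : ℂ} {s : ℝ}
    (hs : Metric.closedBall z s ⊆ Metric.closedBall z₀ ρ) :
    IntegrableOn (fun y => g (z + y)) (Metric.ball 0 s) := by
  refine IntegrableOn.mono_set ?_ Metric.ball_subset_closedBall
  refine ContinuousOn.integrableOn_compact (isCompact_closedBall 0 s) ?_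
  refine hg.continuousOn.comp (by fun_prop) fun y hy => hs ?_
  simpa using hy

/-- The linear Taylor term has mean zero over a centred disc, so only the quadratic remainder
counts. -/
theorem IsC11Ball.le_setIntegral (hg : IsC11Ball g z₀ ρ Λ) {z : ℂ} {s : ℝ} (hs0 : 0 ≤ s)
    (hs : Metric.closedBall z s ⊆ Metric.closedBall z₀ ρ) :
    -Λ * ∫ y in Metric.ball (0 : ℂ) s, ‖y‖ ^ 2 ≤ ∫ y in Metric.ball (0 : ℂ) s, (g (z + y) - g z) := by
  have hz : z ∈ Metric.closedBall z₀ ρ := hs (Metric.mem_closedBall_self hs0)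
  have h1 : ∫ y in Metric.ball (0 : ℂ) s, (-Λ * ‖y‖ ^ 2 + fderiv ℝ g z y) =
      -Λ * ∫ y in Metric.ball (0 : ℂ) s, ‖y‖ ^ 2 := by
    rw [integral_add (Continuous.integrableOn_ball_real (by fun_prop) _ _)
      (Continuous.integrableOn_ball_real (by fun_prop) _ _), setIntegral_ball_linear,
      integral_const_mul, add_zero]
  rw [← h1]
  refine setIntegral_mono_on (Continuous.integrableOn_ball_real (by fun_prop) _ _)
    ((hg.integrableOn hs).sub (integrableOn_const measure_ball_lt_top.ne)) measurableSet_ball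
    fun y hy => ?_
  have := hg.abs_sub_le hz (y := y) (hs (by simpa using (mem_ball_zero_iff.1 hy).le))
  have := (abs_le.1 this).1
  linarith

/-- The real valued effective potential. -/
noncomputable def effPot (μ : Measure ℂ) (g : ℂ → ℝ) (F : ℝ) (z : ℂ) : ℝ := pot μ z + g z / 2 - F

variable {F : ℝ}

theorem HasFinitePotential.integrableOn_pot [IsFiniteMeasure μ] (h : HasFinitePotential μ S)
    (z : ℂ) (r : ℝ) : IntegrableOn (pot μ) (Metric.ball z r) := by
  have h1 := ((h.setIntegral_pot z r).1.integrable_indicator measurableSet_ball).comp_sub_right z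
  rw [← integrable_indicator_iff measurableSet_ball]
  refine h1.congr (ae_of_all _ fun x => ?_)
  by_cases hx : x ∈ Metric.ball z r
  · have hx' : x - z ∈ Metric.ball (0 : ℂ) r := by
      rwa [mem_ball_zero_iff, ← dist_eq_norm]
    change (Metric.ball (0 : ℂ) r).indicator (fun x => pot μ (z + x)) (x - z) = _
    rw [indicator_of_mem hx, indicator_of_mem hx', add_sub_cancel]
  · have hx' : x - z ∉ Metric.ball (0 : ℂ) r := by
      rwa [mem_ball_zero_iff, ← dist_eq_norm]
    change (Metric.ball (0 : ℂ) r).indicator (fun x => pot μ (z + x)) (x - z) = _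
    rw [indicator_of_notMem hx, indicator_of_notMem hx']

theorem integrableOn_effPot [IsFiniteMeasure μ] (h : HasFinitePotential μ S)
    (hg : IsC11Ball g z₀ ρ Λ) {z : ℂ} {s : ℝ}
    (hs : Metric.closedBall z s ⊆ Metric.closedBall z₀ ρ) :
    IntegrableOn (effPot μ g F) (Metric.ball z s) := by
  refine ((h.integrableOn_pot z s).add ?_).sub (integrableOn_const measure_ball_lt_top.ne)
  exact (((hg.continuousOn.mono hs).integrableOn_compact (isCompact_closedBall z s)).mono_set
    Metric.ball_subset_closedBall).div_const 2

/-- The two contributions to the mean value of `E`: Taylor growth of `g`, and the loss due to the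
mass of `μ` near `z`. -/
theorem setIntegral_effPot_sub [IsFiniteMeasure μ] (h : HasFinitePotential μ S)
    (hg : IsC11Ball g z₀ ρ Λ) {z : ℂ} {s : ℝ}
    (hs : Metric.closedBall z s ⊆ Metric.closedBall z₀ ρ) :
    IntegrableOn (fun y => effPot μ g F (z + y) - effPot μ g F z) (Metric.ball 0 s) ∧
    ∫ y in Metric.ball (0 : ℂ) s, (effPot μ g F (z + y) - effPot μ g F z) =
      (∫ y in Metric.ball (0 : ℂ) s, (g (z + y) - g z)) / 2 -
        ∫ y in Metric.ball (0 : ℂ) s, potDefect μ z ‖y‖ := by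
  obtain ⟨i1, i2, e⟩ := h.setIntegral_pot z s
  have ic : ∀ c : ℝ, IntegrableOn (fun _ : ℂ => c) (Metric.ball (0 : ℂ) s) := fun c =>
    integrableOn_const measure_ball_lt_top.ne
  have ig : IntegrableOn (fun y => (g (z + y) - g z) / 2) (Metric.ball 0 s) :=
    ((hg.integrableOn hs).sub (ic _)).div_const 2
  have heq : ∀ y, effPot μ g F (z + y) - effPot μ g F z =
      (g (z + y) - g z) / 2 + (pot μ (z + y) - pot μ z) := fun y => by
    simp only [effPot]; ring
  simp_rw [heq]
  have ip : IntegrableOn (fun y => pot μ (z + y) - pot μ z) (Metric.ball 0 s) := i1.sub (ic _)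
  refine ⟨ig.add ip, ?_⟩
  rw [integral_add ig ip, integral_div, integral_sub i1 (ic _), e,
    integral_sub (ic _) i2]
  ring

/-- The potential need not be continuous at `S`, but `E ≤ 0` on `S` and upper semicontinuity give `E
< η` near `S`. The truncation at height `η` is thus zero there, and off `S` it inherits continuity.
-/
theorem continuousOn_max_effPot [IsFiniteMeasure μ] (h : HasFinitePotential μ S)
    (hg : IsC11Ball g z₀ ρ Λ) (hle : ∀ z ∈ S, effPot μ g F z ≤ 0) (hgc : ∀ z ∈ S, ContinuousAt g z)
    {η : ℝ} (hη : 0 < η) :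
    (∀ z ∈ S, ∀ᶠ x in 𝓝 z, effPot μ g F x < η) ∧
    ContinuousOn (fun z => max (effPot μ g F z - η) 0) (Metric.closedBall z₀ ρ) := by
  have hS : ∀ z ∈ S, ∀ᶠ x in 𝓝 z, effPot μ g F x < η := by
    intro z hz
    have h1 := h.eventually_pot_lt (φ := fun z => F - g z / 2)
      (fun z hz => by have := hle z hz; rw [effPot] at this; linarith) hz
      (continuousAt_const.sub ((hgc z hz).div_const 2)) (half_pos hη)
    have h2 : ∀ᶠ x in 𝓝 z, g x < g z + η := (hgc z hz).eventually (gt_mem_nhds (by linarith))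
    filter_upwards [h1, h2] with x h1 h2
    rw [effPot]; linarith
  refine ⟨hS, fun z hz => ContinuousAt.continuousWithinAt ?_⟩
  by_cases hzS : z ∈ S
  · refine (continuousAt_const (y := (0 : ℝ))).congr ?_
    filter_upwards [hS z hzS] with x hx
    rw [max_eq_right (by linarith)]
  · have : ContinuousAt (effPot μ g F) z :=
      ((h.continuousAt hzS).add ((hg.diff z hz).continuousAt.div_const 2)).sub continuousAt_const
    exact (this.sub continuousAt_const).max continuousAt_const

/-- The positive part of the effective potential has the sub-mean value property up to a
quadratic error. -/
theorem max_effPot_le_setIntegral [IsFiniteMeasure μ] (h : HasFinitePotential μ S)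
    (hg : IsC11Ball g z₀ ρ Λ) (hle : ∀ z ∈ S, effPot μ g F z ≤ 0) (hgc : ∀ z ∈ S, ContinuousAt g z)
    {z₁ : ℂ} {R : ℝ} (hR : 0 < R) (hR₁ : Metric.closedBall z₁ R ⊆ Metric.closedBall z₀ ρ) :
    max (effPot μ g F z₁) 0 * (Real.pi * R ^ 2) ≤
      (∫ z in Metric.ball z₁ R, max (effPot μ g F z) 0) + (Λ + 1) * R ^ 2 * (Real.pi * R ^ 2) := by
  set w := effPot μ g F with hw
  have hwi : IntegrableOn (fun z => max (w z) 0) (Metric.ball z₁ R) :=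
    (integrableOn_effPot h hg hR₁).sup (integrableOn_const measure_ball_lt_top.ne)
  have hΛ := hg.nonneg
  -- Truncation at `η > 0` supplies the continuity needed for the maximum principle; `η → 0` at the
  -- end.
  have key : ∀ η : ℝ, 0 < η → max (w z₁ - η) 0 * (Real.pi * R ^ 2) ≤
      (∫ z in Metric.ball z₁ R, max (w z) 0) + (Λ + 1) * R ^ 2 * (Real.pi * R ^ 2) := by
    intro η hη
    obtain ⟨hS, hcont⟩ := continuousOn_max_effPot h hg hle hgc hη
    have hc1 : ContinuousOn (fun z => max (w z - η) 0) (Metric.closedBall z₁ R) := hcont.mono hR₁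
    -- Tietze extension, because the averaging lemmas ask for functions continuous on the whole
    -- plane.
    obtain ⟨u, hu⟩ := ContinuousMap.exists_restrict_eq (Metric.isClosed_closedBall (x := z₁) (ε := R))
      ⟨_, hc1.domRestrict⟩
    have hueq : ∀ z ∈ Metric.closedBall z₁ R, u z = max (w z - η) 0 := fun z hz =>
      DFunLike.congr_fun hu ⟨z, hz⟩
    have hsub : IsLocallySubmean u z₁ R Λ := by
      -- The part of the disc where `w` may reach `η` is at a positive distance `δ` from `S`, by
      -- compactness. Discs of radius below `δ` centred there miss `S`.
      set O := interior {x | w x < η} with hO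
      have hSO : S ⊆ O := fun z hz => mem_interior_iff_mem_nhds.2 (hS z hz)
      have hK : IsCompact (Metric.closedBall z₁ R \ O) :=
        (isCompact_closedBall z₁ R).inter_right isOpen_interior.isClosed_compl
      obtain ⟨δ, hδ, hthick⟩ := hK.exists_cthickening_subset_open h.isCompact.isClosed.isOpen_compl
        (fun x hx hxS => hx.2 (hSO hxS))
      refine ⟨δ, hδ, fun z hz s hs0 hsδ hsR => ?_⟩
      have hzs : Metric.closedBall z s ⊆ Metric.closedBall z₁ R := by
        refine Metric.closedBall_subset_closedBall' ?_
        rw [dist_eq_norm]; linarith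
      have hmem : ∀ y ∈ Metric.ball (0 : ℂ) s, z + y ∈ Metric.closedBall z₁ R := fun y hy =>
        hzs (by simpa using (mem_ball_zero_iff.1 hy).le)
      have hzc : z ∈ Metric.closedBall z₁ R := Metric.ball_subset_closedBall hz
      have hm0 : 0 ≤ ∫ y in Metric.ball (0 : ℂ) s, ‖y‖ ^ 2 := integral_nonneg fun _ => by positivity
      rcases le_or_gt (w z) η with hwz | hwz
      · have huz : u z = 0 := by rw [hueq z hzc, max_eq_right (by linarith)]
        have : 0 ≤ ∫ y in Metric.ball (0 : ℂ) s, (u (z + y) - u z) :=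
          setIntegral_nonneg measurableSet_ball fun y hy => by
            rw [huz, hueq _ (hmem y hy), sub_zero]
            exact le_max_right _ _
        have := mul_nonneg hΛ hm0
        linarith
      -- Here the defect vanishes, so only the error from `g` remains; in the other case `u` is zero
      -- at the centre and nonnegative.
      · have hzO : z ∉ O := fun hzO => by
          have : z ∈ {x | w x < η} := interior_subset hzO
          exact absurd this (not_lt.2 hwz.le)
        have hdist : ∀ x ∈ S, s ≤ ‖z - x‖ := fun x hx => by
          by_contra hlt
          push Not at hlt
          refine hthick (Metric.mem_cthickening_of_dist_le x z δ _ ⟨hzc, hzO⟩ ?_) hx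
          rw [dist_comm, dist_eq_norm]; linarith
        obtain ⟨iw, ew⟩ := setIntegral_effPot_sub (F := F) h hg (hzs.trans hR₁)
        have hdef : ∫ y in Metric.ball (0 : ℂ) s, potDefect μ z ‖y‖ = 0 := by
          refine setIntegral_eq_zero_of_forall_eq_zero fun y hy => ?_
          exact h.potDefect_eq_zero (norm_nonneg y) (mem_ball_zero_iff.1 hy).le hdist
        have h1 : ∫ y in Metric.ball (0 : ℂ) s, (w (z + y) - w z) ≤
            ∫ y in Metric.ball (0 : ℂ) s, (u (z + y) - u z) := by
          refine setIntegral_mono_on iw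
            (Continuous.integrableOn_ball_real (by fun_prop) _ _) measurableSet_ball fun y hy => ?_
          rw [hueq z hzc, hueq _ (hmem y hy), max_eq_left (a := w z - η) (by linarith)]
          have := le_max_left (w (z + y) - η) 0
          linarith
        have h2 := hg.le_setIntegral hs0.le (hzs.trans hR₁)
        rw [ew, hdef] at h1
        have := mul_nonneg hΛ hm0
        linarith
    have h1 := hsub.le_setIntegral u.continuous hR hΛ
    rw [hueq z₁ (Metric.mem_closedBall_self hR.le)] at h1
    refine h1.trans (add_le_add_left ?_ _)
    refine setIntegral_mono_on (Continuous.integrableOn_ball_real u.continuous _ _) hwi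
      measurableSet_ball fun z hz => ?_
    rw [hueq z (Metric.ball_subset_closedBall hz)]
    exact max_le_max (by linarith) le_rfl
  have hlim : Tendsto (fun η : ℝ => max (w z₁ - η) 0 * (Real.pi * R ^ 2)) (𝓝[>] 0)
      (𝓝 (max (w z₁ - 0) 0 * (Real.pi * R ^ 2))) :=
    (Continuous.tendsto (by fun_prop) 0).mono_left nhdsWithin_le_nhds
  rw [sub_zero] at hlim
  exact le_of_tendsto hlim (eventually_mem_nhdsWithin.mono fun η hη => key η hη)

end LogPotential

/-! ### Decay of the positive part at density points of the support -/

namespace LogPotential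

variable {μ : Measure ℂ} {S : Set ℂ} {g : ℂ → ℝ} {z₀ : ℂ} {ρ Λ F : ℝ}

theorem exists_max_effPot_le [IsFiniteMeasure μ] (h : HasFinitePotential μ S)
    (hne : S.Nonempty) (hg : IsC11Ball g z₀ ρ Λ) (hle : ∀ z ∈ S, effPot μ g F z ≤ 0)
    (hgc : ∀ z ∈ S, ContinuousAt g z) :
    ∃ B, 0 ≤ B ∧ ∀ z ∈ Metric.closedBall z₀ ρ, max (effPot μ g F z) 0 ≤ B := by
  obtain ⟨m, hm⟩ := h.isCompact.exists_bound_of_continuousOn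
    (fun z hz => (hgc z hz).continuousWithinAt)
  obtain ⟨m', hm'⟩ := (isCompact_closedBall z₀ ρ).exists_bound_of_continuousOn hg.continuousOn
  have h1 : ∀ z ∈ S, pot μ z ≤ F + m / 2 := fun z hz => by
    have h1 := hle z hz
    have h2 := (abs_le.1 (hm z hz)).1
    rw [effPot] at h1
    linarith
  refine ⟨max (F + m / 2 + Real.log 2 * μ.real univ + m' / 2 - F) 0, le_max_right _ _,
    fun z hz => max_le_max ?_ le_rfl⟩
  have h2 := h.pot_le_of_le hne h1 z
  have h3 := (abs_le.1 (hm' z hz)).2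
  rw [effPot]
  linarith

/-- Every neighbourhood of `z₀` is almost filled by `S`. -/
def IsDensityPoint (S : Set ℂ) (z₀ : ℂ) : Prop :=
  ∀ δ > 0, ∀ᶠ r in 𝓝[>] (0 : ℝ), volume.real (Metric.ball z₀ r \ S) ≤ δ * (Real.pi * r ^ 2)

theorem ae_isDensityPoint (hS : MeasurableSet S) :
    ∀ᵐ z ∂(volume.restrict S), IsDensityPoint S z := by
  rw [ae_restrict_iff' hS]
  filter_upwards [Besicovitch.ae_tendsto_measure_inter_div_of_measurableSet volume hS.compl]
    with z hz hzS δ hδ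
  rw [indicator_of_notMem (by simpa using hzS)] at hz
  have h1 := hz.eventually_le_const (u := ENNReal.ofReal δ) (by simpa using hδ)
  filter_upwards [h1, self_mem_nhdsWithin] with r hr hr0
  have hr0 : 0 < r := hr0
  have hv : volume (Metric.closedBall z r) = ENNReal.ofReal (Real.pi * r ^ 2) := by
    rw [Complex.volume_closedBall, ENNReal.ofReal_mul Real.pi_pos.le, ENNReal.ofReal_pow hr0.le,
      mul_comm]
    congr 1
    simp [ENNReal.ofReal, Real.toNNReal_of_nonneg Real.pi_pos.le]
    rfl
  have hpos : 0 < Real.pi * r ^ 2 := by positivity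
  rw [ENNReal.div_le_iff (by rw [hv]; simpa using hpos) (by rw [hv]; simp), hv,
    ← ENNReal.ofReal_mul hδ.le] at hr
  refine ENNReal.toReal_le_of_le_ofReal (by positivity) (le_trans (measure_mono ?_) hr)
  exact fun x hx => ⟨hx.2, Metric.ball_subset_closedBall hx.1⟩

/-- The integrand vanishes on `S`, so only the sparse complement contributes. -/
theorem setIntegral_max_effPot_le [IsFiniteMeasure μ] (h : HasFinitePotential μ S)
    (hg : IsC11Ball g z₀ ρ Λ) (hle : ∀ z ∈ S, effPot μ g F z ≤ 0)
    {z : ℂ} {r A : ℝ} (hr : Metric.closedBall z r ⊆ Metric.closedBall z₀ ρ)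
    (hA : ∀ x ∈ Metric.ball z r, max (effPot μ g F x) 0 ≤ A) :
    IntegrableOn (fun x => max (effPot μ g F x) 0) (Metric.ball z r) ∧
    ∫ x in Metric.ball z r, max (effPot μ g F x) 0 ≤ A * volume.real (Metric.ball z r \ S) := by
  have hi : IntegrableOn (fun x => max (effPot μ g F x) 0) (Metric.ball z r) :=
    (integrableOn_effPot h hg hr).sup (integrableOn_const measure_ball_lt_top.ne)
  have hms : MeasurableSet (Metric.ball z r \ S) := measurableSet_ball.diff h.isCompact.measurableSet
  have hfin : volume (Metric.ball z r \ S) ≠ ∞ :=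
    ((measure_mono sdiff_subset).trans_lt measure_ball_lt_top).ne
  refine ⟨hi, ?_⟩
  rw [setIntegral_eq_of_subset_of_forall_sdiff_eq_zero (s := Metric.ball z r \ S)
    measurableSet_ball sdiff_subset fun x hx => ?_]
  · refine (setIntegral_mono_on (hi.mono_set sdiff_subset) (integrableOn_const hfin) hms
      fun x hx => hA x hx.1).trans_eq ?_
    rw [setIntegral_const, smul_eq_mul, mul_comm]
  · have : x ∈ S := by
      by_contra hxS
      exact hx.2 ⟨hx.1, hxS⟩
    exact max_eq_right (hle x this)

/-- At a density point of `S`, the effective potential has a quadratically small positive part. -/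
theorem exists_setIntegral_max_effPot_le [IsFiniteMeasure μ] (h : HasFinitePotential μ S)
    (hne : S.Nonempty) (hg : IsC11Ball g z₀ ρ Λ) (hle : ∀ z ∈ S, effPot μ g F z ≤ 0)
    (hgc : ∀ z ∈ S, ContinuousAt g z) (hd : IsDensityPoint S z₀) {ε r' : ℝ} (hε : 0 < ε)
    (hr' : 0 < r') : ∃ r, 0 < r ∧ r < r' ∧ r ≤ ρ ∧
      ∫ z in Metric.ball z₀ r, max (effPot μ g F z) 0 ≤ ε * r ^ 4 := by
  obtain ⟨B, hB0, hB⟩ := exists_max_effPot_le h hne hg hle hgc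
  -- Passing to half the radius multiplies relative area by `4`, so density `1/32` leaves a factor
  -- `1/8`: half of the wanted `1/4`.
  obtain ⟨r₁, hr₁, hd₁⟩ := (mem_nhdsGT_iff_exists_Ioo_subset).1 (hd (1 / 32) (by norm_num))
  set r₀ := min ρ (r₁ / 2) with hr₀
  have hr₁ : 0 < r₁ := hr₁
  have hr₀pos : 0 < r₀ := lt_min hg.pos (half_pos hr₁)
  have hr₀ρ : r₀ ≤ ρ := min_le_left _ _
  have hD : ∀ r, 0 < r → r ≤ r₀ →
      volume.real (Metric.ball z₀ r \ S) ≤ 1 / 32 * (Real.pi * r ^ 2) := fun r h0 h1 =>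
    hd₁ ⟨h0, by have := min_le_right ρ (r₁ / 2); linarith⟩
  set C := Λ + 1 with hC
  have hC0 : 0 < C := by have := hg.nonneg; linarith
  -- `M ≥ B` starts the induction; `2 C r₀² ≤ M` makes the error `C (r/2)²` at most another `M
  -- (1/4)^k / 8`.
  set M := B + 2 * C * r₀ ^ 2 with hM
  have hM0 : 0 < M := by positivity
  have hrk : ∀ k : ℕ, 0 < r₀ * (1 / 2) ^ k := fun k => by positivity
  have hrk' : ∀ k : ℕ, r₀ * (1 / 2) ^ k ≤ r₀ := fun k =>
    mul_le_of_le_one_right hr₀pos.le (pow_le_one₀ (by norm_num) (by norm_num))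
  have hsub : ∀ k : ℕ, Metric.closedBall z₀ (r₀ * (1 / 2) ^ k) ⊆ Metric.closedBall z₀ ρ := fun k =>
    Metric.closedBall_subset_closedBall ((hrk' k).trans hr₀ρ)
  -- Quadratic decay of `E⁺` along dyadic radii, from the sub-mean value inequality on half discs.
  have hdecay : ∀ k : ℕ, ∀ z ∈ Metric.ball z₀ (r₀ * (1 / 2) ^ k),
      max (effPot μ g F z) 0 ≤ M * (1 / 4) ^ k := by
    intro k
    induction k with
    | zero =>
      intro z hz
      have := hB z (hsub 0 (Metric.ball_subset_closedBall hz))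
      have : 0 ≤ 2 * C * r₀ ^ 2 := by positivity
      rw [pow_zero, mul_one]
      linarith
    | succ k ih =>
      intro z hz
      set r := r₀ * (1 / 2) ^ k with hr
      have hr1 : r₀ * (1 / 2) ^ (k + 1) = r / 2 := by rw [hr, pow_succ]; ring
      rw [hr1] at hz
      have hrpos : 0 < r := hrk k
      have hzz : Metric.closedBall z (r / 2) ⊆ Metric.closedBall z₀ r :=
        Metric.closedBall_subset_closedBall' (by have := Metric.mem_ball.1 hz; linarith)
      have hzb : Metric.ball z (r / 2) ⊆ Metric.ball z₀ r :=
        Metric.ball_subset_ball' (by have := Metric.mem_ball.1 hz; linarith)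
      have h1 := max_effPot_le_setIntegral h hg hle hgc (half_pos hrpos) (hzz.trans (hsub k))
      obtain ⟨hi, h2⟩ := setIntegral_max_effPot_le h hg hle (hsub k) ih
      have h3 : ∫ x in Metric.ball z (r / 2), max (effPot μ g F x) 0 ≤
          ∫ x in Metric.ball z₀ r, max (effPot μ g F x) 0 :=
        setIntegral_mono_set hi (ae_of_all _ fun _ => le_max_right _ _) hzb.eventuallyLE
      have h4 : M * (1 / 4) ^ k * volume.real (Metric.ball z₀ r \ S) ≤
          M * (1 / 4) ^ k * (1 / 32 * (Real.pi * r ^ 2)) :=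
        mul_le_mul_of_nonneg_left (hD r hrpos (hrk' k)) (by positivity)
      have h5 : r ^ 2 = r₀ ^ 2 * (1 / 4) ^ k := by
        rw [hr, mul_pow, ← pow_mul, mul_comm k 2, pow_mul]; norm_num
      have hq : 0 < (1 / 4 : ℝ) ^ k := by positivity
      have h6 : 2 * C * r₀ ^ 2 ≤ M := by linarith
      have h7 : max (effPot μ g F z) 0 * (Real.pi * (r / 2) ^ 2) ≤
          (M * (1 / 4) ^ k / 8 + C * (r / 2) ^ 2) * (Real.pi * (r / 2) ^ 2) := by
        calc _ ≤ M * (1 / 4) ^ k * (1 / 32 * (Real.pi * r ^ 2)) +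
              C * (r / 2) ^ 2 * (Real.pi * (r / 2) ^ 2) := by linarith
          _ = _ := by ring
      have h8 := le_of_mul_le_mul_right h7 (by positivity)
      refine h8.trans ?_
      rw [div_pow r 2, h5, pow_succ (1 / 4 : ℝ) k]
      nlinarith [mul_le_mul_of_nonneg_right h6 hq.le]
  -- With `E⁺ ≤ M r²/r₀²` in hand, this finer density threshold turns the integral bound into `ε
  -- r⁴`.
  obtain ⟨r₂, hr₂, hd₂⟩ := (mem_nhdsGT_iff_exists_Ioo_subset).1
    (hd (ε * r₀ ^ 2 / (M * Real.pi)) (by positivity))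
  have hr₂ : 0 < r₂ := hr₂
  obtain ⟨k, hk⟩ := exists_pow_lt_of_lt_one (y := (1 / 2 : ℝ)) (x := min r' r₂ / r₀)
    (div_pos (lt_min hr' hr₂) hr₀pos) (by norm_num)
  rw [lt_div_iff₀ hr₀pos, mul_comm] at hk
  refine ⟨r₀ * (1 / 2) ^ k, hrk k, hk.trans_le (min_le_left _ _), (hrk' k).trans hr₀ρ, ?_⟩
  refine (setIntegral_max_effPot_le h hg hle (hsub k) (hdecay k)).2.trans ?_
  have h1 := hd₂ ⟨hrk k, hk.trans_le (min_le_right _ _)⟩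
  refine (mul_le_mul_of_nonneg_left h1 (by positivity)).trans_eq ?_
  have h5 : (r₀ * (1 / 2) ^ k) ^ 2 = r₀ ^ 2 * (1 / 4) ^ k := by
    rw [mul_pow, ← pow_mul, mul_comm k 2, pow_mul]; norm_num
  rw [show (r₀ * (1 / 2 : ℝ) ^ k) ^ 4 = ((r₀ * (1 / 2) ^ k) ^ 2) ^ 2 by ring, h5]
  field_simp

end LogPotential

/-! ### Lower bound for the density of the equilibrium measure -/

namespace LogPotential

variable {μ : Measure ℂ} {S : Set ℂ} {g : ℂ → ℝ} {z₀ : ℂ} {ρ Λ F : ℝ}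

/-- Rademacher's theorem for the derivative of a `C^{1,1}` function. -/
theorem IsLocallyC11On.ae_differentiableAt_fderiv {U : Set ℂ} (hg : IsLocallyC11On g U)
    (hU : IsOpen U) : ∀ᵐ z, z ∈ U → DifferentiableAt ℝ (fderiv ℝ g) z := by
  have : volume {z | z ∈ U ∧ ¬ DifferentiableAt ℝ (fderiv ℝ g) z} = 0 := by
    refine measure_null_of_locally_null _ fun z hz => ?_
    obtain ⟨K, t, ht, hK⟩ := hg.2 hz.1
    rw [hU.nhdsWithin_eq hz.1] at ht
    obtain ⟨O, hOt, hO, hzO⟩ := mem_nhds_iff.1 ht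
    refine ⟨{z | z ∈ U ∧ ¬ DifferentiableAt ℝ (fderiv ℝ g) z} ∩ O,
      inter_mem_nhdsWithin _ (hO.mem_nhds hzO), ?_⟩
    refine measure_mono_null (fun x hx => ?_)
      ((hK.mono hOt).ae_differentiableWithinAt_of_mem (μ := volume))
    intro hx'
    exact hx.1.2 ((hx' hx.2).differentiableAt (hO.mem_nhds hx.2))
  filter_upwards [measure_eq_zero_iff_ae_notMem.1 this] with z hz hzU
  by_contra hd
  exact hz ⟨hzU, hd⟩

/-- Differentiability of the derivative at the single point `z₀` suffices: along the segment from
`z₀` the remainder has derivative at most `ε‖x‖²`. -/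
theorem IsC11Ball.eventually_abs_taylor_le (hg : IsC11Ball g z₀ ρ Λ) {B : ℂ →L[ℝ] ℂ →L[ℝ] ℝ}
    (hB : HasFDerivAt (fderiv ℝ g) B z₀) {ε : ℝ} (hε : 0 < ε) :
    ∃ r > 0, ∀ x : ℂ, ‖x‖ < r →
      |g (z₀ + x) - g z₀ - fderiv ℝ g z₀ x - B x x / 2| ≤ ε * ‖x‖ ^ 2 := by
  have h1 := (hasFDerivAt_iff_isLittleO_nhds_zero.1 hB).def hε
  obtain ⟨r, hr, hball⟩ := Metric.eventually_nhds_iff_ball.1 h1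
  refine ⟨min r ρ, lt_min hr hg.pos, fun x hx => ?_⟩
  have hxr : ‖x‖ < r := hx.trans_le (min_le_left _ _)
  have hxρ : ‖x‖ ≤ ρ := hx.le.trans (min_le_right _ _)
  have htx : ∀ t ∈ Icc (0 : ℝ) 1, ‖t • x‖ ≤ ‖x‖ := fun t ht => by
    rw [norm_smul, Real.norm_of_nonneg ht.1]
    exact mul_le_of_le_one_left (norm_nonneg _) ht.2
  have hd : ∀ t ∈ Icc (0 : ℝ) 1, HasDerivWithinAt
      (fun t : ℝ => g (z₀ + t • x) - t * fderiv ℝ g z₀ x - t ^ 2 * (B x x / 2))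
      (fderiv ℝ g (z₀ + t • x) x - fderiv ℝ g z₀ x - t * B x x) (Icc 0 1) t := by
    intro t ht
    have hmem : z₀ + t • x ∈ Metric.closedBall z₀ ρ := by
      rw [mem_closedBall_iff_norm, add_sub_cancel_left]
      exact (htx t ht).trans hxρ
    have hl : HasDerivAt (fun t : ℝ => z₀ + t • x) x t := by
      simpa using ((hasDerivAt_id t).smul_const x).const_add z₀
    have e1 := (hg.diff _ hmem).hasFDerivAt.comp_hasDerivAt t hl
    have e2 := (hasDerivAt_id t).mul_const (fderiv ℝ g z₀ x)
    have e3 := ((hasDerivAt_id t).pow 2).mul_const (B x x / 2)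
    refine (((e1.sub e2).sub e3).congr_deriv ?_).hasDerivWithinAt
    simp only [id_eq, Nat.cast_ofNat, Nat.add_one_sub_one, pow_one]
    ring
  have := norm_image_sub_le_of_norm_deriv_le_segment_01' hd (C := ε * ‖x‖ ^ 2) fun t ht => ?_
  · simp only [one_smul, zero_smul, add_zero, one_mul, one_pow, zero_mul, sub_zero, ne_eq,
      OfNat.ofNat_ne_zero, not_false_eq_true, zero_pow] at this
    rw [Real.norm_eq_abs] at this
    rwa [show g (z₀ + x) - g z₀ - fderiv ℝ g z₀ x - B x x / 2 =
      g (z₀ + x) - fderiv ℝ g z₀ x - B x x / 2 - g z₀ by ring]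
  · have ht' : t ∈ Icc (0 : ℝ) 1 := ⟨ht.1, ht.2.le⟩
    have h2 := hball (t • x) (mem_ball_zero_iff.2 ((htx t ht').trans_lt hxr))
    have h3 := ContinuousLinearMap.le_of_opNorm_le _ h2 x
    simp only [sub_apply, map_smul, smul_apply,
      smul_eq_mul] at h3
    refine h3.trans ?_
    rw [pow_two, ← mul_assoc]
    gcongr
    exact htx t ht'

/-- At a density point, the upper density of `μ` is at least `Δg / 4π`. -/
theorem laplacian_le_of_measure_closedBall_le [IsFiniteMeasure μ] (h : HasFinitePotential μ S)
    (hne : S.Nonempty) (hg : IsC11Ball g z₀ ρ Λ) (hle : ∀ z ∈ S, effPot μ g F z ≤ 0)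
    (hgc : ∀ z ∈ S, ContinuousAt g z) (hd : IsDensityPoint S z₀) (h0 : effPot μ g F z₀ = 0)
    (hB : DifferentiableAt ℝ (fderiv ℝ g) z₀) {a : ℝ} (ha : 0 ≤ a)
    (hμ : ∀ᶠ t in 𝓝[>] (0 : ℝ), μ.real (Metric.closedBall z₀ t) ≤ a * t ^ 2) :
    Laplacian.laplacian g z₀ / 4 ≤ a := by
  by_contra hlt
  push Not at hlt
  set L := Laplacian.laplacian g z₀ with hL
  -- With `L/4 - a = 8ε`, the final comparison reads `(7/2) ε (π/2) ≤ ε`, which is absurd.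
  obtain ⟨ε, hε⟩ : ∃ ε, ε = (L / 4 - a) / 8 := ⟨_, rfl⟩
  have hε0 : 0 < ε := by rw [hε]; linarith
  obtain ⟨r₁, hr₁, htaylor⟩ := hg.eventually_abs_taylor_le hB.hasFDerivAt hε0
  obtain ⟨r₂, hr₂, hμ⟩ := (mem_nhdsGT_iff_exists_Ioo_subset).1 hμ
  have hr₂ : 0 < r₂ := hr₂
  obtain ⟨r, hr, hrr, hrρ, hint⟩ := exists_setIntegral_max_effPot_le h hne hg hle hgc hd
    (ε := ε) (r' := min r₁ r₂) hε0 (lt_min hr₁ hr₂)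
  have hrr₁ : r < r₁ := hrr.trans_le (min_le_left _ _)
  have hrr₂ : r < r₂ := hrr.trans_le (min_le_right _ _)
  have hsub : Metric.closedBall z₀ r ⊆ Metric.closedBall z₀ ρ :=
    Metric.closedBall_subset_closedBall hrρ
  obtain ⟨hi, he⟩ := setIntegral_effPot_sub (F := F) h hg hsub
  have hm := setIntegral_ball_norm_sq hr.le
  -- As `E` vanishes at `z₀`, the integral of `E - E(z₀)` is bounded by that of `E⁺`.
  have hup : ∫ y in Metric.ball (0 : ℂ) r, (effPot μ g F (z₀ + y) - effPot μ g F z₀) ≤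
      ε * r ^ 4 := by
    refine le_trans ?_ hint
    have hmi : IntegrableOn (fun x => max (effPot μ g F x) 0) (Metric.ball z₀ r) :=
      (integrableOn_effPot h hg hsub).sup (integrableOn_const measure_ball_lt_top.ne)
    have e1 : MeasurePreserving (fun y : ℂ => z₀ + y) volume volume :=
      measurePreserving_add_left volume z₀
    have e2 : MeasurableEmbedding (fun y : ℂ => z₀ + y) := measurableEmbedding_addLeft z₀
    have hpre : (fun y : ℂ => z₀ + y) ⁻¹' Metric.ball z₀ r = Metric.ball 0 r := by
      ext y; simp
    rw [← e1.setIntegral_preimage_emb e2 _ (Metric.ball z₀ r), hpre]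
    refine setIntegral_mono_on hi ?_ measurableSet_ball fun y _ => ?_
    · rw [← hpre]
      exact (e1.integrableOn_comp_preimage e2).2 hmi
    · rw [h0, sub_zero]
      exact le_max_left _ _
  have hgl : (L / 4 - ε) * (Real.pi * r ^ 4 / 2) ≤
      ∫ y in Metric.ball (0 : ℂ) r, (g (z₀ + y) - g z₀) := by
    set B := fderiv ℝ (fderiv ℝ g) z₀ with hBdef
    have h1 : ∫ y in Metric.ball (0 : ℂ) r, (fderiv ℝ g z₀ y + (B y y * (1 / 2) - ε * ‖y‖ ^ 2)) =
        (L / 4 - ε) * (Real.pi * r ^ 4 / 2) := by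
      rw [integral_add (Continuous.integrableOn_ball_real (by fun_prop) _ _)
        (Continuous.integrableOn_ball_real (by fun_prop) _ _), setIntegral_ball_linear,
        integral_sub (Continuous.integrableOn_ball_real (by fun_prop) _ _)
        (Continuous.integrableOn_ball_real (by fun_prop) _ _), integral_mul_const,
        integral_const_mul, setIntegral_ball_bilinear, hm, hL, laplacian_eq_fderiv_fderiv]
      ring
    rw [← h1]
    refine setIntegral_mono_on (Continuous.integrableOn_ball_real (by fun_prop) _ _)
      ((hg.integrableOn hsub).sub (integrableOn_const measure_ball_lt_top.ne)) measurableSet_ball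
      fun y hy => ?_
    have := (abs_le.1 (htaylor y ((mem_ball_zero_iff.1 hy).trans hrr₁))).1
    linarith
  have hdef : ∫ y in Metric.ball (0 : ℂ) r, potDefect μ z₀ ‖y‖ ≤
      a / 2 * (Real.pi * r ^ 4 / 2) := by
    rw [← hm, ← integral_const_mul]
    refine setIntegral_mono_on (h.setIntegral_pot z₀ r).2.1
      (Continuous.integrableOn_ball_real (by fun_prop) _ _) measurableSet_ball fun y hy => ?_
    rcases (norm_nonneg y).eq_or_lt with hy0 | hy0
    · rw [← hy0]
      simp [potDefect]
    · have := potDefect_le (μ := μ) (z := z₀) hy0 ha fun t ht hty =>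
        hμ ⟨ht, (hty.trans_lt (mem_ball_zero_iff.1 hy)).trans hrr₂⟩
      linarith
  rw [he] at hup
  have hpi := Real.pi_gt_three
  have hr4 : 0 < r ^ 4 := by positivity
  have : (L / 8 - ε / 2 - a / 2) * (Real.pi / 2) * r ^ 4 ≤ ε * r ^ 4 := by linarith
  have := le_of_mul_le_mul_right this hr4
  have hLa : L / 4 - a = 8 * ε := by linarith
  nlinarith

/-- If the effective potential is nonpositive on `S` and vanishes almost everywhere on `S`, then
the density of `μ` is at least `Δg / 4π` almost everywhere on `S`. -/
theorem ae_laplacian_le_rnDeriv [IsFiniteMeasure μ] (h : HasFinitePotential μ S)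
    (hne : S.Nonempty) {U : Set ℂ} (hU : IsOpen U) (hSU : S ⊆ U) (hg : IsLocallyC11On g U)
    (hle : ∀ z ∈ S, effPot μ g F z ≤ 0)
    (h0 : ∀ᵐ z ∂(volume.restrict S), effPot μ g F z = 0) :
    ∀ᵐ z ∂(volume.restrict S),
      ENNReal.ofReal (Laplacian.laplacian g z / (4 * Real.pi)) ≤ μ.rnDeriv volume z := by
  have hgc : ∀ z ∈ S, ContinuousAt g z := fun z hz =>
    ((hg.1 z (hSU hz)).differentiableAt (hU.mem_nhds (hSU hz))).continuousAt
  filter_upwards [h0, ae_isDensityPoint h.isCompact.measurableSet,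
    ae_restrict_of_ae (hg.ae_differentiableAt_fderiv hU),
    ae_restrict_of_ae (Besicovitch.ae_tendsto_rnDeriv μ volume),
    ae_restrict_mem h.isCompact.measurableSet] with z hz0 hzd hzB hzt hzS
  by_contra hlt
  push Not at hlt
  -- If the density is too small, a value strictly in between bounds `μ` of small discs by `b π r²`,
  -- through differentiation of measures.
  obtain ⟨b, hb1, hb2⟩ := exists_between hlt
  have hbt : b ≠ ∞ := (hb2.trans_le le_top).ne
  obtain ⟨ρ, Λ, -, hC⟩ := hg.exists_isC11Ball hU (hSU hzS)
  have h1 := laplacian_le_of_measure_closedBall_le h hne hC hle hgc hzd hz0 (hzB (hSU hzS))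
    (a := b.toReal * Real.pi) (by positivity) ?_
  · rw [ENNReal.lt_ofReal_iff_toReal_lt hbt, lt_div_iff₀ (by positivity)] at hb2
    linarith
  · filter_upwards [hzt.eventually_le_const hb1, self_mem_nhdsWithin] with r hr hr0
    have hr0 : 0 < r := hr0
    rw [ENNReal.div_le_iff (Metric.measure_closedBall_pos volume z hr0).ne'
      measure_closedBall_lt_top.ne] at hr
    have h2 := ENNReal.toReal_mono (ENNReal.mul_ne_top hbt measure_closedBall_lt_top.ne) hr
    rw [ENNReal.toReal_mul] at h2
    refine h2.trans_eq ?_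
    rw [← Measure.real, Measure.addHaar_real_closedBall_eq_addHaar_real_ball,
      volume_real_ball z hr0.le, mul_assoc]

end LogPotential

/-! ### Extended integrals and measures of finite weighted energy -/

namespace LogPotential

section EIntegral

variable {α : Type*} [MeasurableSpace α] {μ : Measure α} {φ : α → EReal} {h : α → ℝ}

theorem eintegral_congr_ae {ψ : α → EReal} (he : φ =ᵐ[μ] ψ) : eintegral μ φ = eintegral μ ψ := by
  rw [eintegral, eintegral, lintegral_congr_ae (he.mono fun x hx => by
    show (φ x).toENNReal = (ψ x).toENNReal; rw [hx]),
    lintegral_congr_ae (f := fun x => (-φ x).toENNReal) (he.mono fun x hx => by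
    show (-φ x).toENNReal = (-ψ x).toENNReal; rw [hx])]

theorem eintegral_coe (hh : Integrable h μ) :
    eintegral μ (fun x => (h x : EReal)) = ((∫ x, h x ∂μ : ℝ) : EReal) := by
  have h1 : ∫⁻ x, ENNReal.ofReal (h x) ∂μ ≠ ∞ := hh.lintegral_lt_top.ne
  have h2 : ∫⁻ x, ENNReal.ofReal (-h x) ∂μ ≠ ∞ := hh.neg.lintegral_lt_top.ne
  rw [eintegral, integral_eq_lintegral_pos_part_sub_lintegral_neg_part hh, EReal.coe_sub]
  simp_rw [← EReal.coe_neg, EReal.real_coe_toENNReal]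
  rw [EReal.coe_ennreal_toReal h1, EReal.coe_ennreal_toReal h2]

theorem eintegral_eq_coe_of_ae (hh : Integrable h μ) (he : ∀ᵐ x ∂μ, φ x = (h x : EReal)) :
    eintegral μ φ = ((∫ x, h x ∂μ : ℝ) : EReal) := by
  rw [eintegral_congr_ae he, eintegral_coe hh]

/-- A function bounded below by an integrable function, whose extended integral is finite, is
integrable. -/
theorem integrable_toReal_of_eintegral_ne_top (hφ : AEMeasurable φ μ) (hh : Integrable h μ)
    (hle : ∀ᵐ x ∂μ, (h x : EReal) ≤ φ x) (hlt : eintegral μ φ ≠ ⊤) :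
    (∀ᵐ x ∂μ, φ x = ((φ x).toReal : EReal)) ∧ Integrable (fun x => (φ x).toReal) μ := by
  have hneg : ∫⁻ x, (-φ x).toENNReal ∂μ ≤ ∫⁻ x, ENNReal.ofReal (-h x) ∂μ := by
    refine lintegral_mono_ae (hle.mono fun x hx => ?_)
    rw [← EReal.real_coe_toENNReal, EReal.coe_neg]
    exact EReal.toENNReal_le_toENNReal (EReal.neg_le_neg_iff.2 hx)
  have hneg' : ∫⁻ x, (-φ x).toENNReal ∂μ ≠ ∞ :=
    (hneg.trans_lt hh.neg.lintegral_lt_top).ne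
  have hpos : ∫⁻ x, (φ x).toENNReal ∂μ ≠ ∞ := by
    intro htop
    refine hlt ?_
    rw [eintegral, htop, ← EReal.coe_ennreal_toReal hneg', EReal.coe_ennreal_top,
      EReal.top_sub_coe]
  have hm : AEMeasurable (fun x => (φ x).toENNReal) μ := hφ.ereal_toENNReal
  have hfin : ∀ᵐ x ∂μ, φ x = ((φ x).toReal : EReal) := by
    filter_upwards [ae_lt_top' hm hpos, hle] with x hx hx'
    refine (EReal.coe_toReal ?_ ?_).symm
    · exact EReal.toENNReal_ne_top_iff.1 hx.ne
    · exact ((EReal.bot_lt_coe _).trans_le hx').ne'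
  refine ⟨hfin, hφ.ereal_toReal.aestronglyMeasurable, ?_⟩
  rw [HasFiniteIntegral]
  refine (lintegral_mono_ae (g := fun x => (φ x).toENNReal + (-φ x).toENNReal)
    (hfin.mono fun x hx => ?_)).trans_lt ?_
  · rw [hx, ← EReal.coe_neg, EReal.real_coe_toENNReal, EReal.real_coe_toENNReal, EReal.toReal_coe,
      Real.enorm_eq_ofReal_abs]
    rcases le_total 0 (φ x).toReal with h0 | h0
    · rw [abs_of_nonneg h0]; exact le_self_add
    · rw [abs_of_nonpos h0]; exact le_add_self
  · rw [lintegral_add_left' hm]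
    exact ENNReal.add_lt_top.2 ⟨hpos.lt_top, hneg'.lt_top⟩

end EIntegral

theorem measurable_logKernel : Measurable fun p : ℂ × ℂ => logKernel p.1 p.2 := by
  unfold logKernel
  refine Measurable.ite (measurableSet_eq_fun measurable_fst measurable_snd) measurable_const ?_
  exact Measurable.coe_real_ereal (by fun_prop)

theorem logKernel_of_ne {z w : ℂ} (h : z ≠ w) :
    logKernel z w = ((-Real.log ‖z - w‖ : ℝ) : EReal) := by
  rw [logKernel, if_neg h, one_div, Real.log_inv]

theorem neg_log_one_add_le_logKernel (z w : ℂ) :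
    ((-(Real.log (1 + ‖z‖) + Real.log (1 + ‖w‖)) : ℝ) : EReal) ≤ logKernel z w := by
  by_cases h : z = w
  · rw [logKernel, if_pos h]
    exact le_top
  · rw [logKernel_of_ne h, EReal.coe_le_coe_iff, neg_le_neg_iff]
    refine le_trans ?_ (posLog_norm_sub_le z w)
    rw [Real.posLog]
    exact le_max_right _ _

/-- The kernel has an integrable lower bound, so finite energy means integrability; as its value on
the diagonal is `⊤`, the diagonal is a null set. -/
theorem integrable_log_of_logEnergy_ne_top {ν : Measure ℂ} [IsFiniteMeasure ν]
    (hν : Integrable (fun z => Real.log (1 + ‖z‖)) ν) (h : logEnergy ν ≠ ⊤) :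
    Integrable (fun p : ℂ × ℂ => Real.log ‖p.1 - p.2‖) (ν.prod ν) ∧
      ∀ᵐ p ∂(ν.prod ν), p.1 ≠ p.2 := by
  obtain ⟨h1, h2⟩ := integrable_toReal_of_eintegral_ne_top
    (μ := ν.prod ν) measurable_logKernel.aemeasurable ((hν.comp_fst ν).add (hν.comp_snd ν)).neg
    (ae_of_all _ fun p => neg_log_one_add_le_logKernel p.1 p.2) h
  have hne : ∀ᵐ p ∂(ν.prod ν), p.1 ≠ p.2 := h1.mono fun p hp he => by
    rw [logKernel, if_pos he] at hp
    exact EReal.coe_ne_top _ hp.symm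
  refine ⟨h2.neg.congr (hne.mono fun p hp => ?_), hne⟩
  simp [logKernel_of_ne hp]

theorem logEnergy_eq {ν : Measure ℂ}
    (h : Integrable (fun p : ℂ × ℂ => Real.log ‖p.1 - p.2‖) (ν.prod ν))
    (hne : ∀ᵐ p ∂(ν.prod ν), p.1 ≠ p.2) : logEnergy ν = ((mutualEnergy ν ν : ℝ) : EReal) :=
  eintegral_eq_coe_of_ae h.neg (hne.mono fun _ hp => logKernel_of_ne hp)

theorem logPotential_eq {ν : Measure ℂ} {z : ℂ} (h : Integrable (fun w => Real.log ‖z - w‖) ν)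
    (hne : ∀ᵐ w ∂ν, w ≠ z) : logPotential ν z = ((pot ν z : ℝ) : EReal) :=
  eintegral_eq_coe_of_ae h.neg (hne.mono fun _ hp => logKernel_of_ne hp.symm)

/-- A measurable potential growing faster than `2 log |z|`. -/
structure IsConfining (V : ℂ → EReal) (δ c : ℝ) : Prop where
  measurable : Measurable V
  pos : 0 < δ
  le : ∀ z, (((2 + δ) * Real.log (1 + ‖z‖) - c : ℝ) : EReal) ≤ V z

theorem IsAdmissible.exists_isConfining {V : ℂ → EReal} (hV : IsAdmissible V) :
    ∃ δ c, IsConfining V δ c := by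
  obtain ⟨δ, hδ, hlim⟩ := hV.growth
  have h1 : ∀ᶠ z in cocompact ℂ, 0 < V z - (((2 + δ) * Real.log ‖z‖ : ℝ) : EReal) :=
    eventually_lt_of_lt_liminf (by rw [hlim]; exact EReal.zero_lt_top)
  obtain ⟨R, hR⟩ := Metric.closedBall_compl_subset_of_mem_cocompact h1 0
  obtain ⟨b, hb⟩ : ∃ b : ℝ, ∀ z ∈ Metric.closedBall (0 : ℂ) (max R 1), (b : EReal) ≤ V z := by
    obtain ⟨x, -, hx⟩ := (hV.lowerSemicontinuous.lowerSemicontinuousOn _).exists_isMinOn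
      ⟨0, by simp⟩ (isCompact_closedBall (0 : ℂ) (max R 1))
    obtain ⟨b, -, hb⟩ := EReal.lt_iff_exists_real_btwn.1 (bot_lt_iff_ne_bot.2 (hV.ne_bot x))
    exact ⟨b, fun z hz => hb.le.trans (hx hz)⟩
  -- The first entry serves large `‖z‖`, where `log(1 + ‖z‖) ≤ log 2 + log‖z‖`; the second serves
  -- the disc, where `V ≥ b` by lower semicontinuity.
  refine ⟨δ, max ((2 + δ) * Real.log 2) ((2 + δ) * Real.log (1 + max R 1) - b),
    hV.lowerSemicontinuous.measurable, hδ, fun z => ?_⟩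
  by_cases hz : z ∈ Metric.closedBall (0 : ℂ) (max R 1)
  · refine le_trans (EReal.coe_le_coe_iff.2 ?_) (hb z hz)
    have h2 : Real.log (1 + ‖z‖) ≤ Real.log (1 + max R 1) :=
      Real.log_le_log (by positivity) (by linarith [mem_closedBall_zero_iff.1 hz])
    have h3 := le_max_right ((2 + δ) * Real.log 2) ((2 + δ) * Real.log (1 + max R 1) - b)
    nlinarith
  · have hzR : max R 1 < ‖z‖ := by
      rw [mem_closedBall_zero_iff] at hz
      exact not_le.1 hz
    have h2 : 0 < V z - (((2 + δ) * Real.log ‖z‖ : ℝ) : EReal) := hR (by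
      rw [mem_compl_iff, mem_closedBall_zero_iff, not_le]
      exact (le_max_left _ _).trans_lt hzR)
    have hz1 : 1 < ‖z‖ := (le_max_right _ _).trans_lt hzR
    rw [EReal.sub_pos] at h2
    refine le_trans (EReal.coe_le_coe_iff.2 ?_) h2.le
    have h3 : Real.log (1 + ‖z‖) ≤ Real.log 2 + Real.log ‖z‖ := by
      rw [← Real.log_mul (by norm_num) (by positivity)]
      exact Real.log_le_log (by positivity) (by linarith)
    have h4 := le_max_left ((2 + δ) * Real.log 2) ((2 + δ) * Real.log (1 + max R 1) - b)
    nlinarith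

theorem IsConfining.perturb {V : ℂ → EReal} {δ c : ℝ} (hV : IsConfining V δ c) {f : ℂ → ℝ}
    (hf : Measurable f) {C : ℝ} (hC : ∀ z, |f z| ≤ C) :
    IsConfining (perturb V f) δ (c + C) := by
  refine ⟨?_, hV.pos, fun z => ?_⟩
  · have : LogPotential.perturb V f = fun z => V z + ((-f z : ℝ) : EReal) := by
      funext z
      rw [LogPotential.perturb, EReal.coe_neg, sub_eq_add_neg]
    rw [this]
    exact hV.measurable.add hf.neg.coe_real_ereal
  · rw [LogPotential.perturb]
    refine le_trans ?_ (EReal.sub_le_sub (hV.le z) le_rfl)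
    rw [← EReal.coe_sub, EReal.coe_le_coe_iff]
    linarith [(abs_le.1 (hC z)).2]

/-- The probability measures of finite weighted energy. -/
structure HasFiniteEnergy (V : ℂ → EReal) (ν : Measure ℂ) : Prop where
  isProbabilityMeasure : IsProbabilityMeasure ν
  ae_eq : ∀ᵐ z ∂ν, V z = ((V z).toReal : EReal)
  integrable : Integrable (fun z => (V z).toReal) ν
  logInt : Integrable (fun z => Real.log (1 + ‖z‖)) ν
  integrable_log : Integrable (fun p : ℂ × ℂ => Real.log ‖p.1 - p.2‖) (ν.prod ν)
  ae_ne : ∀ᵐ p ∂(ν.prod ν), p.1 ≠ p.2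

variable {V : ℂ → EReal} {ν : Measure ℂ}

theorem HasFiniteEnergy.eintegral_eq (h : HasFiniteEnergy V ν) :
    eintegral ν V = ((∫ z, (V z).toReal ∂ν : ℝ) : EReal) :=
  eintegral_eq_coe_of_ae h.integrable h.ae_eq

theorem HasFiniteEnergy.energy_eq (h : HasFiniteEnergy V ν) :
    energy V ν = ((mutualEnergy ν ν + ∫ z, (V z).toReal ∂ν : ℝ) : EReal) := by
  rw [energy, h.eintegral_eq, if_neg (EReal.coe_ne_top _), logEnergy_eq h.integrable_log h.ae_ne,
    EReal.coe_add]

theorem HasFiniteEnergy.equilibriumConstant_eq (h : HasFiniteEnergy V ν) :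
    equilibriumConstant V ν =
      ((mutualEnergy ν ν + 1 / 2 * ∫ z, (V z).toReal ∂ν : ℝ) : EReal) := by
  rw [equilibriumConstant, h.energy_eq, h.eintegral_eq, ← EReal.coe_mul, ← EReal.coe_sub]
  congr 1
  ring

theorem HasFiniteEnergy.noAtoms (h : HasFiniteEnergy V ν) (z : ℂ) : ν {z} = 0 := by
  have := h.isProbabilityMeasure
  have h1 : ν.prod ν ({z} ×ˢ {z}) = 0 := by
    refine measure_mono_null ?_ (ae_iff.1 h.ae_ne)
    rintro ⟨a, b⟩ ⟨ha, hb⟩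
    have ha : a = z := ha
    have hb : b = z := hb
    simp [ha, hb]
  rw [Measure.prod_prod] at h1
  exact mul_self_eq_zero.1 h1

/-- Since `V` is bounded below, a finite energy makes it integrable; its growth then gives the
logarithmic moment, which in turn bounds the kernel from below. -/
theorem IsConfining.hasFiniteEnergy {δ c : ℝ} (hV : IsConfining V δ c) [IsProbabilityMeasure ν]
    (h : energy V ν ≠ ⊤) : HasFiniteEnergy V ν := by
  have hδ := hV.pos
  have hlow : ∀ z : ℂ, -c ≤ (2 + δ) * Real.log (1 + ‖z‖) - c := fun z => by
    have : 0 ≤ Real.log (1 + ‖z‖) := Real.log_nonneg (by linarith [norm_nonneg z])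
    have : 0 ≤ (2 + δ) * Real.log (1 + ‖z‖) := by positivity
    linarith
  have hVtop : eintegral ν V ≠ ⊤ := fun htop => h (by rw [energy, if_pos htop])
  obtain ⟨h1, h2⟩ := integrable_toReal_of_eintegral_ne_top (h := fun _ => -c)
    hV.measurable.aemeasurable (integrable_const (-c))
    (ae_of_all _ fun z => (EReal.coe_le_coe_iff.2 (hlow z)).trans (hV.le z)) hVtop
  have h3 : Integrable (fun z => Real.log (1 + ‖z‖)) ν := by
    refine ((h2.add (integrable_const c)).div_const (2 + δ)).mono'
      (show Measurable fun z : ℂ => Real.log (1 + ‖z‖) by fun_prop).aestronglyMeasurable ?_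
    filter_upwards [h1] with z hz
    have hle := hV.le z
    rw [hz, EReal.coe_le_coe_iff] at hle
    rw [Real.norm_of_nonneg (Real.log_nonneg (by linarith [norm_nonneg z])),
      le_div_iff₀ (by linarith)]
    simp only [Pi.add_apply]
    linarith
  have h4 : logEnergy ν ≠ ⊤ := fun htop => h (by
    rw [energy, if_neg hVtop, htop, eintegral_eq_coe_of_ae h2 h1, EReal.top_add_coe])
  obtain ⟨h5, h6⟩ := integrable_log_of_logEnergy_ne_top h3 h4
  exact ⟨‹_›, h1, h2, h3, h5, h6⟩

end LogPotential

/-! ### Mutual energy, mixtures and the first variation -/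

namespace LogPotential

/-- The logarithmic kernel is integrable for the product of the two measures, which does not
charge the diagonal. -/
structure HasFiniteMutualEnergy (α β : Measure ℂ) : Prop where
  integrable : Integrable (fun p : ℂ × ℂ => Real.log ‖p.1 - p.2‖) (α.prod β)
  ae_ne : ∀ᵐ p ∂(α.prod β), p.1 ≠ p.2

section MutualEnergy

variable {α α' β : Measure ℂ}

theorem HasFiniteMutualEnergy.symm [SFinite α] [SFinite β] (h : HasFiniteMutualEnergy α β) :
    HasFiniteMutualEnergy β α := by
  refine ⟨h.integrable.swap.congr (ae_of_all _ fun p => ?_), ?_⟩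
  · simp [norm_sub_rev]
  · have h1 : Measure.map Prod.swap (β.prod α) = α.prod β := Measure.prod_swap
    have h2 := h.ae_ne
    rw [← h1] at h2
    exact (ae_of_ae_map measurable_swap.aemeasurable h2).mono fun p hp => Ne.symm hp

theorem HasFiniteMutualEnergy.add_left [SFinite α] [SFinite α'] [SFinite β]
    (h : HasFiniteMutualEnergy α β) (h' : HasFiniteMutualEnergy α' β) :
    HasFiniteMutualEnergy (α + α') β := by
  constructor
  · rw [Measure.add_prod]
    exact h.integrable.add_measure h'.integrable
  · rw [Measure.add_prod, ae_add_measure_iff]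
    exact ⟨h.ae_ne, h'.ae_ne⟩

theorem HasFiniteMutualEnergy.smul_left [SFinite β] (h : HasFiniteMutualEnergy α β) {c : ℝ≥0∞}
    (hc : c ≠ ∞) : HasFiniteMutualEnergy (c • α) β := by
  constructor
  · rw [Measure.prod_smul_left]
    exact h.integrable.smul_measure hc
  · rw [Measure.prod_smul_left]
    exact Measure.ae_smul_measure h.ae_ne c

theorem HasFiniteMutualEnergy.mono_left [SFinite β] (h : HasFiniteMutualEnergy α β)
    (hle : α' ≤ α) : HasFiniteMutualEnergy α' β := by
  have : α'.prod β ≤ α.prod β := Measure.prod_mono hle le_rfl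
  exact ⟨h.integrable.mono_measure this, ae_mono this h.ae_ne⟩

theorem mutualEnergy_comm (α β : Measure ℂ) [SFinite α] [SFinite β] :
    mutualEnergy α β = mutualEnergy β α := by
  rw [mutualEnergy, mutualEnergy, ← integral_prod_swap]
  simp [norm_sub_rev]

theorem mutualEnergy_add_left [SFinite α] [SFinite α'] [SFinite β]
    (h : HasFiniteMutualEnergy α β) (h' : HasFiniteMutualEnergy α' β) :
    mutualEnergy (α + α') β = mutualEnergy α β + mutualEnergy α' β := by
  rw [mutualEnergy, Measure.add_prod]
  exact integral_add_measure h.integrable.neg h'.integrable.neg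

theorem mutualEnergy_smul_left [SFinite β] (c : ℝ≥0∞) :
    mutualEnergy (c • α) β = c.toReal * mutualEnergy α β := by
  rw [mutualEnergy, Measure.prod_smul_left, integral_smul_measure]
  rfl

theorem HasFiniteMutualEnergy.mutualEnergy_eq [SFinite α] [SFinite β]
    (h : HasFiniteMutualEnergy α β) :
    Integrable (pot β) α ∧ mutualEnergy α β = ∫ z, pot β z ∂α :=
  ⟨h.integrable.neg.integral_prod_left, integral_prod _ h.integrable.neg⟩

theorem HasFiniteMutualEnergy.cond_left [SFinite β] (h : HasFiniteMutualEnergy α β) {A : Set ℂ}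
    (hA : α A ≠ 0) : HasFiniteMutualEnergy (ProbabilityTheory.cond α A) β :=
  (h.mono_left Measure.restrict_le_self).smul_left (ENNReal.inv_ne_top.2 hA)

end MutualEnergy

theorem integrable_cond {α : Measure ℂ} {A : Set ℂ} {F : ℂ → ℝ} (h : IntegrableOn F A α)
    (hA : α A ≠ 0) : Integrable F (ProbabilityTheory.cond α A) :=
  h.smul_measure (ENNReal.inv_ne_top.2 hA)

theorem integral_cond (α : Measure ℂ) (A : Set ℂ) (F : ℂ → ℝ) :
    ∫ z, F z ∂(ProbabilityTheory.cond α A) = (α.real A)⁻¹ * ∫ z in A, F z ∂α := by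
  rw [ProbabilityTheory.cond, integral_smul_measure, ENNReal.toReal_inv, smul_eq_mul]
  rfl

theorem ae_cond {α : Measure ℂ} {A : Set ℂ} {p : ℂ → Prop} (h : ∀ᵐ z ∂(α.restrict A), p z) :
    ∀ᵐ z ∂(ProbabilityTheory.cond α A), p z :=
  Measure.ae_smul_measure h _

variable {V : ℂ → EReal} {μ ν : Measure ℂ}

theorem HasFiniteEnergy.hasFiniteMutualEnergy (h : HasFiniteEnergy V ν) :
    HasFiniteMutualEnergy ν ν := ⟨h.integrable_log, h.ae_ne⟩

theorem HasFiniteEnergy.cond (h : HasFiniteEnergy V ν) {A : Set ℂ} (hA : ν A ≠ 0) :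
    HasFiniteEnergy V (ProbabilityTheory.cond ν A) := by
  have := h.isProbabilityMeasure
  have hp := ProbabilityTheory.cond_isProbabilityMeasure hA
  have h1 := ((h.hasFiniteMutualEnergy.cond_left hA).symm.cond_left hA)
  exact ⟨hp, ae_cond (ae_restrict_of_ae h.ae_eq), integrable_cond h.integrable.integrableOn hA,
    integrable_cond h.logInt.integrableOn hA, h1.integrable, h1.ae_ne⟩

section Mixture

variable {t : ℝ}

/-- The mixture `(1 - t) μ + t ν`. -/
noncomputable def mixture (μ ν : Measure ℂ) (t : ℝ) : Measure ℂ :=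
  ENNReal.ofReal (1 - t) • μ + ENNReal.ofReal t • ν

theorem integrable_mixture {F : ℂ → ℝ} (h : Integrable F μ) (h' : Integrable F ν) :
    Integrable F (mixture μ ν t) :=
  (h.smul_measure ENNReal.ofReal_ne_top).add_measure (h'.smul_measure ENNReal.ofReal_ne_top)

theorem integral_mixture {F : ℂ → ℝ} (h : Integrable F μ) (h' : Integrable F ν)
    (ht : t ∈ Icc (0 : ℝ) 1) :
    ∫ z, F z ∂(mixture μ ν t) = (1 - t) * (∫ z, F z ∂μ) + t * ∫ z, F z ∂ν := by
  rw [mixture, integral_add_measure (h.smul_measure ENNReal.ofReal_ne_top)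
    (h'.smul_measure ENNReal.ofReal_ne_top), integral_smul_measure, integral_smul_measure,
    ENNReal.toReal_ofReal (by linarith [ht.2]), ENNReal.toReal_ofReal ht.1, smul_eq_mul,
    smul_eq_mul]

/-- Bilinearity: the energy is a quadratic polynomial along the segment from `μ` to `ν`. -/
theorem HasFiniteEnergy.mixture (hμ : HasFiniteEnergy V μ) (hν : HasFiniteEnergy V ν)
    (hμν : HasFiniteMutualEnergy μ ν) (ht : t ∈ Icc (0 : ℝ) 1) :
    HasFiniteEnergy V (mixture μ ν t) ∧
    mutualEnergy (LogPotential.mixture μ ν t) (LogPotential.mixture μ ν t) =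
      (1 - t) ^ 2 * mutualEnergy μ μ + 2 * t * (1 - t) * mutualEnergy ν μ +
        t ^ 2 * mutualEnergy ν ν := by
  have pμ := hμ.isProbabilityMeasure
  have pν := hν.isProbabilityMeasure
  have ht1 : 0 ≤ 1 - t := by linarith [ht.2]
  have hp : IsProbabilityMeasure (LogPotential.mixture μ ν t) := by
    refine ⟨?_⟩
    simp only [LogPotential.mixture, Measure.add_apply, Measure.smul_apply, measure_univ,
      smul_eq_mul, mul_one]
    rw [← ENNReal.ofReal_add ht1 ht.1]
    simp
  have hl : ∀ {β : Measure ℂ} [SFinite β], HasFiniteMutualEnergy μ β → HasFiniteMutualEnergy ν β →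
      HasFiniteMutualEnergy (LogPotential.mixture μ ν t) β ∧
      mutualEnergy (LogPotential.mixture μ ν t) β =
        (1 - t) * mutualEnergy μ β + t * mutualEnergy ν β := by
    intro β _ h1 h2
    have h1' := h1.smul_left (c := ENNReal.ofReal (1 - t)) ENNReal.ofReal_ne_top
    have h2' := h2.smul_left (c := ENNReal.ofReal t) ENNReal.ofReal_ne_top
    refine ⟨h1'.add_left h2', ?_⟩
    rw [LogPotential.mixture, mutualEnergy_add_left h1' h2', mutualEnergy_smul_left,
      mutualEnergy_smul_left, ENNReal.toReal_ofReal ht1, ENNReal.toReal_ofReal ht.1]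
  obtain ⟨a1, a2⟩ := hl hμ.hasFiniteMutualEnergy hμν.symm
  obtain ⟨b1, b2⟩ := hl hμν hν.hasFiniteMutualEnergy
  obtain ⟨c1, c2⟩ := hl a1.symm b1.symm
  refine ⟨⟨hp, ?_, integrable_mixture hμ.integrable hν.integrable,
    integrable_mixture hμ.logInt hν.logInt, c1.integrable, c1.ae_ne⟩, ?_⟩
  · rw [LogPotential.mixture, ae_add_measure_iff]
    exact ⟨Measure.ae_smul_measure hμ.ae_eq _, Measure.ae_smul_measure hν.ae_eq _⟩
  · rw [c2, mutualEnergy_comm μ, mutualEnergy_comm ν, a2, b2, mutualEnergy_comm μ ν]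
    ring

/-- The first variation of the weighted energy at an equilibrium measure. -/
theorem IsEquilibriumMeasure.le_of_hasFiniteEnergy (h : IsEquilibriumMeasure V μ)
    (hμ : HasFiniteEnergy V μ) (hν : HasFiniteEnergy V ν) (hνV : ν (potentialDomain V)ᶜ = 0)
    (hμν : HasFiniteMutualEnergy μ ν) :
    mutualEnergy μ μ + 1 / 2 * ∫ z, (V z).toReal ∂μ ≤
      mutualEnergy ν μ + 1 / 2 * ∫ z, (V z).toReal ∂ν := by
  -- The energy of the mixture minus that of `μ` is `t (2X + tY)`; minimality and `t → 0` give `X ≥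
  -- 0`.
  set X := mutualEnergy ν μ + 1 / 2 * (∫ z, (V z).toReal ∂ν) -
    (mutualEnergy μ μ + 1 / 2 * ∫ z, (V z).toReal ∂μ) with hX
  set Y := mutualEnergy μ μ - 2 * mutualEnergy ν μ + mutualEnergy ν ν with hY
  have key : ∀ t ∈ Ioc (0 : ℝ) 1, 0 ≤ 2 * X + t * Y := by
    intro t ht
    have ht' : t ∈ Icc (0 : ℝ) 1 := ⟨ht.1.le, ht.2⟩
    obtain ⟨h1, h2⟩ := hμ.mixture hν hμν ht'
    have h3 := h.energy_le _ h1.isProbabilityMeasure (by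
      simp [LogPotential.mixture, h.compl_domain, hνV])
    rw [hμ.energy_eq, h1.energy_eq, h2, integral_mixture hμ.integrable hν.integrable ht',
      EReal.coe_le_coe_iff] at h3
    have : 0 ≤ t * (2 * X + t * Y) := by
      rw [hX, hY]
      linarith
    exact nonneg_of_mul_nonneg_right this ht.1
  have hlim : Tendsto (fun t : ℝ => 2 * X + t * Y) (𝓝[>] 0) (𝓝 (2 * X + 0 * Y)) :=
    (Continuous.tendsto (by fun_prop) 0).mono_left nhdsWithin_le_nhds
  have := ge_of_tendsto hlim (by
    filter_upwards [Ioc_mem_nhdsGT (zero_lt_one' ℝ)] with t ht using key t ht)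
  linarith

end Mixture

/-- Positive capacity provides a competitor of finite weighted energy. -/
theorem IsConfining.exists_hasFiniteEnergy {δ c : ℝ} (hV : IsConfining V δ c)
    (hcap : HasPositiveCapacity {z | V z < ⊤}) :
    ∃ ν, HasFiniteEnergy V ν ∧ ν (potentialDomain V)ᶜ = 0 := by
  obtain ⟨τ, hτ, ⟨K, hK, hKV, hτK⟩, hE⟩ := hcap
  have hKae : ∀ᵐ z ∂τ, z ∈ K := mem_ae_iff.2 hτK
  obtain ⟨R, hR⟩ := hK.isBounded.exists_norm_le
  have hlog : Integrable (fun z => Real.log (1 + ‖z‖)) τ :=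
    integrable_log_one_add_norm_of_bounded (hKae.mono fun z hz => hR z hz)
  obtain ⟨i1, i2⟩ := integrable_log_of_logEnergy_ne_top hlog hE.ne
  have hM : HasFiniteMutualEnergy τ τ := ⟨i1, i2⟩
  -- `V` is finite on `K` but need not be bounded there; some sublevel set has positive mass, and
  -- conditioning on it keeps the energy finite.
  obtain ⟨n, hn⟩ : ∃ n : ℕ, τ {z | V z ≤ ((n : ℝ) : EReal)} ≠ 0 := by
    by_contra hcon
    push Not at hcon
    have h0 : τ (⋃ n : ℕ, {z | V z ≤ ((n : ℝ) : EReal)}) = 0 := measure_iUnion_null hcon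
    have hsub : K ⊆ ⋃ n : ℕ, {z | V z ≤ ((n : ℝ) : EReal)} := fun z hz => by
      obtain ⟨b, hb, -⟩ := EReal.lt_iff_exists_real_btwn.1 (show V z < ⊤ from hKV hz)
      obtain ⟨n, hn⟩ := exists_nat_ge b
      exact mem_iUnion.2 ⟨n, hb.le.trans (EReal.coe_le_coe_iff.2 hn)⟩
    have : τ univ = 0 := by
      rw [← union_compl_self K]
      exact measure_union_null (measure_mono_null hsub h0) hτK
    simp at this
  set A := {z | V z ≤ ((n : ℝ) : EReal)} with hA
  have hAm : MeasurableSet A := hV.measurable measurableSet_Iic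
  have hp := ProbabilityTheory.cond_isProbabilityMeasure hn
  have hVA : ∀ z ∈ A, V z = ((V z).toReal : EReal) ∧ -c ≤ (V z).toReal ∧ (V z).toReal ≤ n := by
    intro z hz
    have hz : V z ≤ ((n : ℝ) : EReal) := hz
    have h1 := hV.le z
    have h2 : V z = ((V z).toReal : EReal) :=
      (EReal.coe_toReal (hz.trans_lt (EReal.coe_lt_top _)).ne
        ((EReal.bot_lt_coe _).trans_le h1).ne').symm
    rw [h2, EReal.coe_le_coe_iff] at h1 hz
    refine ⟨h2, le_trans ?_ h1, hz⟩
    have := hV.pos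
    have : 0 ≤ (2 + δ) * Real.log (1 + ‖z‖) :=
      mul_nonneg (by linarith) (Real.log_nonneg (by linarith [norm_nonneg z]))
    linarith
  have h1 := (hM.cond_left hn).symm.cond_left hn
  have hAae : ∀ᵐ z ∂(τ.restrict A), z ∈ A := ae_restrict_mem hAm
  refine ⟨ProbabilityTheory.cond τ A, ⟨hp, ae_cond (hAae.mono fun z hz => (hVA z hz).1),
    Integrable.of_bound hV.measurable.ereal_toReal.aestronglyMeasurable (|c| + n)
      (ae_cond (hAae.mono fun z hz => ?_)), integrable_cond hlog.integrableOn hn,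
    h1.integrable, h1.ae_ne⟩, ?_⟩
  · obtain ⟨-, h2, h3⟩ := hVA z hz
    rw [Real.norm_eq_abs, abs_le]
    constructor
    · linarith [le_abs_self c, Nat.cast_nonneg (α := ℝ) n]
    · linarith [abs_nonneg c]
  · refine mem_ae_iff.1 (ae_cond (ae_restrict_of_ae (hKae.mono fun z hz => ?_)))
    exact subset_closure (hKV hz)

theorem IsEquilibriumMeasure.hasFiniteEnergy {δ c : ℝ} (h : IsEquilibriumMeasure V μ)
    (hV : IsConfining V δ c) (hcap : HasPositiveCapacity {z | V z < ⊤}) :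
    HasFiniteEnergy V μ := by
  obtain ⟨ν, hν, hνV⟩ := hV.exists_hasFiniteEnergy hcap
  have := h.isProbabilityMeasure
  refine hV.hasFiniteEnergy ((h.energy_le ν hν.isProbabilityMeasure hνV).trans_lt ?_).ne
  rw [hν.energy_eq]
  exact EReal.coe_lt_top _

end LogPotential

/-! ### Frostman conditions and compactness of the support -/

namespace LogPotential

variable {V : ℂ → EReal} {μ ν : Measure ℂ} {g : ℂ → ℝ} {δ c : ℝ}

theorem HasFiniteMutualEnergy.integral_pot_add [SFinite μ] [SFinite ν]
    (h : HasFiniteMutualEnergy ν μ) (hV : Integrable (fun z => (V z).toReal) ν) :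
    Integrable (fun z => pot μ z + (V z).toReal / 2) ν ∧
    ∫ z, (pot μ z + (V z).toReal / 2) ∂ν =
      mutualEnergy ν μ + 1 / 2 * ∫ z, (V z).toReal ∂ν := by
  obtain ⟨h1, h2⟩ := h.mutualEnergy_eq
  refine ⟨h1.add (hV.div_const 2), ?_⟩
  rw [integral_add h1 (hV.div_const 2), h2, integral_div]
  ring

/-- The effective potential vanishes almost everywhere with respect to the equilibrium measure. -/
theorem IsEquilibriumMeasure.ae_pot_add_eq (h : IsEquilibriumMeasure V μ)
    (hμ : HasFiniteEnergy V μ) :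
    ∀ᵐ z ∂μ, pot μ z + (V z).toReal / 2 =
      mutualEnergy μ μ + 1 / 2 * ∫ z, (V z).toReal ∂μ := by
  have := h.isProbabilityMeasure
  set F := mutualEnergy μ μ + 1 / 2 * ∫ z, (V z).toReal ∂μ with hF
  obtain ⟨i1, e1⟩ := hμ.hasFiniteMutualEnergy.integral_pot_add hμ.integrable
  have iF : Integrable (fun z => pot μ z + (V z).toReal / 2 - F) μ := i1.sub (integrable_const F)
  have h0 : ∫ z, (pot μ z + (V z).toReal / 2 - F) ∂μ = 0 := by
    rw [integral_sub i1 (integrable_const F), e1]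
    simp [hF]
  -- Conditioning `μ` on `A` gives a competitor, and the first variation says that the integral over
  -- `A` is nonnegative. The total integral being zero, the function vanishes almost everywhere.
  have hnn : 0 ≤ᵐ[μ] fun z => pot μ z + (V z).toReal / 2 - F := by
    refine ae_nonneg_of_forall_setIntegral_nonneg iF fun A hA _ => ?_
    rcases eq_or_ne (μ A) 0 with h0 | h0
    · rw [Measure.restrict_eq_zero.2 h0, integral_zero_measure]
    · have hm := hμ.hasFiniteMutualEnergy.cond_left h0
      have hc := hμ.cond h0
      have pc := hc.isProbabilityMeasure
      have h1 := h.le_of_hasFiniteEnergy hμ hc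
        (by rw [ProbabilityTheory.cond]
            simp [Measure.restrict_apply' hA, measure_inter_null_of_null_left, h.compl_domain])
        hm.symm
      obtain ⟨i2, e2⟩ := hm.integral_pot_add hc.integrable
      rw [← e2, integral_cond] at h1
      have hpos : 0 < μ.real A := ENNReal.toReal_pos h0 (measure_ne_top μ A)
      rw [integral_sub i1.integrableOn (integrable_const F), setIntegral_const, smul_eq_mul,
        sub_nonneg]
      rwa [inv_mul_eq_div, le_div_iff₀ hpos, mul_comm] at h1
  have := (integral_eq_zero_iff_of_nonneg_ae hnn iF).1 h0
  filter_upwards [this] with z hz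
  exact sub_eq_zero.1 hz

/-- The far part of the kernel contributes continuously under a logarithmic moment, so only the
singular part needs care. -/
theorem continuous_integral_posLog [IsFiniteMeasure μ]
    (hμ : Integrable (fun z => Real.log (1 + ‖z‖)) μ) :
    (∀ z, Integrable (fun w => Real.posLog ‖z - w‖) μ) ∧
      Continuous fun z => ∫ w, Real.posLog ‖z - w‖ ∂μ := by
  have hm : ∀ z : ℂ, AEStronglyMeasurable (fun w => Real.posLog ‖z - w‖) μ := fun z =>
    (measurable_posLog.comp (by fun_prop)).aestronglyMeasurable
  have hb : ∀ R : ℝ, Integrable (fun w : ℂ => Real.log (1 + R) + Real.log (1 + ‖w‖)) μ := fun R =>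
    (integrable_const _).add hμ
  constructor
  · intro z
    refine (hb ‖z‖).mono' (hm z) (ae_of_all _ fun w => ?_)
    rw [Real.norm_of_nonneg Real.posLog_nonneg]
    exact posLog_norm_sub_le z w
  · refine continuous_iff_continuousAt.2 fun z₀ => ?_
    refine continuousAt_of_dominated (Eventually.of_forall hm) ?_ (hb (‖z₀‖ + 1))
      (ae_of_all _ fun w => ?_)
    · filter_upwards [Metric.ball_mem_nhds z₀ one_pos] with z hz
      refine ae_of_all _ fun w => ?_
      rw [Real.norm_of_nonneg Real.posLog_nonneg]
      refine (posLog_norm_sub_le z w).trans ?_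
      gcongr
      have h1 := norm_sub_norm_le z z₀
      rw [Metric.mem_ball, dist_eq_norm] at hz
      linarith
    · exact (Real.continuous_posLog.comp (by fun_prop)).continuousAt

theorem integrable_log_norm_sub_iff [IsFiniteMeasure μ]
    (hμ : Integrable (fun z => Real.log (1 + ‖z‖)) μ) (z : ℂ) :
    Integrable (fun w => Real.log ‖z - w‖) μ ↔
      Integrable (fun w => Real.posLog (1 / ‖z - w‖)) μ := by
  have h1 := (continuous_integral_posLog hμ).1 z
  constructor
  · intro h
    refine (h1.sub h).congr (ae_of_all _ fun w => ?_)
    simp only [Pi.sub_apply]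
    rw [log_norm_eq]
    ring
  · intro h
    refine (h1.sub h).congr (ae_of_all _ fun w => ?_)
    simp only [Pi.sub_apply]
    rw [log_norm_eq (z - w)]

theorem pot_eq_posLog [IsFiniteMeasure μ]
    (hμ : Integrable (fun z => Real.log (1 + ‖z‖)) μ) {z : ℂ}
    (hz : Integrable (fun w => Real.log ‖z - w‖) μ) :
    pot μ z = (∫ w, Real.posLog (1 / ‖z - w‖) ∂μ) - ∫ w, Real.posLog ‖z - w‖ ∂μ := by
  rw [← integral_sub ((integrable_log_norm_sub_iff hμ z).1 hz)
    ((continuous_integral_posLog hμ).1 z), pot]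
  congr 1
  funext w
  rw [log_norm_eq]
  ring

theorem neg_pot_le [IsProbabilityMeasure μ]
    (hμ : Integrable (fun z => Real.log (1 + ‖z‖)) μ) {z : ℂ}
    (hz : Integrable (fun w => Real.log ‖z - w‖) μ) :
    -pot μ z ≤ Real.log (1 + ‖z‖) + ∫ w, Real.log (1 + ‖w‖) ∂μ := by
  rw [pot, integral_neg, neg_neg]
  calc ∫ w, Real.log ‖z - w‖ ∂μ ≤ ∫ w, (Real.log (1 + ‖z‖) + Real.log (1 + ‖w‖)) ∂μ := by
        refine integral_mono hz ((integrable_const _).add hμ) fun w => ?_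
        refine le_trans ?_ (posLog_norm_sub_le z w)
        rw [Real.posLog]
        exact le_max_right _ _
    _ = _ := by rw [integral_add (integrable_const _) hμ]; simp

/-- Fatou's lemma for potentials: an upper bound on a dense part of the support extends to the
support. -/
theorem lintegral_posLog_le_of_tendsto [IsFiniteMeasure μ] (hatom : ∀ z, μ {z} = 0) {z₀ : ℂ}
    {u : ℕ → ℂ} (hu : Tendsto u atTop (𝓝 z₀)) {x : ℕ → ℝ} {x₀ : ℝ} (hx : Tendsto x atTop (𝓝 x₀))
    (hle : ∀ n, ∫⁻ w, ENNReal.ofReal (Real.posLog (1 / ‖u n - w‖)) ∂μ ≤ ENNReal.ofReal (x n)) :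
    ∫⁻ w, ENNReal.ofReal (Real.posLog (1 / ‖z₀ - w‖)) ∂μ ≤ ENNReal.ofReal x₀ := by
  have hm : ∀ z : ℂ, Measurable fun w => ENNReal.ofReal (Real.posLog (1 / ‖z - w‖)) := fun z =>
    (measurable_posLog.comp (by fun_prop)).ennreal_ofReal
  have hne : ∀ᵐ w ∂μ, w ≠ z₀ := by simpa [ae_iff] using hatom z₀
  calc ∫⁻ w, ENNReal.ofReal (Real.posLog (1 / ‖z₀ - w‖)) ∂μ
      = ∫⁻ w, liminf (fun n => ENNReal.ofReal (Real.posLog (1 / ‖u n - w‖))) atTop ∂μ := by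
        refine lintegral_congr_ae (hne.mono fun w hw => ?_)
        have hz : ‖z₀ - w‖ ≠ 0 := by
          rw [Ne, norm_eq_zero, sub_eq_zero]
          exact hw.symm
        refine (Tendsto.liminf_eq ?_).symm
        refine (ENNReal.continuous_ofReal.tendsto _).comp
          ((Real.continuous_posLog.tendsto _).comp ?_)
        exact tendsto_const_nhds.div (hu.sub_const w).norm hz
    _ ≤ liminf (fun n => ∫⁻ w, ENNReal.ofReal (Real.posLog (1 / ‖u n - w‖)) ∂μ) atTop :=
        lintegral_liminf_le fun n => hm (u n)
    _ ≤ liminf (fun n => ENNReal.ofReal (x n)) atTop :=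
        liminf_le_liminf (Eventually.of_forall hle)
    _ = ENNReal.ofReal x₀ := ((ENNReal.continuous_ofReal.tendsto _).comp hx).liminf_eq

/-- The support of the equilibrium measure is compact, the potential is finite and satisfies the
Frostman upper bound on the support. -/
theorem IsEquilibriumMeasure.hasFinitePotential (h : IsEquilibriumMeasure V μ)
    (hμ : HasFiniteEnergy V μ) (hV : IsConfining V δ c) {F : ℝ}
    (hF : F = mutualEnergy μ μ + 1 / 2 * ∫ z, (V z).toReal ∂μ)
    (hVg : ∀ z ∈ μ.support, V z = ((g z : ℝ) : EReal))
    (hg : ∀ z ∈ μ.support, ContinuousAt g z) :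
    HasFinitePotential μ μ.support ∧ (∀ z ∈ μ.support, effPot μ g F z ≤ 0) ∧
      ∃ M : ℝ≥0∞, M ≠ ∞ ∧ ∀ w, ∫⁻ z, ENNReal.ofReal (Real.posLog (1 / ‖z - w‖)) ∂μ ≤ M := by
  have := h.isProbabilityMeasure
  obtain ⟨hPi, hPc⟩ := continuous_integral_posLog hμ.logInt
  set P : ℂ → ℝ := fun z => ∫ w, Real.posLog ‖z - w‖ ∂μ with hP
  set x : ℂ → ℝ := fun z => F - g z / 2 + P z with hx
  -- The points where the Euler-Lagrange equality holds literally. They have full measure, hence are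
  -- dense in the support, and on them the singular part of the potential equals `x`, which is
  -- continuous at points of the support.
  set D := {z | z ∈ μ.support ∧ Integrable (fun w => Real.log ‖z - w‖) μ ∧
    pot μ z + g z / 2 = F} with hD
  have hDae : ∀ᵐ z ∂μ, z ∈ D := by
    filter_upwards [Measure.support_mem_ae (μ := μ), hμ.integrable_log.prod_right_ae,
      h.ae_pot_add_eq hμ] with z h1 h2 h3
    refine ⟨h1, h2, ?_⟩
    rw [hVg z h1, EReal.toReal_coe] at h3
    rw [h3, hF]
  have hSD : μ.support ⊆ closure D :=
    Measure.support_subset_of_isClosed isClosed_closure (mem_of_superset hDae subset_closure)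
  have hxD : ∀ z ∈ D, ∫⁻ w, ENNReal.ofReal (Real.posLog (1 / ‖z - w‖)) ∂μ =
      ENNReal.ofReal (x z) ∧ 0 ≤ x z := by
    rintro z ⟨-, hz1, hz2⟩
    have h1 : x z = ∫ w, Real.posLog (1 / ‖z - w‖) ∂μ := by
      have := pot_eq_posLog hμ.logInt hz1
      simp only [hx, hP]
      linarith
    rw [h1]
    refine ⟨(ofReal_integral_eq_lintegral_ofReal ((integrable_log_norm_sub_iff hμ.logInt z).1 hz1)
      (ae_of_all _ fun _ => Real.posLog_nonneg)).symm, integral_nonneg fun _ => Real.posLog_nonneg⟩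
  have hxc : ∀ z ∈ μ.support, ContinuousAt x z := fun z hz =>
    (continuousAt_const.sub ((hg z hz).div_const 2)).add hPc.continuousAt
  -- Fatou along a sequence in `D` loses equality but keeps the upper bound at every point of the
  -- support.
  have hxS : ∀ z ∈ μ.support, ∫⁻ w, ENNReal.ofReal (Real.posLog (1 / ‖z - w‖)) ∂μ ≤
      ENNReal.ofReal (x z) ∧ 0 ≤ x z := by
    intro z hz
    obtain ⟨u, huD, hu⟩ := mem_closure_iff_seq_limit.1 (hSD hz)
    have hxu : Tendsto (fun n => x (u n)) atTop (𝓝 (x z)) := (hxc z hz).tendsto.comp hu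
    exact ⟨lintegral_posLog_le_of_tendsto hμ.noAtoms hu hxu fun n => (hxD _ (huD n)).1.le,
      ge_of_tendsto' hxu fun n => (hxD _ (huD n)).2⟩
  have hlogS : ∀ z ∈ μ.support, Integrable (fun w => Real.log ‖z - w‖) μ := by
    intro z hz
    refine (integrable_log_norm_sub_iff hμ.logInt z).2
      ⟨(measurable_posLog.comp (by fun_prop)).aestronglyMeasurable, ?_⟩
    rw [hasFiniteIntegral_iff_ofReal (ae_of_all _ fun p => Real.posLog_nonneg)]
    exact (hxS z hz).1.trans_lt ENNReal.ofReal_lt_top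
  -- On `D`, `V = 2F - 2U^μ` grows at most like `2 log(1 + ‖z‖)`, whereas the confinement demands
  -- `(2 + δ) log(1 + ‖z‖) - c`.
  have hbdd : ∃ R, ∀ z ∈ D, ‖z‖ ≤ R := by
    have hδ := hV.pos
    set ℓ := ∫ w, Real.log (1 + ‖w‖) ∂μ with hℓ
    refine ⟨Real.exp ((2 * F + 2 * ℓ + c) / δ), fun z hz => ?_⟩
    have h1 := hV.le z
    rw [hVg z hz.1, EReal.coe_le_coe_iff] at h1
    have h2 := neg_pot_le hμ.logInt hz.2.1
    have h3 := hz.2.2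
    have h4 : Real.log (1 + ‖z‖) ≤ (2 * F + 2 * ℓ + c) / δ := by
      rw [le_div_iff₀ hδ]
      linarith
    have h5 := (Real.log_le_iff_le_exp (by positivity)).1 h4
    linarith
  obtain ⟨R, hR⟩ := hbdd
  have hcompact : IsCompact μ.support := by
    refine Metric.isCompact_of_isClosed_isBounded Measure.isClosed_support
      (Metric.isBounded_closedBall.subset (hSD.trans
        (closure_minimal (fun z hz => ?_) (Metric.isClosed_closedBall (x := (0 : ℂ)) (ε := R)))))
    rw [mem_closedBall_zero_iff]
    exact hR z hz
  have hpot : HasFinitePotential μ μ.support := by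
    refine ⟨hcompact, Measure.measure_compl_support, fun z => ?_, hμ.noAtoms⟩
    by_cases hz : z ∈ μ.support
    · exact hlogS z hz
    · have hc : ContinuousOn (fun w => Real.log ‖z - w‖) μ.support := by
        refine ContinuousOn.log (by fun_prop) fun w hw => ?_
        rw [Ne, norm_eq_zero, sub_eq_zero]
        rintro rfl
        exact hz hw
      obtain ⟨C, hC⟩ := hcompact.exists_bound_of_continuousOn hc
      refine Integrable.of_bound (C := C)
        (show Measurable fun w => Real.log ‖z - w‖ by fun_prop).aestronglyMeasurable ?_
      filter_upwards [Measure.support_mem_ae (μ := μ)] with w hw using hC w hw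
  refine ⟨hpot, fun z hz => ?_, ?_⟩
  · have h1 := pot_eq_posLog hμ.logInt (hlogS z hz)
    have h2 : ∫ w, Real.posLog (1 / ‖z - w‖) ∂μ ≤ x z := by
      rw [integral_eq_lintegral_of_nonneg_ae (ae_of_all _ fun _ => Real.posLog_nonneg)
        (measurable_posLog.comp (by fun_prop)).aestronglyMeasurable]
      exact ENNReal.toReal_le_of_le_ofReal (hxS z hz).2 (hxS z hz).1
    simp only [hx, hP] at h2
    rw [effPot]
    linarith
  · obtain ⟨C, hC⟩ := hcompact.exists_bound_of_continuousOn
      (fun z hz => (hxc z hz).continuousWithinAt)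
    -- `C` bounds the singular part on the support; the nearest point comparison carries it to the
    -- plane at the cost of `log 2`.
    refine ⟨ENNReal.ofReal C + ENNReal.ofReal (Real.log 2), by simp, fun z => ?_⟩
    have : NeZero μ := ⟨IsProbabilityMeasure.ne_zero μ⟩
    obtain ⟨z', hz', -, hd⟩ := hpot.exists_nearest hpot.nonempty z
    calc ∫⁻ w, ENNReal.ofReal (Real.posLog (1 / ‖w - z‖)) ∂μ
        ≤ ∫⁻ w, (ENNReal.ofReal (Real.posLog (1 / ‖z' - w‖)) + ENNReal.ofReal (Real.log 2)) ∂μ := by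
          refine lintegral_mono_ae ?_
          filter_upwards [hpot.ae_mem, hpot.ae_ne z'] with w hw hw'
          rw [← ENNReal.ofReal_add Real.posLog_nonneg (Real.log_nonneg one_le_two)]
          refine ENNReal.ofReal_le_ofReal ?_
          have h0 : 0 < ‖z' - w‖ := by
            rw [norm_pos_iff, sub_ne_zero]
            exact hw'.symm
          have h1 : 0 < ‖z - w‖ := by linarith [hd w hw]
          have h2 : 1 / ‖w - z‖ ≤ 1 / ‖z' - w‖ * 2 := by
            rw [norm_sub_rev w z, one_div_mul_eq_div, div_le_div_iff₀ h1 h0]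
            linarith [hd w hw]
          calc Real.posLog (1 / ‖w - z‖) ≤ Real.posLog (1 / ‖z' - w‖ * 2) :=
                Real.monotoneOn_posLog (by simp) (by simp only [mem_Ici]; positivity) h2
            _ ≤ _ := Real.posLog_mul.trans_eq (by
                rw [Real.posLog_eq_log (x := 2) (by norm_num)])
      _ ≤ ENNReal.ofReal C + ENNReal.ofReal (Real.log 2) := by
          rw [lintegral_add_right _ measurable_const, lintegral_const, measure_univ, mul_one]
          gcongr
          exact (hxS z' hz').1.trans (ENNReal.ofReal_le_ofReal
            ((le_abs_self _).trans (hC z' hz')))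

end LogPotential

/-! ### Frostman lower bound almost everywhere on the domain -/

namespace LogPotential

variable {V : ℂ → EReal} {μ ν α β : Measure ℂ} {g : ℂ → ℝ} {δ c : ℝ}

/-- Measures with uniformly bounded singular part of the potential. -/
theorem hasFiniteMutualEnergy_of_bounded [IsFiniteMeasure α] [IsFiniteMeasure β]
    (hα : Integrable (fun z => Real.log (1 + ‖z‖)) α)
    (hβ : Integrable (fun z => Real.log (1 + ‖z‖)) β) {M : ℝ≥0∞} (hM : M ≠ ∞)
    (h : ∀ w, ∫⁻ z, ENNReal.ofReal (Real.posLog (1 / ‖z - w‖)) ∂α ≤ M) (hatom : ∀ z, α {z} = 0) :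
    HasFiniteMutualEnergy α β := by
  refine ⟨integrable_log_norm_sub_prod hα hβ hM h, ?_⟩
  have hd : MeasurableSet {p : ℂ × ℂ | p.1 = p.2} :=
    measurableSet_eq_fun measurable_fst measurable_snd
  have : α.prod β {p : ℂ × ℂ | p.1 = p.2} = 0 := by
    rw [Measure.prod_apply_symm hd]
    refine lintegral_eq_zero_of_ae_eq_zero (ae_of_all _ fun w => ?_)
    exact measure_mono_null (fun z hz => hz) (hatom w)
  simpa [ae_iff] using this

theorem hasFiniteMutualEnergy_volume {A : Set ℂ} {R : ℝ} (hA : MeasurableSet A)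
    (hAR : ∀ z ∈ A, ‖z‖ ≤ R) [IsFiniteMeasure β]
    (hβ : Integrable (fun z => Real.log (1 + ‖z‖)) β) :
    HasFiniteMutualEnergy (volume.restrict A) β := by
  have hfin : IsFiniteMeasure (volume.restrict A) :=
    ⟨by rw [Measure.restrict_apply_univ]
        exact (measure_mono fun z hz => mem_closedBall_zero_iff.2 (hAR z hz)).trans_lt
          measure_closedBall_lt_top⟩
  refine hasFiniteMutualEnergy_of_bounded (integrable_log_one_add_norm_of_bounded
    ((ae_restrict_mem hA).mono fun z hz => hAR z hz)) hβ lintegral_posLog_volume_ne_top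
    (lintegral_posLog_le_volume A) fun z => ?_
  exact measure_mono_null subset_rfl (measure_singleton z)

theorem measurable_pot (μ : Measure ℂ) [SFinite μ] : Measurable (pot μ) := by
  have : StronglyMeasurable fun p : ℂ × ℂ => -Real.log ‖p.1 - p.2‖ :=
    (show Measurable fun p : ℂ × ℂ => -Real.log ‖p.1 - p.2‖ by fun_prop).stronglyMeasurable
  exact this.integral_prod_right.measurable

/-- The effective potential is nonnegative almost everywhere on the domain of `V`. -/
theorem IsEquilibriumMeasure.ae_le_pot_add (h : IsEquilibriumMeasure V μ)
    (hμ : HasFiniteEnergy V μ) (hV : IsConfining V δ c) {F : ℝ}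
    (hF : F = mutualEnergy μ μ + 1 / 2 * ∫ z, (V z).toReal ∂μ) :
    ∀ᵐ z, V z < ⊤ → F ≤ pot μ z + (V z).toReal / 2 := by
  have pμ := h.isProbabilityMeasure
  have hVr : Measurable fun z => (V z).toReal := hV.measurable.ereal_toReal
  -- Bounded pieces, with `V` bounded, of the set where the inequality fails. Normalized area on a
  -- piece of positive area would be a competitor violating the first variation.
  set A : ℕ → Set ℂ := fun n => {z | V z ≤ ((n : ℝ) : EReal) ∧ ‖z‖ ≤ n ∧
    pot μ z + (V z).toReal / 2 < F} with hA
  have hVb : ∀ z, ⊥ < V z := fun z => (EReal.bot_lt_coe _).trans_le (hV.le z)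
  have hnull : ∀ n, volume (A n) = 0 := by
    intro n
    by_contra h0
    have hAm : MeasurableSet (A n) :=
      (hV.measurable measurableSet_Iic).inter ((measurableSet_le measurable_norm measurable_const).inter
        (measurableSet_lt ((measurable_pot μ).add (hVr.div_const 2)) measurable_const))
    have hAR : ∀ z ∈ A n, ‖z‖ ≤ n := fun z hz => hz.2.1
    have hAt : volume (A n) ≠ ∞ :=
      ((measure_mono fun z hz => mem_closedBall_zero_iff.2 (hAR z hz)).trans_lt
          measure_closedBall_lt_top).ne
    have hVA : ∀ z ∈ A n, V z = ((V z).toReal : EReal) ∧ -c ≤ (V z).toReal ∧ (V z).toReal ≤ n := by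
      intro z hz
      have h1 := hV.le z
      have hz : V z ≤ ((n : ℝ) : EReal) := hz.1
      have h2 : V z = ((V z).toReal : EReal) :=
        (EReal.coe_toReal (hz.trans_lt (EReal.coe_lt_top _)).ne (hVb z).ne').symm
      rw [h2, EReal.coe_le_coe_iff] at h1 hz
      refine ⟨h2, le_trans ?_ h1, hz⟩
      have := hV.pos
      have : 0 ≤ (2 + δ) * Real.log (1 + ‖z‖) :=
        mul_nonneg (by linarith) (Real.log_nonneg (by linarith [norm_nonneg z]))
      linarith
    have hAae : ∀ᵐ z ∂(volume.restrict (A n)), z ∈ A n := ae_restrict_mem hAm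
    set ν := ProbabilityTheory.cond volume (A n) with hν
    have pν : IsProbabilityMeasure ν := ProbabilityTheory.cond_isProbabilityMeasure_of_finite h0 hAt
    have hνlog : Integrable (fun z => Real.log (1 + ‖z‖)) ν :=
      integrable_log_one_add_norm_of_bounded (ae_cond (hAae.mono fun z hz => hAR z hz))
    have hνβ : ∀ {β : Measure ℂ} [IsFiniteMeasure β], Integrable (fun z => Real.log (1 + ‖z‖)) β →
        HasFiniteMutualEnergy ν β := fun hβ =>
      (hasFiniteMutualEnergy_volume hAm hAR hβ).smul_left (ENNReal.inv_ne_top.2 h0)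
    have hνν := hνβ hνlog
    have hνE : HasFiniteEnergy V ν := by
      refine ⟨pν, ae_cond (hAae.mono fun z hz => (hVA z hz).1),
        Integrable.of_bound hVr.aestronglyMeasurable (|c| + n)
        (ae_cond (hAae.mono fun z hz => ?_)), hνlog, hνν.integrable, hνν.ae_ne⟩
      obtain ⟨-, h2, h3⟩ := hVA z hz
      rw [Real.norm_eq_abs, abs_le]
      constructor
      · linarith [le_abs_self c, Nat.cast_nonneg (α := ℝ) n]
      · linarith [abs_nonneg c]
    have hνμ := hνβ hμ.logInt
    have h1 := h.le_of_hasFiniteEnergy hμ hνE (mem_ae_iff.1 (ae_cond (hAae.mono fun z hz =>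
      subset_closure (hz.1.trans_lt (EReal.coe_lt_top _))))) hνμ.symm
    obtain ⟨i2, e2⟩ := hνμ.integral_pot_add hνE.integrable
    rw [← e2, ← hF] at h1
    have h2 : ∫ z, (F - (pot μ z + (V z).toReal / 2)) ∂ν = 0 := by
      refine le_antisymm ?_ (integral_nonneg_of_ae (ae_cond (hAae.mono fun z hz => ?_)))
      · rw [integral_sub (integrable_const F) i2]
        simp only [integral_const, probReal_univ, one_smul]
        linarith
      · exact sub_nonneg.2 hz.2.2.le
    have h3 := (integral_eq_zero_iff_of_nonneg_ae (ae_cond (hAae.mono fun z hz =>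
      sub_nonneg.2 hz.2.2.le)) ((integrable_const F).sub i2)).1 h2
    have h4 : ∀ᵐ z ∂ν, z ∈ A n := ae_cond hAae
    obtain ⟨z, hz1, hz2⟩ := (h3.and h4).exists
    have hz3 : F - (pot μ z + (V z).toReal / 2) = 0 := hz1
    linarith [hz2.2.2]
  have hU := measure_iUnion_null hnull
  filter_upwards [measure_eq_zero_iff_ae_notMem.1 hU] with z hz hzV
  by_contra hlt
  push Not at hlt
  refine hz (mem_iUnion.2 ?_)
  obtain ⟨b, hb, -⟩ := EReal.lt_iff_exists_real_btwn.1 hzV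
  obtain ⟨n, hn⟩ := exists_nat_ge (max b ‖z‖)
  exact ⟨n, hb.le.trans (EReal.coe_le_coe_iff.2 ((le_max_left _ _).trans hn)),
    (le_max_right _ _).trans hn, hlt⟩

end LogPotential

/-! ### Densities, sufficiency of the Frostman condition, perturbed potentials -/

namespace LogPotential

variable {V : ℂ → EReal} {μ ν : Measure ℂ} {f φ h : ℂ → ℝ} {S : Set ℂ} {δ c : ℝ}

/-- The measure with density the positive part of `φ / 4π`. -/
noncomputable def densityMeasure (φ : ℂ → ℝ) : Measure ℂ :=
  volume.withDensity fun z => ENNReal.ofReal (φ z / (4 * Real.pi))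

theorem integrable_densityMeasure (hφ : Measurable φ) (hh : Integrable fun z => h z * φ z) :
    Integrable h (densityMeasure φ) ∧
      (Integrable fun z => max (φ z / (4 * Real.pi)) 0 * h z) ∧
      ∫ z, h z ∂(densityMeasure φ) = ∫ z, max (φ z / (4 * Real.pi)) 0 * h z := by
  have hm : Measurable fun z => ENNReal.ofReal (φ z / (4 * Real.pi)) :=
    (hφ.div_const _).ennreal_ofReal
  have hpos : MeasurableSet {z | 0 < φ z} := measurableSet_lt measurable_const hφ
  have heq : ∀ z, (ENNReal.ofReal (φ z / (4 * Real.pi))).toReal • h z =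
      {z | 0 < φ z}.indicator (fun z => h z * φ z / (4 * Real.pi)) z := by
    intro z
    by_cases hz : 0 < φ z
    · have : 0 < φ z / (4 * Real.pi) := by positivity
      rw [indicator_of_mem (show z ∈ {z | 0 < φ z} from hz), ENNReal.toReal_ofReal this.le,
        smul_eq_mul]
      ring
    · have : φ z / (4 * Real.pi) ≤ 0 := div_nonpos_of_nonpos_of_nonneg (not_lt.1 hz) (by positivity)
      rw [indicator_of_notMem (show z ∉ {z | 0 < φ z} from hz), ENNReal.ofReal_of_nonpos this]
      simp
  have hint : Integrable fun z => (ENNReal.ofReal (φ z / (4 * Real.pi))).toReal • h z := by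
    simp_rw [heq]
    exact (hh.div_const _).indicator hpos
  refine ⟨?_, by simpa [ENNReal.toReal_ofReal'] using hint, ?_⟩
  · rwa [densityMeasure, integrable_withDensity_iff_integrable_smul' hm
      (ae_of_all _ fun _ => ENNReal.ofReal_lt_top)]
  · rw [densityMeasure, integral_withDensity_eq_integral_toReal_smul hm
      (ae_of_all _ fun _ => ENNReal.ofReal_lt_top)]
    simp [ENNReal.toReal_ofReal']

/-- Integrals against `μ - φ / 4π`. -/
theorem integral_of_add_densityMeasure
    (hν : ν + densityMeasure φ = μ + densityMeasure fun z => -φ z) (hφ : Measurable φ)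
    (hh : Integrable h μ) (hhφ : Integrable fun z => h z * φ z) :
    Integrable h ν ∧
      ∫ z, h z ∂ν = (∫ z, h z ∂μ) - 1 / (4 * Real.pi) * ∫ z, h z * φ z := by
  obtain ⟨i1, j1, e1⟩ := integrable_densityMeasure hφ hhφ
  have hhφ' : Integrable fun z => h z * -φ z := by
    simp_rw [mul_neg]
    exact hhφ.neg
  obtain ⟨i2, j2, e2⟩ := integrable_densityMeasure (φ := fun z => -φ z) hφ.neg hhφ'
  have hi : Integrable h (ν + densityMeasure φ) := by
    rw [hν]
    exact hh.add_measure i2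
  have iν : Integrable h ν := hi.mono_measure (Measure.le_add_right le_rfl)
  refine ⟨iν, ?_⟩
  have e3 : ∫ z, h z ∂(ν + densityMeasure φ) = ∫ z, h z ∂(μ + densityMeasure fun z => -φ z) := by
    rw [hν]
  rw [integral_add_measure iν i1, integral_add_measure hh i2] at e3
  -- Positive and negative parts of the density recombine; this replaces a calculus of signed
  -- measures.
  have e4 : (∫ z, max (φ z / (4 * Real.pi)) 0 * h z) - ∫ z, max (-φ z / (4 * Real.pi)) 0 * h z =
      1 / (4 * Real.pi) * ∫ z, h z * φ z := by
    rw [← integral_sub j1 j2, ← integral_const_mul]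
    congr 1
    funext z
    rw [← sub_mul, neg_div, max_zero_sub_eq_self]
    ring
  rw [e1, e2] at e3
  linarith

/-- The comparison concerns only the absolutely continuous part of `μ`, which `μ` dominates. -/
theorem densityMeasure_le (hφ : ∀ᵐ z, ENNReal.ofReal (φ z / (4 * Real.pi)) ≤ μ.rnDeriv volume z) :
    densityMeasure φ ≤ μ :=
  (withDensity_mono hφ).trans (Measure.withDensity_rnDeriv_le _ _)

theorem densityMeasure_compl_eq_zero (hS : MeasurableSet S) (h0 : ∀ z ∉ S, φ z = 0) :
    densityMeasure φ Sᶜ = 0 := by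
  rw [densityMeasure, withDensity_apply _ hS.compl]
  refine (setLIntegral_congr_fun hS.compl fun z hz => ?_).trans lintegral_zero
  simp [h0 z hz]

theorem densityMeasure_absolutelyContinuous : densityMeasure φ ≪ volume :=
  withDensity_absolutelyContinuous _ _

theorem densityMeasure_le_smul_volume {B : ℝ} (hB : ∀ z, |φ z| ≤ B) :
    densityMeasure φ ≤ ENNReal.ofReal (B / (4 * Real.pi)) • volume := by
  rw [← withDensity_const]
  refine withDensity_mono (ae_of_all _ fun z => ENNReal.ofReal_le_ofReal ?_)
  exact div_le_div_of_nonneg_right ((le_abs_self _).trans (hB z)) (by positivity)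

/-- A measure of finite weighted energy which satisfies the Frostman inequality, tested with all
measures of finite weighted energy, is the unique equilibrium measure. -/
theorem isEquilibriumMeasure_of_frostman (hV : IsConfining V δ c) (hν : HasFiniteEnergy V ν)
    (hνV : ν (potentialDomain V)ᶜ = 0)
    (h : ∀ ν', HasFiniteEnergy V ν' → ν' (potentialDomain V)ᶜ = 0 → HasFiniteMutualEnergy ν ν' ∧
      mutualEnergy ν ν + 1 / 2 * ∫ z, (V z).toReal ∂ν ≤
        mutualEnergy ν' ν + 1 / 2 * ∫ z, (V z).toReal ∂ν') :
    IsEquilibriumMeasure V ν ∧ ∀ ν', IsEquilibriumMeasure V ν' → ν' = ν := by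
  have pν := hν.isProbabilityMeasure
  -- Positive definiteness gives `D(ν', ν') + D(ν, ν) ≥ 2 D(ν', ν)`, with equality only for `ν' =
  -- ν`; add twice the Frostman inequality.
  have key : ∀ ν', HasFiniteEnergy V ν' → ν' (potentialDomain V)ᶜ = 0 →
      mutualEnergy ν ν + ∫ z, (V z).toReal ∂ν ≤ mutualEnergy ν' ν' + ∫ z, (V z).toReal ∂ν' ∧
      (mutualEnergy ν' ν' + ∫ z, (V z).toReal ∂ν' ≤ mutualEnergy ν ν + ∫ z, (V z).toReal ∂ν →
        ν' = ν) := by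
    intro ν' h' hν'V
    have pν' := h'.isProbabilityMeasure
    obtain ⟨h1, h2⟩ := h ν' h' hν'V
    obtain ⟨h3, h4⟩ := mutualEnergy_add_sub_nonneg ν' ν h'.integrable_log hν.integrable_log
      h1.symm.integrable h'.ae_ne hν.ae_ne h1.symm.ae_ne
    exact ⟨by linarith, fun h5 => h4 (by linarith)⟩
  refine ⟨⟨pν, hνV, fun ν' _ hν'V => ?_⟩, fun ν' h' => ?_⟩
  · by_cases htop : energy V ν' = ⊤
    · rw [htop]
      exact le_top
    · have h' := hV.hasFiniteEnergy htop
      rw [hν.energy_eq, h'.energy_eq, EReal.coe_le_coe_iff]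
      exact (key ν' h' hν'V).1
  · have hle := h'.energy_le ν pν hνV
    have pν' := h'.isProbabilityMeasure
    have hf : HasFiniteEnergy V ν' := hV.hasFiniteEnergy (hle.trans_lt (by
      rw [hν.energy_eq]
      exact EReal.coe_lt_top _)).ne
    rw [hν.energy_eq, hf.energy_eq, EReal.coe_le_coe_iff] at hle
    exact (key ν' hf h'.compl_domain).2 hle

theorem perturb_lt_top_iff (z : ℂ) : perturb V f z < ⊤ ↔ V z < ⊤ := by
  rw [perturb]
  induction V z with
  | bot => simp
  | coe x => simp [← EReal.coe_sub]
  | top => simp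

theorem potentialDomain_perturb : potentialDomain (perturb V f) = potentialDomain V := by
  simp only [potentialDomain, perturb_lt_top_iff]

theorem perturb_eq_of_eq_coe {z : ℂ} {x : ℝ} (h : V z = (x : EReal)) :
    perturb V f z = ((x - f z : ℝ) : EReal) := by
  rw [perturb, h, EReal.coe_sub]

theorem eq_of_perturb_eq_coe {z : ℂ} {x : ℝ} (h : perturb V f z = (x : EReal)) :
    V z = ((x + f z : ℝ) : EReal) := by
  rw [perturb] at h
  induction hz : V z with
  | bot => simp [hz] at h
  | coe y =>
    rw [hz, ← EReal.coe_sub, EReal.coe_eq_coe_iff] at h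
    rw [← h, sub_add_cancel]
  | top => simp [hz] at h

theorem HasFiniteEnergy.perturb (hν : HasFiniteEnergy V ν) (hf : Integrable f ν) :
    HasFiniteEnergy (perturb V f) ν ∧
      ∫ z, (LogPotential.perturb V f z).toReal ∂ν = (∫ z, (V z).toReal ∂ν) - ∫ z, f z ∂ν := by
  have h1 : ∀ᵐ z ∂ν, LogPotential.perturb V f z = (((V z).toReal - f z : ℝ) : EReal) :=
    hν.ae_eq.mono fun z hz => perturb_eq_of_eq_coe hz
  have h2 : ∀ᵐ z ∂ν, (LogPotential.perturb V f z).toReal = (V z).toReal - f z :=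
    h1.mono fun z hz => by rw [hz, EReal.toReal_coe]
  refine ⟨⟨hν.isProbabilityMeasure, ?_, (hν.integrable.sub hf).congr (h2.mono fun z hz => hz.symm),
    hν.logInt, hν.integrable_log, hν.ae_ne⟩, ?_⟩
  · filter_upwards [h1] with z hz
    rw [hz, EReal.toReal_coe]
  · rw [integral_congr_ae h2, integral_sub hν.integrable hf]

theorem HasFiniteEnergy.of_perturb (hν : HasFiniteEnergy (LogPotential.perturb V f) ν)
    (hf : Integrable f ν) : HasFiniteEnergy V ν := by
  have h1 : ∀ᵐ z ∂ν, V z = (((LogPotential.perturb V f z).toReal + f z : ℝ) : EReal) :=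
    hν.ae_eq.mono fun z hz => eq_of_perturb_eq_coe hz
  refine ⟨hν.isProbabilityMeasure, ?_, (hν.integrable.add hf).congr (h1.mono fun z hz => ?_),
    hν.logInt, hν.integrable_log, hν.ae_ne⟩
  · filter_upwards [h1] with z hz
    rw [hz, EReal.toReal_coe]
  · show _ = (V z).toReal
    rw [hz, EReal.toReal_coe]
    rfl

end LogPotential

/-! ### Construction of the perturbed measure -/

namespace LogPotential

variable {μ ν : Measure ℂ} {φ : ℂ → ℝ} {S : Set ℂ}

/-- Subtracting from `μ` a continuous density of mean zero, bounded by that of `μ`. -/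
theorem exists_add_densityMeasure_eq [IsProbabilityMeasure μ] (hμ : HasFinitePotential μ S)
    {M : ℝ≥0∞} (hM : M ≠ ∞)
    (hμM : ∀ w, ∫⁻ z, ENNReal.ofReal (Real.posLog (1 / ‖z - w‖)) ∂μ ≤ M)
    (hφ : Continuous φ) (hφS : tsupport φ ⊆ S) (hφ0 : ∫ z, φ z = 0)
    (hle : densityMeasure φ ≤ μ) :
    ∃ ν : Measure ℂ, IsProbabilityMeasure ν ∧
      ν + densityMeasure φ = μ + (densityMeasure fun z => -φ z) ∧ HasFinitePotential ν S ∧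
      (∀ A : Set ℂ, MeasurableSet A →
        ν.real A = μ.real A - 1 / (4 * Real.pi) * ∫ z in A, φ z) ∧
      (∀ z, pot ν z = pot μ z + 1 / (4 * Real.pi) * ∫ w, Real.log ‖z - w‖ * φ w) ∧
      ∃ M' : ℝ≥0∞, M' ≠ ∞ ∧
        ∀ w, ∫⁻ z, ENNReal.ofReal (Real.posLog (1 / ‖z - w‖)) ∂ν ≤ M' := by
  have hcs : HasCompactSupport φ := hμ.isCompact.of_isClosed_subset (isClosed_tsupport φ) hφS
  have hint : Integrable φ := hφ.integrable_of_hasCompactSupport hcs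
  have hS0 : ∀ z ∉ S, φ z = 0 := fun z hz => image_eq_zero_of_notMem_tsupport fun h => hz (hφS h)
  obtain ⟨B, hB⟩ := hcs.exists_bound_of_continuous hφ
  -- The negative part of the density only adds mass, with a bounded density, so it keeps the
  -- singular potential bounded.
  have hN : densityMeasure (fun z => -φ z) ≤ ENNReal.ofReal (B / (4 * Real.pi)) • volume :=
    densityMeasure_le_smul_volume fun z => by
      rw [abs_neg]
      exact hB z
  have fP : IsFiniteMeasure (densityMeasure φ) := isFiniteMeasure_of_le μ hle
  have fN : IsFiniteMeasure (densityMeasure fun z => -φ z) :=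
    isFiniteMeasure_withDensity_ofReal (hint.neg.div_const (4 * Real.pi)).hasFiniteIntegral
  set N := densityMeasure fun z => -φ z with hNdef
  -- Subtraction of measures is truncated in general; domination by `μ` makes it exact here.
  have hadd : μ - densityMeasure φ + N + densityMeasure φ = μ + N := by
    rw [add_right_comm, Measure.sub_add_cancel_of_le hle]
  set ν := μ - densityMeasure φ + N with hν
  have hνle : ν ≤ μ + N := by
    rw [← hadd]
    exact Measure.le_add_right le_rfl
  have fν : IsFiniteMeasure ν := isFiniteMeasure_of_le (μ + N) hνle
  have hset : ∀ A : Set ℂ, MeasurableSet A →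
      ν.real A = μ.real A - 1 / (4 * Real.pi) * ∫ z in A, φ z := by
    intro A hA
    have hmul : ∀ z, A.indicator (fun _ => (1 : ℝ)) z * φ z = A.indicator φ z := fun z => by
      by_cases hz : z ∈ A <;> simp [hz]
    have h1 := (integral_of_add_densityMeasure (h := A.indicator fun _ => (1 : ℝ)) hadd
      hφ.measurable ((integrable_const _).indicator hA) (by
        simp_rw [hmul]
        exact hint.indicator hA)).2
    simp_rw [hmul] at h1
    rw [integral_indicator hA, integral_indicator hA, integral_indicator hA] at h1
    simpa using h1
  have hlog : ∀ z, Integrable (fun w => Real.log ‖z - w‖) ν ∧ ∫ w, Real.log ‖z - w‖ ∂ν =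
      (∫ w, Real.log ‖z - w‖ ∂μ) - 1 / (4 * Real.pi) * ∫ w, Real.log ‖z - w‖ * φ w := fun z =>
    integral_of_add_densityMeasure hadd hφ.measurable (hμ.integrable z)
      (integrable_log_norm_sub_mul hφ hcs z)
  refine ⟨ν, ⟨?_⟩, hadd, ⟨hμ.isCompact, ?_, fun z => (hlog z).1, fun z => ?_⟩, hset, fun z => ?_,
    M + ENNReal.ofReal (B / (4 * Real.pi)) * ∫⁻ z : ℂ, ENNReal.ofReal (Real.posLog (1 / ‖z‖)),
    ?_, fun w => ?_⟩
  · have h1 := hset univ MeasurableSet.univ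
    rw [setIntegral_univ, hφ0, mul_zero, sub_zero, probReal_univ (μ := μ)] at h1
    rw [← ENNReal.ofReal_toReal (measure_ne_top ν univ), ← Measure.real, h1, ENNReal.ofReal_one]
  · refine le_antisymm ((hνle _).trans ?_) zero_le
    rw [Measure.add_apply, hμ.compl_eq_zero, zero_add, hNdef,
      densityMeasure_compl_eq_zero hμ.isCompact.measurableSet fun z hz => by rw [hS0 z hz, neg_zero]]
  · refine le_antisymm ((hνle _).trans ?_) zero_le
    rw [Measure.add_apply, hμ.noAtoms, zero_add, hNdef,
      densityMeasure_absolutelyContinuous (measure_singleton z)]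
  · rw [pot, pot, integral_neg, integral_neg, (hlog z).2]
    ring
  · exact ENNReal.add_ne_top.2
      ⟨hM, ENNReal.mul_ne_top ENNReal.ofReal_ne_top lintegral_posLog_volume_ne_top⟩
  · refine (lintegral_mono' hνle le_rfl).trans ?_
    rw [lintegral_add_measure]
    refine add_le_add (hμM w) ((lintegral_mono' hN le_rfl).trans ?_)
    rw [lintegral_smul_measure, smul_eq_mul]
    exact mul_le_mul' le_rfl (by simpa using lintegral_posLog_le_volume univ w)

end LogPotential

/-! ### The proposition -/

theorem proposition3p1
    (V : ℂ → EReal) (hV : IsAdmissible V)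
    (μ : Measure ℂ) (hμ : IsEquilibriumMeasure V μ)
    -- near the support of `μ`, `V` is a `C^{1,1}` function `g` on `Σ_V` (and `+∞` off `Σ_V`)
    (U : Set ℂ) (hU : IsOpen U) (hμU : μ.support ⊆ U)
    (g : ℂ → ℝ) (hg : IsLocallyC11On g U)
    (hVg : ∀ z ∈ U ∩ potentialDomain V, V z = ((g z : ℝ) : EReal))
    (f : ℂ → ℝ) (hf : ContDiff ℝ 2 f) (hfb : ∃ C : ℝ, ∀ z, |f z| ≤ C)
    (hfsupp : tsupport (Laplacian.laplacian f) ⊆ μ.support)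
    (hfg : ∀ᵐ z ∂(volume.restrict μ.support), Laplacian.laplacian f z ≤ Laplacian.laplacian g z) :
    Integrable (Laplacian.laplacian f) ∧
    ∃ ν : Measure ℂ,
      -- `ν` is the unique equilibrium measure of `V - f`
      (IsEquilibriumMeasure (perturb V f) ν ∧
        ∀ ν' : Measure ℂ, IsEquilibriumMeasure (perturb V f) ν' → ν' = ν) ∧
      (∀ A : Set ℂ, MeasurableSet A →
        ν.real A = μ.real A - 1 / (4 * Real.pi) * ∫ z in A, Laplacian.laplacian f z) ∧
      ν.support ⊆ μ.support ∧
      -- the constants in the effective potentials and the energies are finite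
      (∃ c : ℝ, equilibriumConstant V μ = (c : EReal)) ∧
      (∃ c : ℝ, equilibriumConstant (perturb V f) ν = (c : EReal)) ∧
      (∃ c : ℝ, energy V μ = (c : EReal)) ∧
      (∀ z : ℂ, effectivePotential (perturb V f) ν z =
        effectivePotential V μ z) ∧
      energy (perturb V f) ν =
        energy V μ - ((∫ z, f z ∂μ : ℝ) : EReal) -
          ((1 / (8 * Real.pi) * ∫ z, f z * -(Laplacian.laplacian f z) : ℝ) : EReal) := by
  have pμ := hμ.isProbabilityMeasure
  obtain ⟨δ, c₀, hconf⟩ := hV.exists_isConfining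
  have hμE := hμ.hasFiniteEnergy hconf hV.capacity
  set S := μ.support with hS
  have hSdom : S ⊆ potentialDomain V :=
    Measure.support_subset_of_isClosed isClosed_closure (mem_ae_iff.2 hμ.compl_domain)
  have hVS : ∀ z ∈ S, V z = ((g z : ℝ) : EReal) := fun z hz => hVg z ⟨hμU hz, hSdom hz⟩
  have hgS : ∀ z ∈ S, ContinuousAt g z := fun z hz =>
    ((hg.1 z (hμU hz)).differentiableAt (hU.mem_nhds (hμU hz))).continuousAt
  obtain ⟨F, hF⟩ : ∃ F, F = mutualEnergy μ μ + 1 / 2 * ∫ z, (V z).toReal ∂μ := ⟨_, rfl⟩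
  obtain ⟨hpot, hle, M, hM, hμM⟩ := hμ.hasFinitePotential hμE hconf hF hVS hgS
  have hSm : MeasurableSet S := hpot.isCompact.measurableSet
  have : NeZero μ := ⟨IsProbabilityMeasure.ne_zero μ⟩
  -- On `S` the upper bound holds everywhere and the lower one almost everywhere for area measure.
  have hEvol : ∀ᵐ z ∂(volume.restrict S), effPot μ g F z = 0 := by
    filter_upwards [ae_restrict_of_ae (hμ.ae_le_pot_add hμE hconf hF), ae_restrict_mem hSm]
      with z hz hzS
    have h1 := hz (by rw [hVS z hzS]; exact EReal.coe_lt_top _)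
    rw [hVS z hzS, EReal.toReal_coe] at h1
    refine le_antisymm (hle z hzS) ?_
    rw [effPot]
    linarith
  have hEμ : ∀ᵐ z ∂μ, effPot μ g F z = 0 := by
    filter_upwards [hμ.ae_pot_add_eq hμE, hpot.ae_mem] with z hz hzS
    rw [hVS z hzS, EReal.toReal_coe, ← hF] at hz
    rw [effPot, hz, sub_self]
  set φ := Laplacian.laplacian f with hφ
  have hφc : Continuous φ := continuous_laplacian hf
  have hcs : HasCompactSupport φ := hpot.isCompact.of_isClosed_subset (isClosed_tsupport φ) hfsupp
  have hφi : Integrable φ := hφc.integrable_of_hasCompactSupport hcs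
  have hφ0 : ∀ z ∉ S, φ z = 0 := fun z hz =>
    image_eq_zero_of_notMem_tsupport fun h => hz (hfsupp h)
  obtain ⟨C, hC⟩ := hfb
  obtain ⟨hmean, c, hfc⟩ := exists_eq_const_add_log_potential hf hC hcs
  -- The positivity of `ν`: the density of `μ` is at least `Δg/4π` on `S`, and `Δf ≤ Δg` there.
  have hdens : densityMeasure φ ≤ μ := by
    refine densityMeasure_le ?_
    have h1 := ae_laplacian_le_rnDeriv hpot hpot.nonempty hU hμU hg hle hEvol
    rw [ae_restrict_iff' hSm] at h1 hfg
    filter_upwards [h1, hfg] with z h1 h2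
    by_cases hz : z ∈ S
    · refine le_trans (ENNReal.ofReal_le_ofReal ?_) (h1 hz)
      exact div_le_div_of_nonneg_right (h2 hz) (by positivity)
    · simp [hφ0 z hz]
  obtain ⟨ν, pν, hadd, hνpot, hset, hνμ, M', hM', hνM⟩ :=
    exists_add_densityMeasure_eq hpot hM hμM hφc hfsupp hmean hdens
  -- The kernel coefficient `1/4π` is half of the `1/2π` in the representation of `f`, which leaves
  -- `(f - c)/2`.
  have hpotν : ∀ z, pot ν z = pot μ z + (f z - c) / 2 := fun z => by
    rw [hνμ, hfc z]
    field_simp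
    ring
  -- `ν` is dominated by `μ` plus an absolutely continuous measure on `S`; the effective potential
  -- vanishes almost everywhere for both.
  have hEν : ∀ᵐ z ∂ν, z ∈ S ∧ pot μ z + g z / 2 = F := by
    have h1 : ν ≤ μ + densityMeasure fun z => -φ z := by
      rw [← hadd]
      exact Measure.le_add_right le_rfl
    have h2 : ∀ᵐ z ∂(densityMeasure fun z => -φ z), effPot μ g F z = 0 := by
      rw [ae_restrict_iff' hSm] at hEvol
      filter_upwards [densityMeasure_absolutelyContinuous.ae_le hEvol,
        mem_ae_iff.2 (densityMeasure_compl_eq_zero (φ := fun z => -φ z) hSm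
          fun z hz => by rw [hφ0 z hz, neg_zero])] with z h3 h4 using h3 h4
    filter_upwards [hνpot.ae_mem, ae_mono h1 (ae_add_measure_iff.2 ⟨hEμ, h2⟩)] with z h3 h4
    rw [effPot] at h4
    exact ⟨h3, by linarith⟩
  -- The singular potentials of `μ` and `ν` are uniformly bounded, so every competitor with a
  -- logarithmic moment has finite mutual energy with them.
  have hmut : ∀ β : Measure ℂ, IsProbabilityMeasure β →
      Integrable (fun z => Real.log (1 + ‖z‖)) β →
      HasFiniteMutualEnergy μ β ∧ HasFiniteMutualEnergy ν β := fun β _ hβ =>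
    ⟨hasFiniteMutualEnergy_of_bounded hpot.logInt hβ hM hμM hpot.noAtoms,
      hasFiniteMutualEnergy_of_bounded hνpot.logInt hβ hM' hνM hνpot.noAtoms⟩
  obtain ⟨hμν, hνν⟩ := hmut ν pν hνpot.logInt
  have hfint : ∀ β : Measure ℂ, IsProbabilityMeasure β → Integrable f β := fun β _ =>
    Integrable.of_bound hf.continuous.aestronglyMeasurable C (ae_of_all _ hC)
  have hmutν : ∀ β : Measure ℂ, IsProbabilityMeasure β →
      Integrable (fun z => Real.log (1 + ‖z‖)) β →
      mutualEnergy β ν = mutualEnergy β μ + 1 / 2 * (∫ z, f z ∂β) - c / 2 := by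
    intro β pβ hβ
    obtain ⟨h1, h2⟩ := hmut β pβ hβ
    obtain ⟨i1, e1⟩ := h1.symm.mutualEnergy_eq
    rw [e1, h2.symm.mutualEnergy_eq.2]
    simp_rw [hpotν, sub_div]
    have i2 : Integrable (fun z => f z / 2) β := (hfint β pβ).div_const 2
    have i3 : Integrable (fun z => f z / 2 - c / 2) β := i2.sub (integrable_const _)
    rw [integral_add i1 i3, integral_sub i2 (integrable_const _),
      integral_div]
    simp only [integral_const, probReal_univ, one_smul]
    ring
  have hVν : ∀ᵐ z ∂ν, V z = ((V z).toReal : EReal) ∧ (V z).toReal = 2 * (F - pot μ z) := by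
    filter_upwards [hEν] with z hz
    rw [hVS z hz.1, EReal.toReal_coe]
    exact ⟨rfl, by linarith [hz.2]⟩
  obtain ⟨iνμ, eνμ⟩ := hμν.symm.mutualEnergy_eq
  have iF : Integrable (fun z => 2 * (F - pot μ z)) ν :=
    ((integrable_const F).sub iνμ).const_mul 2
  have hνE : HasFiniteEnergy V ν :=
    ⟨pν, hVν.mono fun z hz => hz.1, iF.congr (hVν.mono fun z hz => hz.2.symm), hνpot.logInt,
      hνν.integrable, hνν.ae_ne⟩
  have hVint : ∫ z, (V z).toReal ∂ν = 2 * F - 2 * mutualEnergy ν μ := by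
    rw [integral_congr_ae (hVν.mono fun z hz => hz.2), integral_const_mul,
      integral_sub (integrable_const F) iνμ, eνμ]
    simp only [integral_const, probReal_univ, one_smul]
    ring
  obtain ⟨hνW, hWint⟩ := hνE.perturb (hfint ν pν)
  have hDν := hmutν ν pν hνpot.logInt
  have hDμ := hmutν μ pμ hpot.logInt
  rw [mutualEnergy_comm μ ν] at hDμ
  -- The equilibrium constant of `V - f` is `F - c/2`: the same shift as in the potential.
  have hconst : mutualEnergy ν ν + 1 / 2 * ∫ z, (perturb V f z).toReal ∂ν = F - c / 2 := by
    rw [hWint, hVint, hDν]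
    ring
  have hfν : ∫ z, f z ∂ν = (∫ z, f z ∂μ) - 1 / (4 * Real.pi) * ∫ z, f z * φ z :=
    (integral_of_add_densityMeasure hadd hφc.measurable (hfint μ pμ)
      ((hf.continuous.mul hφc).integrable_of_hasCompactSupport hcs.mul_left)).2
  have hνdom : ν (potentialDomain (perturb V f))ᶜ = 0 := by
    rw [potentialDomain_perturb]
    exact measure_mono_null (compl_subset_compl.2 hSdom) hνpot.compl_eq_zero
  refine ⟨hφi, ν, ?_, hset, Measure.support_subset_of_isClosed hpot.isCompact.isClosed
    hνpot.ae_mem, ⟨_, hμE.equilibriumConstant_eq⟩, ⟨_, hνW.equilibriumConstant_eq⟩,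
    ⟨_, hμE.energy_eq⟩, fun z => ?_, ?_⟩
  -- In the tested inequality the `f` terms cancel and both sides shift by `-c/2`, so it is the
  -- first variation of `V` at `μ`.
  · refine isEquilibriumMeasure_of_frostman (hconf.perturb hf.continuous.measurable hC) hνW hνdom
      fun ν' hν' hν'dom => ?_
    have pν' := hν'.isProbabilityMeasure
    have hν'V := hν'.of_perturb (hfint ν' pν')
    rw [potentialDomain_perturb] at hν'dom
    obtain ⟨h1, h2⟩ := hmut ν' pν' hν'.logInt
    refine ⟨h2, ?_⟩
    rw [hconst, hmutν ν' pν' hν'.logInt, (hν'V.perturb (hfint ν' pν')).2, hF]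
    linarith [hμ.le_of_hasFiniteEnergy hμE hν'V hν'dom h1]
  · rw [effectivePotential, effectivePotential, hνW.equilibriumConstant_eq,
      hμE.equilibriumConstant_eq, hconst, ← hF, logPotential_eq (hpot.integrable z) (hpot.ae_ne z),
      logPotential_eq (hνpot.integrable z) (hνpot.ae_ne z), hpotν, perturb]
    induction hz : V z with
    | bot => exact absurd hz (hV.ne_bot z)
    | coe x =>
      rw [← EReal.coe_sub, ← EReal.coe_mul, ← EReal.coe_mul, ← EReal.coe_add, ← EReal.coe_add,
        ← EReal.coe_sub, ← EReal.coe_sub]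
      congr 1
      ring
    | top =>
      rw [EReal.top_sub_coe, EReal.coe_mul_top_of_pos (by norm_num), EReal.coe_add_top,
        EReal.coe_add_top, EReal.top_sub_coe, EReal.top_sub_coe]
  -- The constant `c` cancels between `hDν` and `hDμ`, leaving `I_V(μ) - (∫ f dμ + ∫ f dν)/2`; `hfν`
  -- turns this into the stated formula.
  · rw [hνW.energy_eq, hμE.energy_eq, ← EReal.coe_sub, ← EReal.coe_sub]
    congr 1
    simp_rw [mul_neg]
    rw [integral_neg, hWint, hVint, hDν, hfν, hDμ, hF]
    field_simp
    ring
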